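/- **Setting.** A slim heap represents a heap by a heap-ordered rooted tree whose nodes are the items and in which the children of each node form an ordered list (leftmost first); keys come from a totally ordered set. Linking two roots makes the root of larger key (the loser) the new leftmost child of the root of smaller key (the winner). In an insertion, meld or decrease-key, a tie between the two keys is broken arbitrarily. The operations are: make-heap (create an empty heap); find-min (return the root); insert (link the new one-node tree with the root, if the heap is nonempty); meld (link the two roots, if both heaps are nonempty); decrease-key of $e$ to a key at most its current key (change the key; if $e$ is not the root, cut $e$ from its parent and link it with the root); delete-min (delete the root, so that its list of children becomes a list of roots, and reduce this list to one root by leftmost locally maximum linking: while at least two roots remain, find the leftmost root $v$ whose key is at least the keys of its neighbors on the list, where a missing neighbor counts as having key $-\infty$, and link $v$ with its neighbor of larger key, the left one if both neighbors have the same key; $v$ loses the link and leaves the list, the winner keeps its position). A general delete is done as a decrease-key to $-\infty$ followed by a delete-min. The time of an operation is one, plus one for each link and each cut, plus, in a delete-min, one for each move to the right in the standard left-to-right scan of the root list that finds the locally maximum roots (if the current root is locally maximum, link it as above and make the winner the current root; otherwise move to its right neighbor). In a given finite sequence of operations, call a node temporary if it is eventually deleted. For an operation on a heap, let $n$ be the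 maximum of $8$ and the number of temporary nodes in this heap just before the operation; in particular $n$ is at most the maximum of $8$ and the number of items in the heap. Let $\lg x=\max\{\log_2 x,0\}$. **Theorem.** There is an absolute constant $C>0$ such that for every finite sequence of slim heap operations that starts with no heaps: (i) the total number of links done is at most $C$ times the sum of $1$ for each insertion, $\lg\lg n$ for each decrease-key, and $\lg n$ for each delete-min, where $n$ is the value for that operation; (ii) the total time of the sequence is at most $C$ times the sum of $\lg n$ for each delete-min, $\lg\lg n$ for each decrease-key, and $1$ for each other operation. That is, slim heaps support delete-min in $O(\log n)$, decrease-key in $O(\log\log n)$, and make-heap, find-min, insert and meld in $O(1)$ amortized time. -/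

import Mathlib

namespace SlimHeap

/-! ### States: a collection of heaps, each a heap-ordered tree with ordered lists of children -/

/-- A collection of disjoint heaps. `H` is the type of heap handles, `I` the type of items (the
nodes of the trees), `K` the key space.
* `root h = none`: there is no heap with handle `h`;
  `root h = some none`: the heap `h` is empty;
  `root h = some (some r)`: the heap `h` is the tree with root `r`.
* `children v`: the ordered list of children of `v`, leftmost first.
* `key v`: the key of `v`. -/
structure State (H I K : Type*) where
  root : H → Option (Option I)
  children : I → List I
  key : I → K

/-- There are no heaps. -/
def State.NoHeaps {H I K : Type*} (s : State H I K) : Prop :=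
  (∀ h, s.root h = none) ∧ ∀ v, s.children v = []

/-- The item `x` is in the heap `h`: it is the root of `h` or a descendant of it. -/
def State.Mem {H I K : Type*} (s : State H I K) (h : H) (x : I) : Prop :=
  ∃ r, s.root h = some (some r) ∧ Relation.ReflTransGen (fun v w => w ∈ s.children v) r x

/-! ### Links and cuts -/

/-- The link `vw` won by `v`: the loser `w` becomes the new leftmost child of the winner `v`. -/
def link {I : Type*} [DecidableEq I] (c : I → List I) (v w : I) : I → List I :=
  Function.update c v (w :: c v)

/-- Cut the child `w` from its parent. -/
def cut {I : Type*} [DecidableEq I] (c : I → List I) (w : I) : I → List I :=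
  fun p => (c p).erase w

/-- The link of two roots `x` and `y` done by an insertion, a meld or a decrease-key: the root of
smaller key wins, ties are broken arbitrarily. The last two arguments are the winner and the
children lists after the link. -/
inductive RootLink {I K : Type*} [DecidableEq I] [LinearOrder K] (key : I → K)
    (c : I → List I) (x y : I) : I → (I → List I) → Prop
  | first (h : key x ≤ key y) : RootLink key c x y x (link c x y)
  | second (h : key y ≤ key x) : RootLink key c x y y (link c y x)

/-! ### Leftmost locally maximum linking -/

/-- On the root list `pre ++ v :: post`, the key of `v` is at least the keys of its neighbors
(a missing neighbor counts as one of key `-∞`). -/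
def LocalMax {I K : Type*} [LinearOrder K] (key : I → K) (pre : List I) (v : I)
    (post : List I) : Prop :=
  (∀ u ∈ pre.getLast?, key u ≤ key v) ∧ (∀ w ∈ post.head?, key w ≤ key v)

/-- On the root list `pre ++ v :: post`, the root `v` is the leftmost local maximum. -/
def LeftmostLocalMax {I K : Type*} [LinearOrder K] (key : I → K) (pre : List I) (v : I)
    (post : List I) : Prop :=
  LocalMax key pre v post ∧
    ∀ pre' u post', pre = pre' ++ u :: post' → ¬ LocalMax key pre' u (post' ++ v :: post)

/-- One link of a delete-min: the leftmost local maximum `v` is linked with its neighbor of larger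
key, the left one if both neighbors have the same key. The root `v` loses the link and leaves the
root list; the winner keeps its position and gets `v` as its new leftmost child.
`LinkStep key l c l' c'`: the root list and the children lists are `l`, `c` before the link and
`l'`, `c'` after it. -/
inductive LinkStep {I K : Type*} [DecidableEq I] [LinearOrder K] (key : I → K) :
    List I → (I → List I) → List I → (I → List I) → Prop
  | withLeft (pre : List I) (u v : I) (post : List I) (c : I → List I)
      (hv : LeftmostLocalMax key (pre ++ [u]) v post)
      (hu : ∀ w ∈ post.head?, key w ≤ key u) :
      LinkStep key (pre ++ u :: v :: post) c (pre ++ u :: post) (link c u v)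
  | withRight (pre : List I) (v w : I) (post : List I) (c : I → List I)
      (hv : LeftmostLocalMax key pre v (w :: post))
      (hw : ∀ u ∈ pre.getLast?, key u < key w) :
      LinkStep key (pre ++ v :: w :: post) c (pre ++ w :: post) (link c w v)

/-- Repeat leftmost locally maximum links until only one root remains.
`LinkAll key l c m r c'`: starting from the root list `l` and the children lists `c`, this does
`m` links and ends with the single root `r` and the children lists `c'`. -/
inductive LinkAll {I K : Type*} [DecidableEq I] [LinearOrder K] (key : I → K) :
    List I → (I → List I) → ℕ → I → (I → List I) → Prop
  | one (r : I) (c : I → List I) : LinkAll key [r] c 0 r c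
  | step {l : List I} {c : I → List I} {l' : List I} {c₁ : I → List I} {m : ℕ} {r : I}
      {c' : I → List I} (h₁ : LinkStep key l c l' c₁) (h₂ : LinkAll key l' c₁ m r c') :
      LinkAll key l c (m + 1) r c'

/-! ### The implementation of leftmost locally maximum linking by a scan of the root list -/

/-- The outcome of the scan: last root, children lists, number of links, number of steps. -/
structure ScanResult (I : Type*) where
  root : I
  children : I → List I
  links : ℕ
  steps : ℕ

/-- The result of a scan that begins with a link. -/
def ScanResult.afterLink {I : Type*} (x : ScanResult I) : ScanResult I :=
  ⟨x.root, x.children, x.links + 1, x.steps + 1⟩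

/-- The result of a scan that begins with a move of the current root. -/
def ScanResult.afterMove {I : Type*} (x : ScanResult I) : ScanResult I :=
  ⟨x.root, x.children, x.links, x.steps + 1⟩

/-- The scan. The first three arguments are the roots left of the current root (nearest first),
the current root, and the roots right of it (nearest first). If the current root is a local
maximum, link it with its neighbor of larger key and make the winner the current root; otherwise
make its right neighbor the current root. Each step takes at most two comparisons and a constant
number of pointer changes. (A root is only left behind if its right neighbor has larger key, so
that a rightmost current root is always a local maximum and need not be compared.) -/
def scan {I K : Type*} [DecidableEq I] [LinearOrder K] (key : I → K) :
    List I → I → List I → (I → List I) → ScanResult I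
  | [], v, [], c => ⟨v, c, 0, 0⟩
  | u :: L, v, [], c => (scan key L u [] (link c u v)).afterLink
  | [], v, w :: R, c =>
      if key w ≤ key v then (scan key [] w R (link c w v)).afterLink
      else (scan key [v] w R c).afterMove
  | u :: L, v, w :: R, c =>
      if key u ≤ key v ∧ key w ≤ key v then
        if key w ≤ key u then (scan key L u (w :: R) (link c u v)).afterLink
        else (scan key (u :: L) w R (link c w v)).afterLink
      else (scan key (v :: u :: L) w R c).afterMove
  termination_by L _ R _ => L.length + 2 * R.length

/-! ### Heap operations -/

/-- The heap operations, with their arguments. The heap returned by a meld gets the handle of the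
first of the two melded heaps. -/
inductive Op (H I K : Type*) where
  | makeHeap (h : H)
  | findMin (h : H)
  | insert (h : H) (e : I) (k : K)
  | deleteMin (h : H)
  | meld (h₁ h₂ : H)
  | decreaseKey (h : H) (e : I) (k : K)

/-- The slim heap operations. `Step s o m τ s'`: in the state `s` the operation `o` is allowed,
it does `m` links and takes time `τ`, and it can lead to the state `s'`. The time is one for the
operation itself, plus one for each link, each cut, and each move to a right neighbor in the scan
of a delete-min. -/
inductive Step {H I K : Type*} [DecidableEq H] [DecidableEq I] [LinearOrder K] :
    State H I K → Op H I K → ℕ → ℕ → State H I K → Prop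
  | makeHeap (s : State H I K) (h : H) (hh : s.root h = none) :
      Step s (.makeHeap h) 0 1 { s with root := Function.update s.root h (some none) }
  | findMin (s : State H I K) (h : H) (x : Option I) (hh : s.root h = some x) :
      Step s (.findMin h) 0 1 s
  | insertEmpty (s : State H I K) (h : H) (e : I) (k : K)
      (he : ∀ h', ¬ s.Mem h' e) (hh : s.root h = some none) :
      Step s (.insert h e k) 0 1
        ⟨Function.update s.root h (some (some e)), Function.update s.children e [],
          Function.update s.key e k⟩
  | insertLink (s : State H I K) (h : H) (e : I) (k : K) (r r' : I) (c' : I → List I)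
      (he : ∀ h', ¬ s.Mem h' e) (hh : s.root h = some (some r))
      (hl : RootLink (Function.update s.key e k) (Function.update s.children e []) r e r' c') :
      Step s (.insert h e k) 1 2
        ⟨Function.update s.root h (some (some r')), c', Function.update s.key e k⟩
  | meldRightEmpty (s : State H I K) (h₁ h₂ : H) (x : Option I) (hne : h₁ ≠ h₂)
      (hh₁ : s.root h₁ = some x) (hh₂ : s.root h₂ = some none) :
      Step s (.meld h₁ h₂) 0 1 { s with root := Function.update s.root h₂ none }
  | meldLeftEmpty (s : State H I K) (h₁ h₂ : H) (x : Option I) (hne : h₁ ≠ h₂)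
      (hh₁ : s.root h₁ = some none) (hh₂ : s.root h₂ = some x) :
      Step s (.meld h₁ h₂) 0 1
        { s with root := Function.update (Function.update s.root h₂ none) h₁ (some x) }
  | meldLink (s : State H I K) (h₁ h₂ : H) (r₁ r₂ r' : I) (c' : I → List I) (hne : h₁ ≠ h₂)
      (hh₁ : s.root h₁ = some (some r₁)) (hh₂ : s.root h₂ = some (some r₂))
      (hl : RootLink s.key s.children r₁ r₂ r' c') :
      Step s (.meld h₁ h₂) 1 2
        ⟨Function.update (Function.update s.root h₂ none) h₁ (some (some r')), c', s.key⟩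
  | decreaseKeyRoot (s : State H I K) (h : H) (e : I) (k : K)
      (hh : s.root h = some (some e)) (hk : k ≤ s.key e) :
      Step s (.decreaseKey h e k) 0 1 { s with key := Function.update s.key e k }
  | decreaseKeyLink (s : State H I K) (h : H) (e : I) (k : K) (r r' : I) (c' : I → List I)
      (he : s.Mem h e) (hh : s.root h = some (some r)) (hne : e ≠ r) (hk : k ≤ s.key e)
      (hl : RootLink (Function.update s.key e k) (cut s.children e) r e r' c') :
      Step s (.decreaseKey h e k) 1 3
        ⟨Function.update s.root h (some (some r')), c', Function.update s.key e k⟩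
  | deleteMinLast (s : State H I K) (h : H) (r : I)
      (hh : s.root h = some (some r)) (hc : s.children r = []) :
      Step s (.deleteMin h) 0 1 { s with root := Function.update s.root h (some none) }
  | deleteMinLink (s : State H I K) (h : H) (r v : I) (R : List I) (m : ℕ) (r' : I)
      (c' : I → List I)
      (hh : s.root h = some (some r)) (hc : s.children r = v :: R)
      (hl : LinkAll s.key (v :: R) (Function.update s.children r []) m r' c') :
      Step s (.deleteMin h) m
        (1 + (scan s.key [] v R (Function.update s.children r [])).steps)
        ⟨Function.update s.root h (some (some r')), c', s.key⟩

/-- A sequence of `T` slim heap operations starting with no heaps: `op t`, for `t < T`, is done in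
`state t`; it does `links t` links, takes time `time t` and leads to `state (t + 1)`. -/
structure Execution (H I K : Type*) [DecidableEq H] [DecidableEq I] [LinearOrder K] where
  T : ℕ
  state : ℕ → State H I K
  op : ℕ → Op H I K
  links : ℕ → ℕ
  time : ℕ → ℕ
  start : (state 0).NoHeaps
  step : ∀ t < T, Step (state t) (op t) (links t) (time t) (state (t + 1))

namespace Execution

variable {H I K : Type*} [DecidableEq H] [DecidableEq I] [LinearOrder K]

/-- A node `x` that is in a heap just before operation `t` is temporary if it is eventually
deleted: some delete-min from then on deletes it. -/
def Temporary (E : Execution H I K) (t : ℕ) (x : I) : Prop :=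
  ∃ t' < E.T, t ≤ t' ∧ ∃ h, E.op t' = .deleteMin h ∧ (E.state t').root h = some (some x)

/-- The number of temporary nodes in the heap `h` just before operation `t`, but at least `8`. -/
noncomputable def n (E : Execution H I K) (t : ℕ) (h : H) : ℕ :=
  max 8 (Set.ncard {x | (E.state t).Mem h x ∧ E.Temporary t x})

end Execution

/-- `lg x = max {log₂ x, 0}`. -/
noncomputable def lg (x : ℝ) : ℝ := max (Real.logb 2 x) 0

namespace Execution

variable {H I K : Type*} [DecidableEq H] [DecidableEq I] [LinearOrder K]

/-- The amount that operation `t` contributes to the bound: `lg n` for a delete-min, `lg lg n` for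
a decrease-key, `1` for an insertion, and `a` for every other operation. -/
noncomputable def charge (E : Execution H I K) (a : ℝ) (t : ℕ) : ℝ :=
  match E.op t with
  | .insert _ _ _ => 1
  | .decreaseKey h _ _ => lg (lg (E.n t h))
  | .deleteMin h => lg (E.n t h)
  | .makeHeap _ => a
  | .findMin _ => a
  | .meld _ _ => a

end Execution

/-! ### The scan does leftmost locally maximum linking -/

theorem not_localMax_of_chain {I K : Type*} [LinearOrder K] {key : I → K} {L : List I}
    {v : I} (hL : (v :: L).Pairwise (fun a b => key b < key a)) (post pre' : List I) (u : I)
    (post' : List I) (h : L.reverse = pre' ++ u :: post') :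
    ¬ LocalMax key pre' u (post' ++ v :: post) := by
  intro hm
  have h1 : (pre' ++ u :: (post' ++ [v])).Pairwise (fun a b => key a < key b) := by
    have := List.pairwise_reverse.2 hL
    simpa [h] using this
  have h2 := (List.pairwise_append.1 h1).2.1
  rw [List.pairwise_cons] at h2
  cases post' with
  | nil => exact absurd (hm.2 v (by simp)) (not_le.2 (h2.1 v (by simp)))
  | cons w ws => exact absurd (hm.2 w (by simp)) (not_le.2 (h2.1 w (by simp)))

theorem scan_spec_aux {I K : Type*} [DecidableEq I] [LinearOrder K] (key : I → K)
    (L : List I) (v : I) (R : List I) (c : I → List I)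
    (hL : (v :: L).Pairwise (fun a b => key b < key a)) :
    LinkAll key (L.reverse ++ v :: R) c (scan key L v R c).links (scan key L v R c).root
      (scan key L v R c).children := by
  fun_induction scan key L v R c with
  | case1 v c => exact .one v c
  | case2 u L v c ih =>
    have hL' := List.pairwise_cons.1 hL
    refine .step (l' := L.reverse ++ [u]) (c₁ := link c u v) ?_ (ih hL'.2)
    have := LinkStep.withLeft (key := key) L.reverse u v [] c
      ⟨⟨by simpa using (hL'.1 u (by simp)).le, by simp⟩, fun pre' x post' h =>
        not_localMax_of_chain hL [] pre' x post' (by simpa using h)⟩ (by simp)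
    simpa using this
  | case3 v w R c h ih =>
    refine .step (l' := w :: R) (c₁ := link c w v) ?_ (ih (by simp))
    exact LinkStep.withRight (key := key) [] v w R c
      ⟨⟨by simp, by simpa using h⟩, by simp⟩ (by simp)
  | case4 v w R c h ih =>
    simpa [ScanResult.afterMove] using ih (by simpa using h)
  | case5 u L v w R c h h' ih =>
    have hL' := List.pairwise_cons.1 hL
    refine .step (l' := L.reverse ++ u :: w :: R) (c₁ := link c u v) ?_ (ih hL'.2)
    have := LinkStep.withLeft (key := key) L.reverse u v (w :: R) c
      ⟨⟨by simpa using h.1, by simpa using h.2⟩, fun pre' x post' h =>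
        not_localMax_of_chain hL (w :: R) pre' x post' (by simpa using h)⟩ (by simpa using h')
    simpa using this
  | case6 u L v w R c h h' ih =>
    have hL' := List.pairwise_cons.1 hL
    have hu := List.pairwise_cons.1 hL'.2
    refine .step (l' := (u :: L).reverse ++ w :: R) (c₁ := link c w v) ?_ (ih ?_)
    · exact LinkStep.withRight (key := key) (u :: L).reverse v w R c
        ⟨⟨by simpa using h.1, by simpa using h.2⟩, fun pre' x post' h =>
          not_localMax_of_chain hL (w :: R) pre' x post' h⟩ (by simpa using h')
    · refine List.pairwise_cons.2 ⟨fun x hx => ?_, hL'.2⟩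
      rcases List.mem_cons.1 hx with rfl | hx
      · exact not_le.1 h'
      · exact (hu.1 x hx).trans (not_le.1 h')
  | case7 u L v w R c h ih =>
    have hL' := List.pairwise_cons.1 hL
    have huv : key u ≤ key v := (hL'.1 u (by simp)).le
    have hvw : key v < key w := by
      by_contra hc
      exact h ⟨huv, not_lt.1 hc⟩
    have := ih (List.pairwise_cons.2 ⟨fun x hx => by
      rcases List.mem_cons.1 hx with rfl | hx
      · exact hvw
      · exact (hL'.1 x hx).trans hvw, hL⟩)
    simpa [ScanResult.afterMove] using this

/-- The scan from the leftmost root does leftmost locally maximum linking. -/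
theorem scan_spec {I K : Type*} [DecidableEq I] [LinearOrder K] (key : I → K)
    (v : I) (R : List I) (c : I → List I) :
    LinkAll key (v :: R) c (scan key [] v R c).links (scan key [] v R c).root
      (scan key [] v R c).children := by
  simpa using scan_spec_aux key [] v R c (by simp)

end SlimHeap

namespace SlimHeap

/-! ### Numerical core: siblings with masses, reduced to one root by adjacent links -/

namespace Run

theorem log_add_le (x y : ℕ) : Nat.log 2 (x + y) ≤ Nat.log 2 x + y := by
  have h1 : x < 2 ^ (Nat.log 2 x + 1) := Nat.lt_pow_succ_log_self (by norm_num) x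
  have h2 : y + 1 ≤ 2 ^ y := Nat.lt_two_pow_self
  have h3 : x + y < 2 ^ (Nat.log 2 x + y + 1) := by
    have : 2 ^ (Nat.log 2 x + y + 1) = 2 ^ (Nat.log 2 x + 1) * 2 ^ y := by ring
    rw [this]
    nlinarith [Nat.one_le_two_pow (n := y)]
  have := Nat.log_lt_of_lt_pow' (b := 2) (by omega) h3
  omega

theorem log_le_log {a b : ℕ} (h : a ≤ b) : Nat.log 2 a ≤ Nat.log 2 b := Nat.log_mono_right h

theorem log_le_add {a x y : ℕ} (h : a ≤ x + y) : Nat.log 2 a ≤ Nat.log 2 x + y :=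
  (log_le_log h).trans (log_add_le x y)

/-- One plus the total mass of a list of siblings. -/
def total {I : Type*} (sg : I → ℕ) (R : List I) : ℕ := 1 + (R.map sg).sum

/-- The masses `sg` of the siblings, the totals `S` of the suffixes that they start, their labels
`c`, and the total `S0` of the list. -/
structure Data (I : Type*) where
  sg : I → ℕ
  S : I → ℕ
  c : I → ℕ
  S0 : ℕ

variable {I : Type*} (d : Data I)

namespace Data

/-- The logarithm of the total of a suffix. -/
def ls (i : I) : ℕ := Nat.log 2 (d.S i)

/-- The logarithm of a total relative to the mass of its first sibling. -/
def x (i : I) : ℕ := Nat.log 2 (d.S i) - Nat.log 2 (d.sg i)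

/-- The number `b`, an upper bound for the label. -/
def b (i : I) : ℕ := Nat.log 2 (d.x i)

/-- A bound for all labels. -/
def cap : ℕ := Nat.log 2 (Nat.log 2 d.S0)

/-- The logarithm of the total of a list. -/
def lsR (R : List I) : ℕ := Nat.log 2 (total d.sg R)

/-- The list `R` is well-formed: each `S i` is the total of the suffix that starts with `i`. -/
def Wf : List I → Prop
  | [] => True
  | w :: R => d.S w = total d.sg (w :: R) ∧ 1 ≤ d.sg w ∧ d.c w ≤ d.b w ∧ Wf R

end Data

/-- A state: the stack of roots with their current masses (the current root first), the roots
not yet visited, and, if the current root has just won a link against the root that was right of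
it, the loser with its mass and the former mass of the current root. -/
structure St (I : Type*) where
  stk : List (I × ℕ)
  R : List I
  cl : Option (I × ℕ × ℕ)

/-- The invariant of the process. -/
structure Inv (s : St I) : Prop where
  wf : d.Wf s.R
  mem : ∀ p ∈ s.stk, 1 ≤ d.sg p.1 ∧ d.sg p.1 ≤ p.2 ∧ d.c p.1 ≤ d.b p.1 ∧
    total d.sg s.R ≤ d.S p.1 ∧ d.S p.1 ≤ d.S0
  chain : s.stk.Pairwise (fun q p => d.S q.1 ≤ d.S p.1)
  sum : (s.stk.map Prod.snd).sum + total d.sg s.R ≤ d.S0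
  record : ∀ t m m0, s.cl = some (t, m, m0) → ∃ v stk, s.stk = (v, m0 + m) :: stk ∧
    d.sg v ≤ m0 ∧ 1 ≤ d.sg t ∧ d.sg t ≤ m ∧ d.S t ≤ d.S v ∧ total d.sg s.R ≤ d.S t ∧ d.c t ≤ d.b t

theorem total_cons (sg : I → ℕ) (w : I) (R : List I) :
    total sg (w :: R) = sg w + total sg R := by
  simp [total]; omega

theorem total_pos (sg : I → ℕ) (R : List I) : 1 ≤ total sg R := by simp [total]

/-! #### The transitions preserve the invariant -/

theorem inv_init {l : List I} (h : d.Wf l) (hS : total d.sg l ≤ d.S0) :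
    Inv d ⟨[], l, none⟩ :=
  ⟨h, by simp, by simp, by simpa using hS, by simp⟩

theorem inv_push {stk w R} (h : Inv d ⟨stk, w :: R, none⟩) :
    Inv d ⟨(w, d.sg w) :: stk, R, none⟩ := by
  obtain ⟨h1, h2, h3, h4, h5⟩ := h
  simp only [Data.Wf] at h1
  have := total_cons d.sg w R
  dsimp only at h2 h3 h4
  refine ⟨h1.2.2.2, ?_, ?_, ?_, by simp⟩
  · intro p hp
    rcases List.mem_cons.1 hp with rfl | hp
    · dsimp only
      exact ⟨h1.2.1, le_rfl, h1.2.2.1, by omega, by omega⟩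
    · have := h2 p hp
      dsimp only at *
      exact ⟨this.1, this.2.1, this.2.2.1, by omega, this.2.2.2.2⟩
  · refine List.pairwise_cons.2 ⟨fun p hp => ?_, h3⟩
    have := h2 p hp
    dsimp only at *
    omega
  · simp only [List.map_cons, List.sum_cons]
    omega

theorem inv_linkL {v μv u μu stk R r} (h : Inv d ⟨(v, μv) :: (u, μu) :: stk, R, r⟩) :
    Inv d ⟨(u, μu + μv) :: stk, R, some (v, μv, μu)⟩ := by
  obtain ⟨h1, h2, h3, h4, h5⟩ := h
  simp only [List.pairwise_cons, List.mem_cons, forall_eq_or_imp] at h2 h3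
  obtain ⟨a1, a2, a3, a4, a5⟩ := h2.1
  obtain ⟨b1, b2, b3, b4, b5⟩ := h2.2.1
  dsimp only at *
  refine ⟨h1, ?_, ?_, ?_, ?_⟩
  · intro p hp
    rcases List.mem_cons.1 hp with rfl | hp
    · dsimp only
      exact ⟨b1, by omega, b3, b4, b5⟩
    · exact h2.2.2 p hp
  · exact List.pairwise_cons.2 ⟨h3.2.1, h3.2.2⟩
  · simp only [List.map_cons, List.sum_cons] at h4 ⊢
    omega
  · intro t m m0 he
    simp only [Option.some.injEq, Prod.mk.injEq] at he
    obtain ⟨rfl, rfl, rfl⟩ := he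
    exact ⟨u, stk, rfl, b2, a1, a2, h3.1.1, a4, a3⟩

theorem inv_drop {v μv stk R r} (h : Inv d ⟨(v, μv) :: stk, R, r⟩) : Inv d ⟨stk, R, none⟩ := by
  obtain ⟨h1, h2, h3, h4, h5⟩ := h
  simp only [List.pairwise_cons, List.mem_cons, forall_eq_or_imp] at h2 h3
  refine ⟨h1, h2.2, h3.2, ?_, by simp⟩
  simp only [List.map_cons, List.sum_cons] at h4 ⊢
  omega

theorem inv_linkR {v μv stk w R r} (h : Inv d ⟨(v, μv) :: stk, w :: R, r⟩) :
    Inv d ⟨(w, d.sg w + μv) :: stk, R, none⟩ := by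
  have h4' := h.sum
  obtain ⟨h1, h2, h3, h4, h5⟩ := inv_push d (inv_drop d h)
  simp only [List.mem_cons, forall_eq_or_imp] at h2
  have := total_cons d.sg w R
  refine ⟨h1, ?_, ?_, ?_, by simp⟩
  · intro p hp
    rcases List.mem_cons.1 hp with rfl | hp
    · obtain ⟨a1, a2, a3, a4, a5⟩ := h2.1
      dsimp only at *
      exact ⟨a1, by omega, a3, a4, a5⟩
    · exact h2.2 p hp
  · simpa using h3
  · simp only [List.map_cons, List.sum_cons] at h4' ⊢
    omega

/-! #### Funds -/

/-- Sum of a gap function over adjacent elements of the stack. -/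
def gaps (g : I × ℕ → I × ℕ → ℕ) : List (I × ℕ) → ℕ
  | q :: p :: stk => g p q + gaps g (p :: stk)
  | _ => 0

theorem gaps_cons (g : I × ℕ → I × ℕ → ℕ) (q p : I × ℕ) (stk) :
    gaps g (q :: p :: stk) = g p q + gaps g (p :: stk) := rfl

theorem gaps_mono {g g' : I × ℕ → I × ℕ → ℕ} (h : ∀ p q, g p q ≤ g' p q) :
    ∀ stk, gaps g stk ≤ gaps g' stk
  | [] => le_rfl
  | [_] => le_rfl
  | q :: p :: stk => by
    rw [gaps_cons, gaps_cons]
    exact add_le_add (h p q) (gaps_mono h (p :: stk))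

/-- Replacing the top of the stack. -/
theorem gaps_top_le {g g' : I × ℕ → I × ℕ → ℕ} (h : ∀ p q, g p q ≤ g' p q) {q q' : I × ℕ}
    (e : ℕ) : ∀ stk, (∀ p ∈ stk, g p q ≤ g' p q' + e) →
      gaps g (q :: stk) ≤ gaps g' (q' :: stk) + e
  | [], _ => Nat.zero_le _
  | p :: stk, hh => by
    rw [gaps_cons, gaps_cons]
    have := gaps_mono h (p :: stk)
    have := hh p (by simp)
    omega

/-- Total variation. -/
def tv : List ℕ → ℕ
  | x :: y :: l => (x - y) + (y - x) + tv (y :: l)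
  | _ => 0

namespace Data

def m (r μ : ℕ) : ℕ := Nat.log 2 (r - Nat.log 2 μ)

def gapA (r : ℕ) (p q : I × ℕ) : ℕ :=
  (min (d.c q.1) (m r p.2) - d.c p.1) + (d.c q.1 - d.b p.1) + (min (d.c p.1) (m r q.2) - d.c q.1)

def topA (stk : List (I × ℕ)) (R : List I) (closed : Bool) : ℕ :=
  match stk, R with
  | v :: _, w :: R =>
    if closed then (min (d.c v.1) (m (d.lsR (w :: R)) v.2) - d.c w) +
      (min (m (d.lsR (w :: R)) v.2) (d.c w) - d.c v.1)
    else (d.c v.1 - d.c w) + (d.c w - d.c v.1)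
  | _, _ => 0

def fundA (s : St I) : ℕ :=
  gaps (d.gapA (d.lsR s.R)) s.stk + d.topA s.stk s.R s.cl.isSome + tv (s.R.map d.c)

def gapB (p q : I × ℕ) : ℕ := d.c q.1 - d.c p.1

def topB (stk : List (I × ℕ)) (R : List I) (closed : Bool) : ℕ :=
  match stk, R with
  | v :: _, w :: _ =>
    if closed then d.c v.1 - d.c w else (d.c v.1 - d.c w) + (d.c w - d.c v.1)
  | _, _ => 0

def fundB (s : St I) : ℕ :=
  gaps d.gapB s.stk + d.topB s.stk s.R s.cl.isSome + tv (s.R.map d.c)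

def M (v : I × ℕ) : ℕ := max (d.ls v.1) (Nat.log 2 v.2)

def N (v : I × ℕ) : Option (I × ℕ × ℕ) → ℕ
  | none => d.M v
  | some t => max (Nat.log 2 v.2) (d.ls t.1)

def gapE (p q : I × ℕ) : ℕ := min d.cap (d.M p - d.M q)

def dl (r : ℕ) (v : I × ℕ) : ℕ := min d.cap (d.M v - r) - (Nat.log 2 v.2 - r)

def topE (r : ℕ) (stk : List (I × ℕ)) : Option (I × ℕ × ℕ) → ℕ
  | none => match stk with
    | v :: _ => min d.cap (d.M v - r)
    | [] => 0
  | some _ => match stk with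
    | v :: _ => d.dl r v
    | [] => 0

def topE' (r : ℕ) (stk : List (I × ℕ)) : Option (I × ℕ × ℕ) → ℕ
  | none => match stk with
    | v :: _ => min d.cap (d.M v - r)
    | [] => 0
  | some t => match stk with
    | v :: _ => max (min d.cap (d.M v - d.N v (some t))) (d.dl r v)
    | [] => 0

def fundE (s : St I) : ℕ := gaps d.gapE s.stk + d.lsR s.R + d.topE (d.lsR s.R) s.stk s.cl

def fundE' (s : St I) : ℕ := gaps d.gapE s.stk + d.lsR s.R + d.topE' (d.lsR s.R) s.stk s.cl

/-- The growth of the logarithm of the mass of the winner. -/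
def gam (μv μz : ℕ) : ℕ := Nat.log 2 (μz + μv) - Nat.log 2 μz

/-- The new value of `b` for the loser. -/
def b' (μv μz : ℕ) : ℕ := Nat.log 2 (Nat.log 2 (μz + μv) - Nat.log 2 μv)

def err (v z : I × ℕ) (t : Option (I × ℕ × ℕ)) : ℕ := min d.cap (Nat.log 2 z.2 - d.N v t)

end Data

end Run

end SlimHeap

namespace SlimHeap
namespace Run
variable {I : Type*} (d : Data I)

namespace Data

theorem m_mono {r r' μ μ' : ℕ} (h : r ≤ r') (h' : μ' ≤ μ) : m r μ ≤ m r' μ' :=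
  log_le_log (by have := log_le_log h'; omega)

theorem gapA_mono {r r' : ℕ} (h : r ≤ r') {p q p' q' : I × ℕ} (hp : p'.1 = p.1) (hq : q'.1 = q.1)
    (hp2 : p'.2 ≤ p.2) (hq2 : q'.2 ≤ q.2) : d.gapA r p q ≤ d.gapA r' p' q' := by
  have h1 := m_mono h hp2
  have h2 := m_mono h hq2
  simp only [gapA, hp, hq]
  omega

theorem m_le_b {r : ℕ} {v : I} {μ : ℕ} (h1 : r ≤ d.ls v) (h2 : d.sg v ≤ μ) : m r μ ≤ d.b v := by
  refine log_le_log ?_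
  have := log_le_log h2
  simp only [x]
  simp only [ls] at h1
  omega

theorem lsR_le_lsR_cons (w : I) (R : List I) : d.lsR R ≤ d.lsR (w :: R) :=
  log_le_log (by rw [total_cons]; omega)

end Data

open Data

theorem arith_gap_lip {cw cq mp mp' bp cp : ℕ} (e : ℕ) (h1 : mp ≤ bp) (h2 : mp' ≤ mp)
    (h : cw ≤ cq + e) :
    (min cw mp' - cp) + (cw - bp) ≤ (min cq mp - cp) + (cq - bp) + e := by
  have h3 : min cw mp' - cp ≤ min cw mp - cp := by omega
  rcases le_total cw bp with h4 | h4
  · omega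
  · rcases le_total cq bp with h5 | h5
    · have : min cw mp' ≤ mp := by omega
      rcases le_total cq mp with h6 | h6
      · rw [min_eq_left h6]; omega
      · rw [min_eq_right h6]; omega
    · rw [min_eq_right (by omega : mp ≤ cq)]; omega

theorem arith_le_add {cw bw cv m : ℕ} (h : cw ≤ bw) : cw ≤ cv + (min m cw - cv + (bw - m)) := by
  omega

theorem arith_min_sub {cp mw mq cq cw bw e : ℕ} (h1 : mw ≤ mq) (h2 : mw ≤ bw)
    (h4 : min cq mq - cw ≤ e) :
    (min cp mw - cw) + (min cq mq - bw) ≤ (min cp mq - cq) + e + (cw - bw) := by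
  rcases le_total (min cq mq) bw with h5 | h5
  · have : min cp mw - cw ≤ (min cp mq - cq) + (min cq mq - cw) := by omega
    omega
  · omega

theorem Inv.lsR_le {s : St I} (h : Inv d s) {p} (hp : p ∈ s.stk) : d.lsR s.R ≤ d.ls p.1 :=
  log_le_log (h.mem p hp).2.2.2.1

theorem tv_cons_cons (x y : ℕ) (l) : tv (x :: y :: l) = (x - y) + (y - x) + tv (y :: l) := rfl

theorem fundA_push {stk w R} (h : Inv d ⟨stk, w :: R, none⟩) :
    d.fundA ⟨(w, d.sg w) :: stk, R, none⟩ ≤ d.fundA ⟨stk, w :: R, none⟩ := by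
  have hr := d.lsR_le_lsR_cons w R
  have hm := gaps_mono (g := d.gapA (d.lsR R)) (g' := d.gapA (d.lsR (w :: R)))
    (fun p q => d.gapA_mono hr rfl rfl le_rfl le_rfl) stk
  have hw := h.wf
  simp only [Wf] at hw
  have e1 : d.topA ((w, d.sg w) :: stk) R false + tv (R.map d.c) = tv ((w :: R).map d.c) := by
    cases R with
    | nil => rfl
    | cons y R => simp [topA, tv]
  have e2 : gaps (d.gapA (d.lsR R)) ((w, d.sg w) :: stk) ≤
      gaps (d.gapA (d.lsR (w :: R))) stk + d.topA stk (w :: R) false := by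
    cases stk with
    | nil => exact Nat.zero_le _
    | cons p stk =>
      rw [gaps_cons]
      have h1 := h.lsR_le d (p := p) (by simp)
      have h2 := h.mem p (by simp)
      have h3 := d.m_le_b (v := p.1) (μ := p.2) (hr.trans h1) h2.2.1
      have : d.gapA (d.lsR R) p (w, d.sg w) ≤ d.topA (p :: stk) (w :: R) false := by
        simp only [gapA, topA, Bool.false_eq_true, ↓reduceIte]
        omega
      omega
  simp only [fundA, Option.isSome_none]
  omega

theorem fundA_linkL {v μv u μu stk R r} (h : Inv d ⟨(v, μv) :: (u, μu) :: stk, R, r⟩) :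
    d.fundA ⟨(u, μu + μv) :: stk, R, some (v, μv, μu)⟩ + (d.c v - d.b u) ≤
      d.fundA ⟨(v, μv) :: (u, μu) :: stk, R, r⟩ := by
  have h1 := gaps_top_le (g := d.gapA (d.lsR R)) (g' := d.gapA (d.lsR R)) (fun _ _ => le_rfl)
    (q := (u, μu + μv)) (q' := (u, μu)) 0 stk
    (fun p _ => d.gapA_mono le_rfl rfl rfl le_rfl (by dsimp only; omega))
  have hv := h.mem (v, μv) (by simp)
  have hu := h.mem (u, μu) (by simp)
  have lv := h.lsR_le d (p := (v, μv)) (by simp)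
  have lu := h.lsR_le d (p := (u, μu)) (by simp)
  dsimp only at hv hu lv lu
  have mv := d.m_le_b lv hv.2.1
  have mu := d.m_le_b lu hu.2.1
  have mu' := m_mono (le_refl (d.lsR R)) (show μu ≤ μu + μv by omega)
  have mv' := m_mono (le_refl (d.lsR R)) (show μv ≤ μu + μv by omega)
  simp only [fundA, gaps_cons, Option.isSome_some]
  have : d.topA ((u, μu + μv) :: stk) R true + (d.c v - d.b u) ≤
      d.gapA (d.lsR R) (u, μu) (v, μv) + d.topA ((v, μv) :: (u, μu) :: stk) R r.isSome := by
    cases R with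
    | nil => simp only [topA, gapA]; omega
    | cons w R =>
      have i1 : min (d.c u) (m (d.lsR (w :: R)) (μu + μv)) - d.c w ≤
        (min (d.c u) (m (d.lsR (w :: R)) μv) - d.c v) +
          (min (d.c v) (m (d.lsR (w :: R)) μv) - d.c w) := by
        clear mv mu hv hu lv lu h1 mu'; omega
      have i2 : min (m (d.lsR (w :: R)) (μu + μv)) (d.c w) - d.c u ≤
        (min (d.c v) (m (d.lsR (w :: R)) μu) - d.c u) +
          (min (m (d.lsR (w :: R)) μv) (d.c w) - d.c v) := by
        clear mv mu hv hu lv lu h1 i1; omega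
      have i3 : min (d.c v) (m (d.lsR (w :: R)) μv) - d.c w ≤ d.c v - d.c w :=
          tsub_le_tsub_right (min_le_left _ _) _
      have i4 : min (m (d.lsR (w :: R)) μv) (d.c w) - d.c v ≤ d.c w - d.c v := by omega
      cases r <;> simp only [topA, gapA, Option.isSome_some, Option.isSome_none,
        Bool.false_eq_true, ↓reduceIte] <;> linarith
  omega

theorem fundA_linkR {v μv stk w R r} (h : Inv d ⟨(v, μv) :: stk, w :: R, r⟩) :
    d.fundA ⟨(w, d.sg w + μv) :: stk, R, none⟩ + (min (d.c v) (m (d.lsR (w :: R)) μv) - d.b w) ≤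
      d.fundA ⟨(v, μv) :: stk, w :: R, r⟩ + (d.b w - m (d.lsR (w :: R)) μv) := by
  have hr := d.lsR_le_lsR_cons w R
  have hv := h.mem (v, μv) (by simp)
  have lv := h.lsR_le d (p := (v, μv)) (by simp)
  have hw := h.wf
  simp only [Wf] at hw
  have lw : d.lsR (w :: R) ≤ d.ls w := by rw [ls, lsR, hw.1]
  dsimp only at hv lv
  have mv := d.m_le_b lv hv.2.1
  have mw := d.m_le_b (hr.trans lw) (show d.sg w ≤ d.sg w + μv by omega)
  have mw' := m_mono hr (show μv ≤ d.sg w + μv by omega)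
  have e1 : d.topA ((w, d.sg w + μv) :: stk) R false + tv (R.map d.c) = tv ((w :: R).map d.c) := by
    cases R with
    | nil => rfl
    | cons y R => simp [topA, tv]
  have hm := gaps_mono (g := d.gapA (d.lsR R)) (g' := d.gapA (d.lsR (w :: R)))
    (fun p q => d.gapA_mono hr rfl rfl le_rfl le_rfl) stk
  simp only [fundA, Option.isSome_none]
  have key : gaps (d.gapA (d.lsR R)) ((w, d.sg w + μv) :: stk) +
      (min (d.c v) (m (d.lsR (w :: R)) μv) - d.b w) ≤
      gaps (d.gapA (d.lsR (w :: R))) ((v, μv) :: stk) +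
        d.topA ((v, μv) :: stk) (w :: R) r.isSome + (d.b w - m (d.lsR (w :: R)) μv) := by
    cases stk with
    | nil =>
      cases r <;> simp only [topA, gaps, Option.isSome_some, Option.isSome_none,
        Bool.false_eq_true, ↓reduceIte] <;> omega
    | cons p stk =>
      have hp := h.mem p (by simp)
      have lp := h.lsR_le d (p := p) (by simp)
      have mp := d.m_le_b lp hp.2.1
      have mp' := m_mono hr (le_refl p.2)
      have := gaps_mono (g := d.gapA (d.lsR R)) (g' := d.gapA (d.lsR (w :: R)))
        (fun p q => d.gapA_mono hr rfl rfl le_rfl le_rfl) (p :: stk)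
      rw [gaps_cons, gaps_cons]
      dsimp only at mp mp'
      have hcw := hw.2.2.1
      have z : d.c w - d.b w = 0 := Nat.sub_eq_zero_of_le hcw
      have i1 := arith_min_sub (cp := d.c p.1) (cw := d.c w) mw' mw
        (le_refl (min (d.c v) (m (d.lsR (w :: R)) μv) - d.c w))
      cases r
      · have i2 := arith_gap_lip (cp := d.c p.1) (d.c w - d.c v) mp mp'
          le_add_tsub
        have i3 : min (d.c v) (m (d.lsR (w :: R)) μv) - d.c w ≤ d.c v - d.c w :=
          tsub_le_tsub_right (min_le_left _ _) _
        simp only [topA, gapA, Option.isSome_none, Bool.false_eq_true, ↓reduceIte]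
        linarith
      · have i2 := arith_gap_lip (cp := d.c p.1) (min (m (d.lsR (w :: R)) μv) (d.c w) - d.c v +
          (d.b w - m (d.lsR (w :: R)) μv)) mp mp' (arith_le_add hcw)
        simp only [topA, gapA, Option.isSome_some, ↓reduceIte]
        linarith
  omega

theorem Inv.b_le_cap {s : St I} (h : Inv d s) {p} (hp : p ∈ s.stk) : d.b p.1 ≤ d.cap := by
  refine log_le_log ?_
  have := log_le_log (h.mem p hp).2.2.2.2
  simp only [x]
  omega

theorem Inv.c_head_le_cap {s : St I} (h : Inv d s) {w R} (hs : s.R = w :: R) : d.c w ≤ d.cap := by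
  have hw := h.wf
  have h4 := h.sum
  rw [hs] at hw h4
  simp only [Wf] at hw
  refine hw.2.2.1.trans (log_le_log ?_)
  have := log_le_log (show d.S w ≤ d.S0 by rw [hw.1]; omega)
  simp only [x]
  omega

theorem fundA_drop {v μv stk R r} (h : Inv d ⟨(v, μv) :: stk, R, r⟩) :
    d.fundA ⟨stk, R, none⟩ ≤ d.fundA ⟨(v, μv) :: stk, R, r⟩ + d.cap := by
  have h' := inv_drop d h
  have h1 : d.topA stk R false ≤ d.cap := by
    rcases stk with _ | ⟨p, stk⟩ <;> rcases R with _ | ⟨w, R⟩ <;> simp [topA]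
    have h1 := h'.b_le_cap d (p := p) (by simp)
    have h2 := (h'.mem p (by simp)).2.2.1
    have h3 := h'.c_head_le_cap d (w := w) (R := R) rfl
    omega
  have h2 : gaps (d.gapA (d.lsR R)) stk ≤ gaps (d.gapA (d.lsR R)) ((v, μv) :: stk) := by
    cases stk with
    | nil => exact Nat.zero_le _
    | cons p stk => rw [gaps_cons]; omega
  simp only [fundA, Option.isSome_none]
  omega

/-! #### The labels of winners and losers -/

theorem fundB_push {stk w R} :
    d.fundB ⟨(w, d.sg w) :: stk, R, none⟩ ≤ d.fundB ⟨stk, w :: R, none⟩ := by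
  have e1 : d.topB ((w, d.sg w) :: stk) R false + tv (R.map d.c) = tv ((w :: R).map d.c) := by
    cases R with
    | nil => rfl
    | cons y R => simp [topB, tv]
  have e2 : gaps d.gapB ((w, d.sg w) :: stk) ≤ gaps d.gapB stk + d.topB stk (w :: R) false := by
    cases stk with
    | nil => exact Nat.zero_le _
    | cons p stk => simp only [gaps_cons, gapB, topB, Bool.false_eq_true, ↓reduceIte]; omega
  simp only [fundB, Option.isSome_none]
  omega

theorem fundB_linkL {v μv u μu stk R r} :
    (d.fundB ⟨(u, μu + μv) :: stk, R, some (v, μv, μu)⟩ : ℤ) + (d.c v - d.c u) ≤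
      d.fundB ⟨(v, μv) :: (u, μu) :: stk, R, r⟩ := by
  have h1 := gaps_top_le (g := d.gapB) (g' := d.gapB) (fun _ _ => le_rfl)
    (q := (u, μu + μv)) (q' := (u, μu)) 0 stk (fun p _ => le_rfl)
  simp only [fundB, gaps_cons, Option.isSome_some]
  have : (d.topB ((u, μu + μv) :: stk) R true : ℤ) + (d.c v - d.c u) ≤
      d.gapB (u, μu) (v, μv) + d.topB ((v, μv) :: (u, μu) :: stk) R r.isSome := by
    cases R with
    | nil => simp only [topB, gapB]; omega
    | cons w R =>
      cases r <;> simp only [topB, gapB, Option.isSome_some, Option.isSome_none,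
        Bool.false_eq_true, ↓reduceIte] <;> omega
  omega

theorem fundB_linkR {v μv stk w R r} :
    (d.fundB ⟨(w, d.sg w + μv) :: stk, R, none⟩ : ℤ) + (d.c v - d.c w) ≤
      d.fundB ⟨(v, μv) :: stk, w :: R, r⟩ := by
  have e1 : d.topB ((w, d.sg w + μv) :: stk) R false + tv (R.map d.c) = tv ((w :: R).map d.c) := by
    cases R with
    | nil => rfl
    | cons y R => simp [topB, tv]
  have key : (gaps d.gapB ((w, d.sg w + μv) :: stk) : ℤ) + (d.c v - d.c w) ≤
      gaps d.gapB ((v, μv) :: stk) + d.topB ((v, μv) :: stk) (w :: R) r.isSome := by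
    cases stk with
    | nil =>
      cases r <;> simp only [topB, gaps, Option.isSome_some, Option.isSome_none,
        Bool.false_eq_true, ↓reduceIte] <;> omega
    | cons p stk =>
      rw [gaps_cons, gaps_cons]
      cases r <;> simp only [topB, gapB, Option.isSome_some, Option.isSome_none,
        Bool.false_eq_true, ↓reduceIte] <;> omega
  simp only [fundB, Option.isSome_none]
  omega

theorem fundB_drop {v μv stk R r} (h : Inv d ⟨(v, μv) :: stk, R, r⟩) :
    d.fundB ⟨stk, R, none⟩ ≤ d.fundB ⟨(v, μv) :: stk, R, r⟩ + d.cap := by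
  have h' := inv_drop d h
  have h1 : d.topB stk R false ≤ d.cap := by
    rcases stk with _ | ⟨p, stk⟩ <;> rcases R with _ | ⟨w, R⟩ <;> simp [topB]
    have h1 := h'.b_le_cap d (p := p) (by simp)
    have h2 := (h'.mem p (by simp)).2.2.1
    have h3 := h'.c_head_le_cap d (w := w) (R := R) rfl
    omega
  have h2 : gaps d.gapB stk ≤ gaps d.gapB ((v, μv) :: stk) := by
    cases stk with
    | nil => exact Nat.zero_le _
    | cons p stk => rw [gaps_cons]; omega
  simp only [fundB, Option.isSome_none]
  omega

end Run
end SlimHeap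

namespace SlimHeap
namespace Run
variable {I : Type*} (d : Data I)
open Data

theorem arith_E_open {cap r Mv Mu Mu' au au' g : ℕ} (hr : r ≤ Mv) (hu : au ≤ Mu)
    (h2 : Mu' ≤ Mu + g) (h3 : au ≤ au') :
    min cap (Mu' - r) - (au' - r) + min cap (au - Mv) ≤
      min cap (Mu - Mv) + min cap (Mv - r) + 2 * g := by omega

theorem arith_E_closed {cap r Mv Mu Mu' au au' av g : ℕ} (hr : r ≤ Mv) (hu : au ≤ Mu)
    (h2 : Mu' ≤ Mu + g) (h3 : au ≤ au') (h4 : av ≤ au') :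
    min cap (Mu' - r) - (au' - r) + min cap (au - Mv) ≤
      min cap (Mu - Mv) + (min cap (Mv - r) - (av - r)) + 2 * g := by omega

theorem arith_E'_open {cap r Mv Mu Mu' au' av g lsv : ℕ} (hr : r ≤ lsv) (hv : Mv = max lsv av)
    (h2 : Mu' ≤ Mu + g) :
    max (min cap (Mu' - max au' lsv)) (min cap (Mu' - r) - (au' - r)) ≤
      min cap (Mu - Mv) + min cap (Mv - r) + 2 * g := by omega

theorem arith_E'_closed₁ {cap Mv Mu Mu' au' g N lsv x : ℕ} (hv : Mv ≤ max au' lsv)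
    (h2 : Mu' ≤ Mu + g) :
    min cap (Mu' - max au' lsv) + min cap (min (Mv - N) x) ≤
      min cap (Mu - Mv) + min cap (Mv - N) + g := by omega

theorem arith_E'_closed₂ {cap r Mv N Mu Mu' au au' av g : ℕ} (hr : r ≤ Mv)
    (h2 : Mu' ≤ Mu + g) (h3 : au ≤ au') (h4 : av ≤ au') :
    (min cap (Mu' - r) - (au' - r)) + min cap (min (Mv - N) (au - max av r)) ≤
      min cap (Mu - Mv) + max (min cap (Mv - N)) (min cap (Mv - r) - (av - r)) + g := by
  have h6 : min cap (Mu' - r) ≤ min cap (Mu - r) + g := by omega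
  have h7 : min cap (Mu - r) ≤ min cap (Mu - Mv) + min cap (Mv - r) := by omega
  rcases Nat.eq_zero_or_pos (min cap (Mu' - r) - (au' - r)) with h | h
  · rw [h]
    have h9 : min cap (min (Mv - N) (au - max av r)) ≤ min cap (Mv - N) := by omega
    have h8 := le_max_left (min cap (Mv - N)) (min cap (Mv - r) - (av - r))
    have := Nat.zero_le (min cap (Mu - Mv))
    linarith
  · have h8 := le_max_right (min cap (Mv - N)) (min cap (Mv - r) - (av - r))
    have h5 : min cap (min (Mv - N) (au - max av r)) ≤ au - max av r :=
      (min_le_right _ _).trans (min_le_right _ _)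
    generalize max (min cap (Mv - N)) (min cap (Mv - r) - (av - r)) = X at *
    generalize min cap (min (Mv - N) (au - max av r)) = Y at *
    generalize min cap (Mu' - r) = Z at *
    generalize min cap (Mu - Mv) = V at *
    generalize min cap (Mv - r) = V' at *
    omega

theorem arith_E'_closed {cap r Mv N Mu Mu' au au' av g lsv : ℕ} (hr : r ≤ Mv)
    (hv : Mv ≤ max au' lsv) (h2 : Mu' ≤ Mu + g) (h3 : au ≤ au') (h4 : av ≤ au') :
    max (min cap (Mu' - max au' lsv)) (min cap (Mu' - r) - (au' - r)) +
      min cap (min (Mv - N) (au - max av r)) ≤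
      min cap (Mu - Mv) + max (min cap (Mv - N)) (min cap (Mv - r) - (av - r)) + g := by
  rcases le_total (min cap (Mu' - max au' lsv)) (min cap (Mu' - r) - (au' - r)) with h | h
  · rw [max_eq_right h]
    exact arith_E'_closed₂ hr h2 h3 h4
  · rw [max_eq_left h]
    have h1 := arith_E'_closed₁ (cap := cap) (N := N) (x := au - max av r) hv h2
    have h8 := le_max_left (min cap (Mv - N)) (min cap (Mv - r) - (av - r))
    linarith

theorem arith_E_right {cap r r' Mp Mv Mw g X : ℕ} (h1 : r' ≤ r) (h2 : r ≤ Mw)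
    (h3 : Mw ≤ r + g) (hX : min cap (Mv - Mw) ≤ X + g) :
    min cap (Mp - Mw) + r' + min cap (Mw - r') ≤ min cap (Mp - Mv) + r + X + 2 * g := by omega

theorem arith_E_right_closed {cap r Mv Mw av g : ℕ} (h2 : r ≤ Mw) (h3 : av ≤ Mw)
    (h4 : av ≤ r + g) :
    min cap (Mv - Mw) ≤ (min cap (Mv - r) - (av - r)) + g := by omega

theorem M_linkL (u : I) (μu μv : ℕ) : d.M (u, μu + μv) ≤ d.M (u, μu) + gam μv μu := by
  simp only [M, gam]; omega

theorem log_add_ge (μv μu : ℕ) : Nat.log 2 μu + gam μv μu = Nat.log 2 (μu + μv) := by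
  have := log_le_log (show μu ≤ μu + μv by omega)
  simp only [gam]; omega

theorem gapsE_linkL (u : I) (μu μv : ℕ) (stk) :
    gaps d.gapE ((u, μu + μv) :: stk) ≤ gaps d.gapE ((u, μu) :: stk) := by
  refine gaps_top_le (fun _ _ => le_rfl) 0 stk (fun p _ => ?_)
  have := log_le_log (show μu ≤ μu + μv by omega)
  simp only [gapE, M]
  omega

/-- The masses, totals and logarithms of a left link. -/
structure FactsL (v : I) (μv : ℕ) (u : I) (μu r : ℕ) (t : Option (I × ℕ × ℕ)) : Prop where
  r_ls : r ≤ d.ls v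
  sv : Nat.log 2 (d.sg v) ≤ Nat.log 2 μv
  au : Nat.log 2 μu ≤ Nat.log 2 (μu + μv)
  av : Nat.log 2 μv ≤ Nat.log 2 (μu + μv)
  top : Nat.log 2 (μu + μv) ≤ Nat.log 2 d.S0
  N_le : d.N (v, μv) t ≤ d.M (v, μv)
  a_le : Nat.log 2 μv ≤ d.N (v, μv) t
  r_le : r ≤ d.N (v, μv) t

theorem factsN {v μv stk R t} (h : Inv d ⟨(v, μv) :: stk, R, t⟩) :
    d.N (v, μv) t ≤ d.M (v, μv) ∧ Nat.log 2 μv ≤ d.N (v, μv) t ∧ d.lsR R ≤ d.N (v, μv) t := by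
  have lv := h.lsR_le d (p := (v, μv)) (by simp)
  dsimp only at lv
  rcases t with _ | ⟨t, m, m0⟩
  · simp only [N, M]; omega
  · obtain ⟨v', stk', he, h1, h2, h3, h4, h5, h6⟩ := h.record t m m0 rfl
    simp only [List.cons.injEq, Prod.mk.injEq] at he
    obtain ⟨⟨rfl, rfl⟩, rfl⟩ := he
    have e1 := log_le_log h4
    have e2 := log_le_log h5
    simp only [N, M, ls, lsR] at *
    omega

theorem factsL {v μv u μu stk R r} (h : Inv d ⟨(v, μv) :: (u, μu) :: stk, R, r⟩) :
    FactsL d v μv u μu (d.lsR R) r := by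
  have hv := h.mem (v, μv) (by simp)
  have lv := h.lsR_le d (p := (v, μv)) (by simp)
  have hN := factsN d h
  have hs := h.sum
  have := total_pos d.sg R
  simp only [List.map_cons, List.sum_cons] at hs
  exact ⟨lv, log_le_log hv.2.1, log_le_log (by omega), log_le_log (by omega), log_le_log (by omega), hN.1, hN.2.1, hN.2.2⟩

theorem fundE_push {stk w R} (h : Inv d ⟨stk, w :: R, none⟩) :
    d.fundE ⟨(w, d.sg w) :: stk, R, none⟩ ≤ d.fundE ⟨stk, w :: R, none⟩ := by
  have hr := d.lsR_le_lsR_cons w R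
  have hw := h.wf
  simp only [Wf] at hw
  have e : d.M (w, d.sg w) = d.lsR (w :: R) := by
    simp only [M, ls, lsR, hw.1]
    exact max_eq_left (log_le_log (by rw [total_cons]; omega))
  simp only [fundE, topE, e]
  rcases stk with _ | ⟨p, stk⟩
  · simp only [gaps]; omega
  · simp only [gaps_cons, gapE, e]; omega

theorem fundE'_open (stk : List (I × ℕ)) (R) : d.fundE' ⟨stk, R, none⟩ = d.fundE ⟨stk, R, none⟩ :=
  rfl

theorem fundE_linkL {v μv u μu stk R r} (h : Inv d ⟨(v, μv) :: (u, μu) :: stk, R, r⟩) :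
    d.fundE ⟨(u, μu + μv) :: stk, R, some (v, μv, μu)⟩ +
      min d.cap (Nat.log 2 μu - d.M (v, μv)) ≤
      d.fundE ⟨(v, μv) :: (u, μu) :: stk, R, r⟩ + 2 * gam μv μu := by
  have h1 := gapsE_linkL d u μu μv stk
  have f := factsL d h
  have h2 := M_linkL d u μu μv
  have h3 : d.lsR R ≤ d.M (v, μv) := f.r_ls.trans (le_max_left _ _)
  have h4 : Nat.log 2 μu ≤ d.M (u, μu) := le_max_right _ _
  have h5 := arith_E_open (cap := d.cap) h3 h4 h2 f.au
  have h6 := arith_E_closed (cap := d.cap) h3 h4 h2 f.au f.av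
  cases r
  · simp only [fundE, topE, dl, gaps_cons] at *
    simp only [gapE] at *
    linarith
  · simp only [fundE, topE, dl, gaps_cons] at *
    simp only [gapE] at *
    linarith

theorem fundE'_linkL {v μv u μu stk R r} (h : Inv d ⟨(v, μv) :: (u, μu) :: stk, R, r⟩) :
    d.fundE' ⟨(u, μu + μv) :: stk, R, some (v, μv, μu)⟩ +
      min d.cap (min (d.M (v, μv) - d.N (v, μv) r)
        (Nat.log 2 μu - max (Nat.log 2 μv) (d.lsR R))) ≤
      d.fundE' ⟨(v, μv) :: (u, μu) :: stk, R, r⟩ + 2 * gam μv μu := by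
  have h1 := gapsE_linkL d u μu μv stk
  have f := factsL d h
  have h2 := M_linkL d u μu μv
  have h3 : d.lsR R ≤ d.M (v, μv) := f.r_ls.trans (le_max_left _ _)
  have h7 : d.M (v, μv) ≤ max (Nat.log 2 (μu + μv)) (d.ls v) := by
    rw [max_comm]; exact max_le_max le_rfl f.av
  cases r with
  | none =>
    have h5 := arith_E'_open (au' := Nat.log 2 (μu + μv)) (cap := d.cap) f.r_ls
      (rfl : d.M (v, μv) = _) h2
    have h8 : min d.cap (min (d.M (v, μv) - d.N (v, μv) none)
        (Nat.log 2 μu - max (Nat.log 2 μv) (d.lsR R))) = 0 := by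
      simp [N]
    simp only [fundE', topE', gaps_cons, h8, dl, N] at *
    simp only [gapE] at *
    linarith
  | some t =>
    have h5 := arith_E'_closed (cap := d.cap) (N := d.N (v, μv) (some t)) h3 h7 h2 f.au f.av
    simp only [fundE', topE', dl, gaps_cons] at *
    simp only [gapE] at *
    simp only [N] at *
    linarith

theorem err_le {v μv u μu stk R r} (h : Inv d ⟨(v, μv) :: (u, μu) :: stk, R, r⟩) :
    d.err (v, μv) (u, μu) r ≤ min d.cap (Nat.log 2 μu - d.M (v, μv)) +
      min d.cap (min (d.M (v, μv) - d.N (v, μv) r)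
        (Nat.log 2 μu - max (Nat.log 2 μv) (d.lsR R))) := by
  have f := factsL d h
  have h1 := f.N_le
  have h2 := f.a_le
  have h3 := f.r_le
  simp only [err]
  generalize d.N (v, μv) r = n at *
  generalize d.M (v, μv) = n' at *
  generalize Nat.log 2 μu = n1 at *
  generalize Nat.log 2 μv = n2 at *
  clear f h
  omega

/-- The masses, totals and logarithms of a right link. -/
structure FactsR (v : I) (μv : ℕ) (w : I) (R : List I) : Prop where
  r_ls : d.lsR (w :: R) ≤ d.ls v
  lsw : d.ls w = d.lsR (w :: R)
  sv : Nat.log 2 (d.sg v) ≤ Nat.log 2 μv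
  sw : Nat.log 2 (d.sg w) ≤ d.lsR (w :: R)
  aw : Nat.log 2 (d.sg w) ≤ Nat.log 2 (d.sg w + μv)
  av : Nat.log 2 μv ≤ Nat.log 2 (d.sg w + μv)

theorem factsR {v μv stk w R r} (h : Inv d ⟨(v, μv) :: stk, w :: R, r⟩) : FactsR d v μv w R := by
  have hv := h.mem (v, μv) (by simp)
  have lv := h.lsR_le d (p := (v, μv)) (by simp)
  have hw := h.wf
  have hs := h.sum
  simp only [List.map_cons, List.sum_cons, total_cons] at hs
  simp only [Wf] at hw
  exact ⟨lv, by rw [ls, lsR, hw.1], log_le_log hv.2.1, log_le_log (by rw [total_cons]; omega),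
    log_le_log (by omega), log_le_log (by omega)⟩

theorem fundE_linkR_aux {v μv stk w R r} (h : Inv d ⟨(v, μv) :: stk, w :: R, r⟩) (X : ℕ)
    (hX : min d.cap (d.M (v, μv) - d.M (w, d.sg w + μv)) ≤ X + gam μv (d.sg w)) :
    d.fundE ⟨(w, d.sg w + μv) :: stk, R, none⟩ ≤
      gaps d.gapE ((v, μv) :: stk) + d.lsR (w :: R) + X + 2 * gam μv (d.sg w) := by
  have hr := d.lsR_le_lsR_cons w R
  have f := factsR d h
  have h2 : d.M (w, d.sg w + μv) ≤ d.lsR (w :: R) + gam μv (d.sg w) := by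
    have := f.sw
    have := f.aw
    simp only [M, gam, f.lsw]
    omega
  have h3 : d.lsR (w :: R) ≤ d.M (w, d.sg w + μv) := f.lsw ▸ le_max_left _ _
  cases stk with
  | nil =>
    have := arith_E_right (cap := d.cap) (Mp := 0) hr h3 h2 hX
    simp only [fundE, topE, gaps, Nat.zero_sub, Nat.min_zero] at *
    linarith
  | cons p stk =>
    have := arith_E_right (cap := d.cap) (Mp := d.M p) hr h3 h2 hX
    simp only [fundE, topE, gaps_cons, gapE] at *
    linarith

theorem hX_linkR {v μv stk w R r} (h : Inv d ⟨(v, μv) :: stk, w :: R, r⟩) :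
    min d.cap (d.M (v, μv) - d.M (w, d.sg w + μv)) ≤
      d.dl (d.lsR (w :: R)) (v, μv) + gam μv (d.sg w) ∧
    min d.cap (d.M (v, μv) - d.M (w, d.sg w + μv)) ≤
      min d.cap (d.M (v, μv) - d.lsR (w :: R)) + gam μv (d.sg w) := by
  have f := factsR d h
  have h3 : d.lsR (w :: R) ≤ d.M (w, d.sg w + μv) := f.lsw ▸ le_max_left _ _
  refine ⟨arith_E_right_closed h3 (f.av.trans (le_max_right _ _)) ?_, ?_⟩
  · have := f.sw
    have := f.av
    have := f.aw
    simp only [gam]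
    omega
  · omega

theorem fundE_linkR {v μv stk w R r} (h : Inv d ⟨(v, μv) :: stk, w :: R, r⟩) :
    d.fundE ⟨(w, d.sg w + μv) :: stk, R, none⟩ ≤
      d.fundE ⟨(v, μv) :: stk, w :: R, r⟩ + 2 * gam μv (d.sg w) := by
  have hX := hX_linkR d h
  cases r
  · exact fundE_linkR_aux d h _ hX.2
  · exact fundE_linkR_aux d h _ hX.1

theorem fundE'_linkR {v μv stk w R r} (h : Inv d ⟨(v, μv) :: stk, w :: R, r⟩) :
    d.fundE' ⟨(w, d.sg w + μv) :: stk, R, none⟩ ≤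
      d.fundE' ⟨(v, μv) :: stk, w :: R, r⟩ + 2 * gam μv (d.sg w) := by
  have hX := hX_linkR d h
  cases r
  · exact fundE_linkR_aux d h _ hX.2
  · refine fundE_linkR_aux d h _ (hX.1.trans ?_)
    exact Nat.add_le_add_right (le_max_right _ _) _

theorem topE_le (r : ℕ) (stk) : d.topE r stk none ≤ d.cap := by
  cases stk <;> simp [topE]

theorem gaps_tail_le (g : I × ℕ → I × ℕ → ℕ) (p) : ∀ stk, gaps g stk ≤ gaps g (p :: stk)
  | [] => Nat.zero_le _
  | q :: stk => by rw [gaps_cons]; omega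

theorem fundE_drop (v μv) (stk) (R) (r) :
    d.fundE ⟨stk, R, none⟩ ≤ d.fundE ⟨(v, μv) :: stk, R, r⟩ + d.cap := by
  have h1 := topE_le d (d.lsR R) stk
  have h2 := gaps_tail_le d.gapE (v, μv) stk
  simp only [fundE]
  omega

theorem fundE'_drop (v μv) (stk) (R) (r) :
    d.fundE' ⟨stk, R, none⟩ ≤ d.fundE' ⟨(v, μv) :: stk, R, r⟩ + d.cap := by
  have h1 := topE_le d (d.lsR R) stk
  have h2 := gaps_tail_le d.gapE (v, μv) stk
  simp only [fundE'_open]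
  simp only [fundE', fundE]
  omega

end Run
end SlimHeap

namespace SlimHeap
namespace Run
variable {I : Type*} (d : Data I)
open Data

theorem pow_le_of_le_log {k X : ℕ} (hk : 1 ≤ k) (h : k ≤ Nat.log 2 X) : 2 ^ k ≤ X := by
  refine Nat.pow_le_of_le_log ?_ h
  rintro rfl
  simp at h
  omega

theorem b'_le_cap {μv μz : ℕ} (h : Nat.log 2 (μz + μv) ≤ Nat.log 2 d.S0) : b' μv μz ≤ d.cap :=
  log_le_log (by omega)

theorem Inv.record_facts {v μv stk R t m m0} (h : Inv d ⟨(v, μv) :: stk, R, some (t, m, m0)⟩) :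
    μv = m0 + m ∧ Nat.log 2 (d.sg t) ≤ Nat.log 2 m ∧ Nat.log 2 m ≤ Nat.log 2 μv ∧
      d.ls t ≤ d.ls v ∧ d.lsR R ≤ d.ls t := by
  obtain ⟨v', stk', he, h1, h2, h3, h4, h5, h6⟩ := h.record t m m0 rfl
  simp only [List.cons.injEq, Prod.mk.injEq] at he
  exact ⟨he.1.2, log_le_log h3, log_le_log (by omega), he.1.1 ▸ log_le_log h4, log_le_log h5⟩

theorem b'_le_linkL {v μv u μu stk R r} (h : Inv d ⟨(v, μv) :: (u, μu) :: stk, R, r⟩) :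
    b' μv μu ≤ d.b v + (d.err (v, μv) (u, μu) r + gam μv μu) := by
  have f := factsL d h
  have hc := b'_le_cap d f.top
  rcases le_total (Nat.log 2 μu - d.N (v, μv) r) d.cap with h1 | h1
  · refine log_le_add ?_
    have h2 := f.N_le
    have h3 := f.a_le
    have h4 := f.sv
    have h5 := log_add_ge μv μu
    simp only [err, min_eq_right h1, x]
    simp only [M, ls] at h2
    omega
  · simp only [err, min_eq_left h1]
    omega

theorem b'_le_record_linkL {v μv u μu stk R t m m0}
    (h : Inv d ⟨(v, μv) :: (u, μu) :: stk, R, some (t, m, m0)⟩) :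
    b' μv μu ≤ d.b t + (d.err (v, μv) (u, μu) (some (t, m, m0)) + gam μv μu) := by
  have f := factsL d h
  have hc := b'_le_cap d f.top
  have hr := h.record_facts
  rcases le_total (Nat.log 2 μu - d.N (v, μv) (some (t, m, m0))) d.cap with h1 | h1
  · refine log_le_add ?_
    have h5 := log_add_ge μv μu
    simp only [err, min_eq_right h1, x]
    simp only [N, ls] at *
    omega
  · simp only [err, min_eq_left h1]
    omega

theorem b'_le_linkR {v μv stk w R r} (h : Inv d ⟨(v, μv) :: stk, w :: R, r⟩) :
    b' μv (d.sg w) ≤ d.b v + gam μv (d.sg w) := by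
  have f := factsR d h
  have h1 := f.r_ls
  have h2 := f.sv
  have h3 := f.sw
  have h5 := log_add_ge μv (d.sg w)
  refine log_le_add ?_
  simp only [x, ls] at *
  omega

theorem b'_le_record_linkR {v μv stk w R t m m0}
    (h : Inv d ⟨(v, μv) :: stk, w :: R, some (t, m, m0)⟩) :
    b' μv (d.sg w) ≤ d.b t + gam μv (d.sg w) := by
  have f := factsR d h
  have hr := h.record_facts
  have h3 := f.sw
  have h5 := log_add_ge μv (d.sg w)
  refine log_le_add ?_
  simp only [x, ls] at *
  omega

theorem b_right_le {v μv stk w R r} (h : Inv d ⟨(v, μv) :: stk, w :: R, r⟩) :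
    d.b w ≤ d.b v + gam μv (d.sg w) ∧
    d.b w ≤ m (d.lsR (w :: R)) μv + gam μv (d.sg w) ∧
    b' μv (d.sg w) ≤ m (d.lsR (w :: R)) μv + gam μv (d.sg w) := by
  have f := factsR d h
  have h1 := f.r_ls
  have h2 := f.sv
  have h3 := f.sw
  have h4 := f.lsw
  have h6 := f.av
  have h5 := log_add_ge μv (d.sg w)
  refine ⟨log_le_add ?_, log_le_add ?_, log_le_add ?_⟩
  all_goals
    simp only [x, ls] at *
    omega

namespace Data

/-- Indicator of `c i = b i`. -/
def tight (i : I) : ℕ := if d.c i = d.b i then 1 else 0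

def nc (s : St I) : ℕ :=
  (s.stk.map fun p => d.tight p.1).sum +
    match s.cl, s.stk with
    | some _, v :: _ => d.tight v.1
    | _, _ => 0

/-- Indicator of a current root whose last link keeps it from losing cheaply. -/
def df (s : St I) : ℕ :=
  match s.cl, s.stk with
  | some (t, m, m0), v :: _ =>
    if d.b t = d.b v.1 ∧ gam m m0 = 0 ∧ 1 ≤ d.b t ∧ d.b t ≤ b' m m0 then 1 else 0
  | _, _ => 0

def small (i : I) : ℕ := if d.x i ≤ 1 then 1 else 0

def sp (s : St I) : ℕ := (s.stk.map fun p => d.small p.1).sum + (s.R.map d.small).sum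

def dy (s : St I) : ℤ :=
  match s.cl, s.stk with
  | some (t, m, m0), v :: _ => ((d.b v.1 - b' m m0 : ℕ) : ℤ) - (d.b t - b' m m0 : ℕ)
  | _, _ => 0

/-- The amount by which a link of `v` under `z` is good. -/
def good (v z : I × ℕ) (e : ℕ) : ℕ :=
  (d.b v.1 - b' v.2 z.2) + ((d.b z.1 - d.c v.1) + (d.c v.1 - d.b z.1)) + e + gam v.2 z.2 +
    d.small v.1

end Data

theorem tight_le (i : I) : d.tight i ≤ 1 := by
  simp only [tight]; split <;> omega

theorem contradiction_of_df {μ0 m μz k xt lt st : ℕ} (hk : 1 ≤ k) (h1 : k ≤ b' m μ0)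
    (h2 : k ≤ b' (μ0 + m) μz) (hg : gam (μ0 + m) μz = 0)
    (hz : Nat.log 2 μz ≤ max (Nat.log 2 (μ0 + m)) lt) (hx : xt = lt - st) (hs : st ≤ Nat.log 2 m)
    (hb : Nat.log 2 xt = k) : False := by
  have a1 := pow_le_of_le_log hk h1
  have a2 := pow_le_of_le_log hk h2
  have a3 : xt < 2 ^ (k + 1) := hb ▸ Nat.lt_pow_succ_log_self (by norm_num) xt
  have a4 := log_add_ge (μ0 + m) μz
  have a5 := Nat.one_le_two_pow (n := k)
  rw [pow_succ] at a3
  omega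

theorem df_linkL {v μv u μu stk R r} (h : Inv d ⟨(v, μv) :: (u, μu) :: stk, R, r⟩) :
    d.tight v + d.df ⟨(v, μv) :: (u, μu) :: stk, R, r⟩ ≤
      2 * d.good (v, μv) (u, μu) (d.err (v, μv) (u, μu) r) +
        d.df ⟨(u, μu + μv) :: stk, R, some (v, μv, μu)⟩ := by
  have ht := tight_le d v
  by_cases hg : 1 ≤ d.good (v, μv) (u, μu) (d.err (v, μv) (u, μu) r)
  · have : d.df ⟨(v, μv) :: (u, μu) :: stk, R, r⟩ ≤ 1 := by
      rcases r with _ | ⟨t, m, m0⟩ <;> simp only [df] <;> [omega; (split <;> omega)]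
    omega
  have hg0 : d.good (v, μv) (u, μu) (d.err (v, μv) (u, μu) r) = 0 := by omega
  simp only [good, Nat.add_eq_zero_iff] at hg0
  obtain ⟨⟨⟨⟨g1, g2⟩, g3⟩, g4⟩, g5⟩ := hg0
  have hv : d.df ⟨(v, μv) :: (u, μu) :: stk, R, r⟩ = 0 := by
    rcases r with _ | ⟨t, m, m0⟩
    · rfl
    · simp only [df]
      refine if_neg fun hh => ?_
      obtain ⟨e1, e2, e3, e4⟩ := hh
      have hr := h.record_facts
      have hcap := h.b_le_cap d (p := (v, μv)) (by simp)
      obtain ⟨rfl, hr⟩ := hr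
      refine contradiction_of_df (k := d.b t) (xt := d.x t) (lt := d.ls t) e3 e4 ?_ g4 ?_ rfl
        hr.1 rfl
      · omega
      · simp only [err, N] at g3
        dsimp only at hcap g3
        omega
  rw [hv]
  by_cases hc : d.c v = d.b v
  · have hx : 1 ≤ d.b v := by
      have : 2 ≤ d.x v := by
        simp only [small] at g5
        by_contra hx
        rw [if_pos (by omega)] at g5
        omega
      exact Nat.log_pos (by norm_num) this
    have : d.df ⟨(u, μu + μv) :: stk, R, some (v, μv, μu)⟩ = 1 := by
      simp only [df]
      rw [if_pos]
      refine ⟨?_, g4, hx, ?_⟩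
      · omega
      · omega
    omega
  · have : d.tight v = 0 := if_neg hc
    omega

theorem df_linkR {v μv stk w R r} (h : Inv d ⟨(v, μv) :: stk, w :: R, r⟩) :
    d.tight v + d.df ⟨(v, μv) :: stk, w :: R, r⟩ ≤ 2 * d.good (v, μv) (w, d.sg w) 0 := by
  have ht := tight_le d v
  by_cases hg : 1 ≤ d.good (v, μv) (w, d.sg w) 0
  · have : d.df ⟨(v, μv) :: stk, w :: R, r⟩ ≤ 1 := by
      rcases r with _ | ⟨t, m, m0⟩ <;> simp only [df] <;> [omega; (split <;> omega)]
    omega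
  have f := factsR d h
  have hg0 : d.good (v, μv) (w, d.sg w) 0 = 0 := by omega
  simp only [good, Nat.add_eq_zero_iff] at hg0
  obtain ⟨⟨⟨⟨g1, g2⟩, g3⟩, g4⟩, g5⟩ := hg0
  have hv : d.df ⟨(v, μv) :: stk, w :: R, r⟩ = 0 := by
    rcases r with _ | ⟨t, m, m0⟩
    · rfl
    · simp only [df]
      refine if_neg fun hh => ?_
      obtain ⟨e1, e2, e3, e4⟩ := hh
      have hr := h.record_facts
      obtain ⟨rfl, hr⟩ := hr
      refine contradiction_of_df (k := d.b t) (xt := d.x t) (lt := d.ls t) e3 e4 ?_ g4 ?_ rfl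
        hr.1 rfl
      · omega
      · exact (f.sw.trans hr.2.2.2).trans (le_max_right _ _)
  rw [hv]
  by_cases hc : d.c v = d.b v
  · exfalso
    have hx2 : 2 ≤ d.x v := by
      simp only [small] at g5
      by_contra hx
      rw [if_pos (by omega)] at g5
      omega
    have hx : 1 ≤ d.b v := Nat.log_pos (by norm_num) hx2
    have a1 : 2 ^ d.b v ≤ _ := pow_le_of_le_log hx (show d.b v ≤ b' μv (d.sg w) by omega)
    have a2 : 2 ^ d.b v ≤ d.x w := pow_le_of_le_log hx (show d.b v ≤ d.b w by omega)
    have a3 : d.x v < 2 ^ (d.b v + 1) := Nat.lt_pow_succ_log_self (by norm_num) _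
    have a4 := log_add_ge μv (d.sg w)
    have a5 := f.r_ls
    have a6 := f.sv
    have a7 := f.lsw
    have a8 := f.sw
    have a9 := Nat.one_le_two_pow (n := d.b v)
    rw [pow_succ] at a3
    simp only [x, ls] at *
    omega
  · have : d.tight v = 0 := if_neg hc
    omega

theorem nc_linkL (v μv u μu stk R r) :
    d.tight u + d.nc ⟨(v, μv) :: (u, μu) :: stk, R, r⟩ ≤
      2 * d.tight v + d.nc ⟨(u, μu + μv) :: stk, R, some (v, μv, μu)⟩ := by
  cases r <;> simp only [nc, List.map_cons, List.sum_cons] <;> omega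

theorem nc_linkR (v μv w stk R r) :
    d.tight w + d.nc ⟨(v, μv) :: stk, w :: R, r⟩ ≤
      2 * d.tight v + d.nc ⟨(w, d.sg w + μv) :: stk, R, none⟩ := by
  cases r <;> simp only [nc, List.map_cons, List.sum_cons] <;> omega

theorem dy_link {bv bt b't b'v e : ℕ} (h : b'v ≤ bt + e) :
    ((bv - b't : ℕ) : ℤ) - (bt - b't : ℕ) ≤ (bv - b'v : ℕ) + e := by omega

theorem dy_linkL {v μv u μu stk R r} (h : Inv d ⟨(v, μv) :: (u, μu) :: stk, R, r⟩) :
    ((d.b u - b' μv μu : ℕ) : ℤ) + d.dy ⟨(v, μv) :: (u, μu) :: stk, R, r⟩ ≤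
      2 * (d.b v - b' μv μu : ℕ) + d.err (v, μv) (u, μu) r + gam μv μu +
        d.dy ⟨(u, μu + μv) :: stk, R, some (v, μv, μu)⟩ := by
  rcases r with _ | ⟨t, m, m0⟩
  · simp only [dy]; omega
  · have := dy_link (bv := d.b v) (b't := b' m m0) (b'_le_record_linkL d h)
    push_cast at this
    simp only [dy]; omega

theorem dy_linkR {v μv stk w R r} (h : Inv d ⟨(v, μv) :: stk, w :: R, r⟩) :
    ((d.b w - b' μv (d.sg w) : ℕ) : ℤ) + d.dy ⟨(v, μv) :: stk, w :: R, r⟩ ≤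
      2 * (d.b v - b' μv (d.sg w) : ℕ) + 2 * gam μv (d.sg w) := by
  have h2 := (b_right_le d h).1
  rcases r with _ | ⟨t, m, m0⟩
  · simp only [dy]; omega
  · have := dy_link (bv := d.b v) (b't := b' m m0) (b'_le_record_linkR d h)
    simp only [dy]; omega

/-- The potential of a state. -/
def Data.pot (s : St I) : ℤ :=
  8 * d.fundA s + d.fundB s - d.nc s - 2 * d.df s + 4 * d.sp s + 103 * (d.fundE s + d.fundE' s)
    - 23 * d.dy s

/-- An upper bound for the cost of a link of `v` under `z`. -/
def Data.cost (v z : I × ℕ) : ℤ :=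
  1 + 67 * ((b' v.2 z.2 : ℤ) - d.b v.1) - 5 * ((min (d.b z.1) (b' v.2 z.2) : ℕ) - d.c v.1) +
    18 * (d.b z.1 - (min (d.b z.1) (b' v.2 z.2) : ℕ)) + 9 * |(b' v.2 z.2 : ℤ) - d.b v.1|

theorem cost_arith {bv b'v cv bz cz g D G e Q : ℕ} {tz : ℕ} (hcz : cz ≤ bz)
    (htz : tz = if cz = bz then 1 else 0) (hG : G = bv - b'v) (hD : D = cv - bz)
    (hb : b'v ≤ bv + (e + g)) (hQ : Q = G + ((bz - cv) + (cv - bz)) + e + g) :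
    1 + 67 * ((b'v : ℤ) - bv) - 5 * ((min bz b'v : ℕ) - cv) +
      18 * (bz - (min bz b'v : ℕ)) + 9 * |(b'v : ℤ) - bv| ≤
    tz + 76 * (e + g) - 58 * G - 4 * Q + (cv - cz) + 4 * G + 8 * D + 4 * e + 4 * g +
      23 * (bz - b'v : ℕ) := by
  have h1 : (1 : ℤ) ≤ tz + (bz - cz) := by
    subst htz; split <;> omega
  have h2 : ((min bz b'v : ℕ) : ℤ) = bz - (bz - b'v : ℕ) := by omega
  have h3 : |(b'v : ℤ) - bv| ≤ (e + g : ℕ) - G + 2 * G := by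
    rw [abs_le]; omega
  have h4 : (b'v : ℤ) - bv + |(b'v : ℤ) - bv| ≤ 2 * (e + g) := by
    rcases abs_cases ((b'v : ℤ) - bv) with h | h <;> omega
  have h5 : (b'v : ℤ) - bv ≤ (e + g) - G := by omega
  have h6 : (Q : ℤ) = G + ((bz - cv) + 2 * D) + e + g := by omega
  rw [h2]
  push_cast at h3
  rw [h6]
  linarith

end Run
end SlimHeap

namespace SlimHeap
namespace Run
variable {I : Type*} (d : Data I)
open Data

theorem cost_linkL {v μv u μu stk R r} (h : Inv d ⟨(v, μv) :: (u, μu) :: stk, R, r⟩) :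
    d.cost (v, μv) (u, μu) ≤ d.pot ⟨(v, μv) :: (u, μu) :: stk, R, r⟩ -
      d.pot ⟨(u, μu + μv) :: stk, R, some (v, μv, μu)⟩ + 600 * gam μv μu := by
  have hu := (h.mem (u, μu) (by simp)).2.2.1
  have a0 := cost_arith (cv := d.c v) hu (tz := d.tight u) rfl rfl rfl (b'_le_linkL d h) rfl
  have a1 := fundA_linkL d h
  have a2 := fundB_linkL d (v := v) (μv := μv) (u := u) (μu := μu) (stk := stk) (R := R) (r := r)
  have a3 := fundE_linkL d h
  have a4 := fundE'_linkL d h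
  have a5 := err_le d h
  have a6 := dy_linkL d h
  have a7 := nc_linkL d v μv u μu stk R r
  have a8 := df_linkL d h
  have a9 : d.sp ⟨(v, μv) :: (u, μu) :: stk, R, r⟩ =
      d.small v + d.sp ⟨(u, μu + μv) :: stk, R, some (v, μv, μu)⟩ := by
    simp only [sp, List.map_cons, List.sum_cons]; omega
  simp only [good, cost, pot] at *
  zify at *
  linarith

theorem cost_linkR {v μv stk w R r} (h : Inv d ⟨(v, μv) :: stk, w :: R, r⟩) :
    d.cost (v, μv) (w, d.sg w) ≤ d.pot ⟨(v, μv) :: stk, w :: R, r⟩ -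
      d.pot ⟨(w, d.sg w + μv) :: stk, R, none⟩ + 600 * gam μv (d.sg w) := by
  have hw := h.wf
  simp only [Wf] at hw
  have hv := (h.mem (v, μv) (by simp)).2.2.1
  have a0 := cost_arith (cv := d.c v) (e := 0) hw.2.2.1 (tz := d.tight w) rfl rfl rfl
    (by simpa using b'_le_linkR d h) rfl
  have a1 := fundA_linkR d h
  have a2 := fundB_linkR d (v := v) (μv := μv) (w := w) (stk := stk) (R := R) (r := r)
  have a3 := fundE_linkR d h
  have a4 := fundE'_linkR d h
  obtain ⟨-, b2, b3⟩ := b_right_le d h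
  have a5 : d.c v - d.b w ≤ (min (d.c v) (m (d.lsR (w :: R)) μv) - d.b w) +
      ((d.b v - b' μv (d.sg w)) + gam μv (d.sg w)) := by
    clear a0 a1 a2 a3 a4; dsimp only at hv; omega
  have a5' : d.b w - m (d.lsR (w :: R)) μv ≤ gam μv (d.sg w) := by
    clear a0 a1 a2 a3 a4 a5; omega
  have a6 := dy_linkR d h
  have a7 := nc_linkR d v μv w stk R r
  have a8 := df_linkR d h
  have a9 : d.sp ⟨(v, μv) :: stk, w :: R, r⟩ =
      d.small v + d.sp ⟨(w, d.sg w + μv) :: stk, R, none⟩ := by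
    simp only [sp, List.map_cons, List.sum_cons]; omega
  have a10 : d.df ⟨(w, d.sg w + μv) :: stk, R, none⟩ = 0 := rfl
  have a11 : d.dy ⟨(w, d.sg w + μv) :: stk, R, none⟩ = 0 := rfl
  have a12 := (gam μv (d.sg w)).zero_le
  clear b2 b3 hw hv h
  simp only [good, cost, pot, a10, a11] at *
  generalize min (d.c v) (m (d.lsR (w :: R)) μv) - d.b w = X1 at *
  generalize d.b w - m (d.lsR (w :: R)) μv = X2 at *
  zify at *
  linarith

theorem pot_push {stk w R} (h : Inv d ⟨stk, w :: R, none⟩) :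
    d.pot ⟨(w, d.sg w) :: stk, R, none⟩ ≤ d.pot ⟨stk, w :: R, none⟩ := by
  have a1 := fundA_push d h
  have a2 := fundB_push d (stk := stk) (w := w) (R := R)
  have a3 := fundE_push d h
  have a5 : d.nc ⟨stk, w :: R, none⟩ ≤ d.nc ⟨(w, d.sg w) :: stk, R, none⟩ := by
    simp only [nc, List.map_cons, List.sum_cons]; omega
  have a6 : d.sp ⟨(w, d.sg w) :: stk, R, none⟩ = d.sp ⟨stk, w :: R, none⟩ := by
    simp only [sp, List.map_cons, List.sum_cons]; omega
  simp only [pot, fundE'_open, df, dy]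
  omega

theorem pot_drop {v μv stk R r} (h : Inv d ⟨(v, μv) :: stk, R, r⟩) :
    d.pot ⟨stk, R, none⟩ ≤ d.pot ⟨(v, μv) :: stk, R, r⟩ + 240 * (d.cap + 1) := by
  have a1 := fundA_drop d h
  have a2 := fundB_drop d h
  have a3 := fundE_drop d v μv stk R r
  have a4 := fundE'_drop d v μv stk R r
  have a5 : d.nc ⟨(v, μv) :: stk, R, r⟩ ≤ d.nc ⟨stk, R, none⟩ + 2 := by
    have := tight_le d v
    cases r <;> simp only [nc, List.map_cons, List.sum_cons] <;> omega
  have a6 : d.sp ⟨stk, R, none⟩ ≤ d.sp ⟨(v, μv) :: stk, R, r⟩ := by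
    simp only [sp, List.map_cons, List.sum_cons]; omega
  have a7 : d.df ⟨(v, μv) :: stk, R, r⟩ ≤ 1 := by
    rcases r with _ | ⟨t, m, m0⟩ <;> simp only [df] <;> [omega; (split <;> omega)]
  have a8 : d.dy ⟨(v, μv) :: stk, R, r⟩ ≤ d.cap := by
    have := h.b_le_cap d (p := (v, μv)) (by simp)
    rcases r with _ | ⟨t, m, m0⟩ <;> simp only [dy] at * <;> omega
  have a9 : d.df ⟨stk, R, none⟩ = 0 := rfl
  have a10 : d.dy ⟨stk, R, none⟩ = 0 := rfl
  simp only [pot, a9, a10]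
  omega

theorem small_count : ∀ {l : List I}, d.Wf l → 2 ^ (l.map d.small).sum ≤ total d.sg l ^ 3
  | [], _ => by simp [total]
  | w :: R, h => by
    have ih := small_count h.2.2.2
    have h1 := total_cons d.sg w R
    have h2 := h.1
    have h3 := h.2.1
    rw [List.map_cons, List.sum_cons, pow_add]
    simp only [small]
    split_ifs with hx
    · have h4 : d.S w < 4 * d.sg w := by
        have a1 : d.S w < 2 ^ (Nat.log 2 (d.S w) + 1) := Nat.lt_pow_succ_log_self (by norm_num) _
        have a2 : 2 ^ Nat.log 2 (d.sg w) ≤ d.sg w := Nat.pow_log_le_self 2 (by omega)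
        have a3 : 2 ^ (Nat.log 2 (d.S w) + 1) ≤ 2 ^ (Nat.log 2 (d.sg w) + 2) := by
          apply Nat.pow_le_pow_right (by norm_num)
          simp only [Data.x] at hx
          omega
        rw [pow_add _ (Nat.log 2 (d.sg w)), show (2 : ℕ) ^ 2 = 4 by norm_num] at a3
        linarith
      have h5 : total d.sg R ≤ 3 * d.sg w := by omega
      rw [h1]
      generalize total d.sg R = T at *
      generalize d.sg w = s at *
      calc 2 ^ 1 * 2 ^ _ ≤ 2 * T ^ 3 := by rw [pow_one]; omega
        _ ≤ (s + T) ^ 3 := by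
          have : 64 * T ^ 3 ≤ 27 * (s + T) ^ 3 := by
            calc 64 * T ^ 3 = (4 * T) ^ 3 := by ring
              _ ≤ (3 * (s + T)) ^ 3 := Nat.pow_le_pow_left (by omega) 3
              _ = _ := by ring
          omega
    · rw [pow_zero, one_mul]
      exact ih.trans (Nat.pow_le_pow_left (by omega) 3)

theorem pot_init {l : List I} (h : d.Wf l) :
    d.pot ⟨[], l, none⟩ ≤ 9 * tv (l.map d.c) + 220 * (d.lsR l + 1) := by
  have h1 := small_count d h
  have h2 : (l.map d.small).sum ≤ 3 * (d.lsR l + 1) := by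
    have h3 : total d.sg l < 2 ^ (d.lsR l + 1) := Nat.lt_pow_succ_log_self (by norm_num) _
    have h4 : 2 ^ (l.map d.small).sum < 2 ^ (3 * (d.lsR l + 1)) := by
      refine h1.trans_lt ?_
      rw [mul_comm, pow_mul]
      exact Nat.pow_lt_pow_left h3 (by norm_num)
    exact ((Nat.pow_lt_pow_iff_right (by norm_num)).1 h4).le
  simp only [pot, fundA, fundB, nc, df, sp, dy, fundE, fundE', topE, topE', gaps, topA, topB,
    List.map_nil, List.sum_nil]
  push_cast
  zify at h2
  linarith

theorem pot_nil : d.pot ⟨[], [], none⟩ = 0 := by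
  simp [pot, fundA, fundB, nc, df, sp, dy, fundE, fundE', topE, topE', gaps, topA, topB, tv, lsR,
    total]

end Run
end SlimHeap

namespace SlimHeap

/-! ### The shape of a scan -/

/-- A run of the scan, with the keys forgotten. The flag tells that the current root has just won
a link against its right neighbor; then it does not move. -/
inductive Scan {I : Type*} [DecidableEq I] :
    List I → I → List I → Bool → (I → List I) → ℕ → I → (I → List I) → Prop
  | done (v : I) (f : Bool) (c : I → List I) : Scan [] v [] f c 0 v c
  | left {L u v R f c m r c'} (h : Scan L u R true (link c u v) m r c') :
      Scan (u :: L) v R f c (m + 1) r c'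
  | right {L v w R f c m r c'} (h : Scan L w R false (link c w v) m r c') :
      Scan L v (w :: R) f c (m + 1) r c'
  | move {L v w R c m r c'} (h : Scan (v :: L) w R false c m r c') :
      Scan L v (w :: R) false c m r c'

section

variable {I K : Type*} [DecidableEq I] [LinearOrder K]

theorem scan_shape (key : I → K) (L : List I) (v : I) (R : List I) (c : I → List I) (f : Bool)
    (hL : (v :: L).Pairwise (fun a b => key b < key a))
    (hf : f = true → ∀ w ∈ R.head?, key w ≤ key v) :
    Scan L v R f c (scan key L v R c).links (scan key L v R c).root
      (scan key L v R c).children := by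
  fun_induction scan key L v R c generalizing f with
  | case1 v c => exact .done v f c
  | case2 u L v c ih => exact .left (ih true (List.pairwise_cons.1 hL).2 (by simp))
  | case3 v w R c h ih => exact .right (ih false (by simp) (by simp))
  | case4 v w R c h ih =>
    cases f with
    | true => exact absurd (hf rfl w (by simp)) h
    | false => exact .move (ih false (by simpa using h) (by simp))
  | case5 u L v w R c h h' ih =>
    exact .left (ih true (List.pairwise_cons.1 hL).2 (by simpa using h'))
  | case6 u L v w R c h h' ih =>
    have hL' := List.pairwise_cons.1 hL
    have hu := List.pairwise_cons.1 hL'.2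
    refine .right (ih false (List.pairwise_cons.2 ⟨fun x hx => ?_, hL'.2⟩) (by simp))
    rcases List.mem_cons.1 hx with rfl | hx
    · exact not_le.1 h'
    · exact (hu.1 x hx).trans (not_le.1 h')
  | case7 u L v w R c h ih =>
    have hL' := List.pairwise_cons.1 hL
    have huv : key u ≤ key v := (hL'.1 u (by simp)).le
    have hvw : key v < key w := by
      by_contra hc
      exact h ⟨huv, not_lt.1 hc⟩
    cases f with
    | true => exact absurd (hf rfl w (by simp)) (not_le.2 hvw)
    | false =>
      refine .move (ih false (List.pairwise_cons.2 ⟨fun x hx => ?_, hL⟩) (by simp))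
      rcases List.mem_cons.1 hx with rfl | hx
      · exact hvw
      · exact (hL'.1 x hx).trans hvw

theorem scan_links (key : I → K) (L : List I) (v : I) (R : List I) (c : I → List I) :
    (scan key L v R c).links = L.length + R.length := by
  fun_induction scan key L v R c <;>
    simp_all [ScanResult.afterLink, ScanResult.afterMove] <;> omega

theorem scan_steps (key : I → K) (L : List I) (v : I) (R : List I) (c : I → List I) :
    (scan key L v R c).steps ≤ L.length + 2 * R.length := by
  fun_induction scan key L v R c <;>
    simp_all [ScanResult.afterLink, ScanResult.afterMove] <;> omega

omit [DecidableEq I] in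
theorem leftmostLocalMax_unique {key : I → K} {pre pre' : List I} {v v' : I} {post post' : List I}
    (h : LeftmostLocalMax key pre v post) (h' : LeftmostLocalMax key pre' v' post')
    (he : pre ++ v :: post = pre' ++ v' :: post') : pre = pre' ∧ v = v' ∧ post = post' := by
  rcases List.append_eq_append_iff.1 he with ⟨a, h1, h2⟩ | ⟨a, h1, h2⟩
  · cases a with
    | nil => simp_all
    | cons x a =>
      simp only [List.cons_append, List.cons.injEq] at h2
      obtain ⟨rfl, rfl⟩ := h2
      exact absurd h.1 (h'.2 pre v a h1)
  · cases a with
    | nil => simp_all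
    | cons x a =>
      simp only [List.cons_append, List.cons.injEq] at h2
      obtain ⟨rfl, rfl⟩ := h2
      exact absurd h'.1 (h.2 pre' v' a h1)

theorem linkStep_unique {key : I → K} {l : List I} {c : I → List I} {l₁ l₂ : List I}
    {c₁ c₂ : I → List I} (h₁ : LinkStep key l c l₁ c₁) (h₂ : LinkStep key l c l₂ c₂) :
    l₁ = l₂ ∧ c₁ = c₂ := by
  generalize hl : l = l' at h₂
  cases h₁ with
  | withLeft pre u v post _ hv hu =>
    cases h₂ with
    | withLeft pre' u' v' post' _ hv' hu' =>
      obtain ⟨h1, rfl, rfl⟩ := leftmostLocalMax_unique hv hv' (by simpa using hl)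
      obtain ⟨rfl, h2⟩ := List.append_inj' h1 rfl
      simp only [List.cons.injEq, and_true] at h2
      subst h2
      exact ⟨rfl, rfl⟩
    | withRight pre' v' w' post' _ hv' hw' =>
      obtain ⟨rfl, rfl, rfl⟩ := leftmostLocalMax_unique hv hv' (by simpa using hl)
      exact absurd (hu w' (by simp)) (not_le.2 (hw' u (by simp)))
  | withRight pre v w post _ hv hw =>
    cases h₂ with
    | withLeft pre' u' v' post' _ hv' hu' =>
      obtain ⟨rfl, rfl, rfl⟩ := leftmostLocalMax_unique hv hv' (by simpa using hl)
      exact absurd (hu' w (by simp)) (not_le.2 (hw u' (by simp)))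
    | withRight pre' v' w' post' _ hv' hw' =>
      obtain ⟨rfl, rfl, h1⟩ := leftmostLocalMax_unique hv hv' (by simpa using hl)
      simp only [List.cons.injEq] at h1
      obtain ⟨rfl, rfl⟩ := h1
      exact ⟨rfl, rfl⟩

theorem not_linkStep_singleton {key : I → K} {r : I} {c : I → List I} {l' : List I}
    {c' : I → List I} : ¬ LinkStep key [r] c l' c' := by
  intro h
  generalize hl : [r] = l at h
  cases h with
  | withLeft pre u v post _ hv hu =>
    have := congrArg List.length hl
    simp at this
    omega
  | withRight pre v w post _ hv hw =>
    have := congrArg List.length hl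
    simp at this
    omega

theorem linkAll_unique {key : I → K} {l : List I} {c : I → List I} {m₁ m₂ : ℕ} {r₁ r₂ : I}
    {c₁ c₂ : I → List I} (h₁ : LinkAll key l c m₁ r₁ c₁) (h₂ : LinkAll key l c m₂ r₂ c₂) :
    m₁ = m₂ ∧ r₁ = r₂ ∧ c₁ = c₂ := by
  induction h₁ generalizing m₂ with
  | one r c =>
    cases h₂ with
    | one => exact ⟨rfl, rfl, rfl⟩
    | step h _ => exact absurd h not_linkStep_singleton
  | step h hh ih =>
    cases h₂ with
    | one => exact absurd h not_linkStep_singleton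
    | step h' hh' =>
      obtain ⟨rfl, rfl⟩ := linkStep_unique h h'
      obtain ⟨rfl, rfl, rfl⟩ := ih hh'
      exact ⟨rfl, rfl, rfl⟩

theorem linkAll_shape {key : I → K} {v : I} {R : List I} {c : I → List I} {m : ℕ} {r : I}
    {c' : I → List I} (h : LinkAll key (v :: R) c m r c') : Scan [] v R false c m r c' := by
  obtain ⟨rfl, rfl, rfl⟩ := linkAll_unique h (scan_spec key v R c)
  exact scan_shape key [] v R c false (by simp) (by simp)

theorem linkAll_steps {key : I → K} {v : I} {R : List I} {c : I → List I} {m : ℕ} {r : I}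
    {c' : I → List I} (h : LinkAll key (v :: R) c m r c') :
    (scan key [] v R c).steps ≤ 2 * m := by
  obtain ⟨rfl, rfl, rfl⟩ := linkAll_unique h (scan_spec key v R c)
  have h1 := scan_steps key [] v R c
  have h2 := scan_links key [] v R c
  simp only [List.length_nil] at *
  omega

end

end SlimHeap

namespace SlimHeap

/-! ### Forests -/

section

variable {H I : Type*} [DecidableEq I]

/-- The node `x` is not in any list of children. -/
def Free (ch : I → List I) (x : I) : Prop := ∀ p, x ∉ ch p

/-- The lists of children `ch` form disjoint lists, and are compatible with the map `own` that
sends each node to its heap. -/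
structure Forest (own : I → Option H) (ch : I → List I) : Prop where
  nodup : ∀ p, (ch p).Nodup
  uniq : ∀ {x p p'}, x ∈ ch p → x ∈ ch p' → p = p'
  own_eq : ∀ {x p}, x ∈ ch p → own x = own p
  own_ne : ∀ {x p}, x ∈ ch p → own p ≠ none

theorem mem_link {ch : I → List I} {z v x p : I} :
    x ∈ link ch z v p ↔ p = z ∧ x = v ∨ x ∈ ch p := by
  by_cases h : p = z
  · subst h; simp [link]
  · simp [link, h]

theorem free_link {ch : I → List I} {z v x : I} : Free (link ch z v) x ↔ Free ch x ∧ x ≠ v := by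
  simp only [Free, mem_link]
  constructor
  · intro h
    exact ⟨fun p hp => h p (.inr hp), fun e => h z (.inl ⟨rfl, e⟩)⟩
  · rintro ⟨h1, h2⟩ p (⟨-, h3⟩ | h3)
    · exact h2 h3
    · exact h1 p h3

theorem Forest.link {own : I → Option H} {ch : I → List I} (h : Forest own ch) {z v : I}
    (hv : Free ch v) (ho : own v = own z) (hz : own z ≠ none) : Forest own (link ch z v) := by
  refine ⟨fun p => ?_, ?_, ?_, ?_⟩
  · by_cases hp : p = z
    · subst hp
      simpa [SlimHeap.link] using ⟨hv p, h.nodup p⟩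
    · simpa [SlimHeap.link, hp] using h.nodup p
  · intro x p p' h1 h2
    rcases mem_link.1 h1 with ⟨e1, e2⟩ | h1 <;> rcases mem_link.1 h2 with ⟨e3, e4⟩ | h2
    · exact e1.trans e3.symm
    · exact absurd (e2 ▸ h2) (hv p')
    · exact absurd (e4 ▸ h1) (hv p)
    · exact h.uniq h1 h2
  · intro x p h1
    rcases mem_link.1 h1 with ⟨rfl, rfl⟩ | h1
    · exact ho
    · exact h.own_eq h1
  · intro x p h1
    rcases mem_link.1 h1 with ⟨rfl, rfl⟩ | h1
    · exact hz
    · exact h.own_ne h1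

/-- The node `x` has been linked by a link that is not real. -/
def Nonreal (Rl : I → I → Prop) (ch : I → List I) (x : I) : Prop := ∃ p, x ∈ ch p ∧ ¬ Rl x p

theorem nonreal_link {Rl : I → I → Prop} {ch : I → List I} {z v : I} (hv : Free ch v) (x : I) :
    Nonreal Rl (link ch z v) x ↔ if x = v then ¬ Rl v z else Nonreal Rl ch x := by
  simp only [Nonreal, mem_link]
  split_ifs with h
  · subst h
    constructor
    · rintro ⟨p, ⟨rfl, -⟩ | h1, h2⟩
      · exact h2
      · exact absurd h1 (hv p)
    · exact fun h => ⟨z, .inl ⟨rfl, rfl⟩, h⟩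
  · constructor
    · rintro ⟨p, ⟨-, h1⟩ | h1, h2⟩
      · exact absurd h1 h
      · exact ⟨p, h1, h2⟩
    · rintro ⟨p, h1, h2⟩
      exact ⟨p, .inr h1, h2⟩

/-! ### Finite sums -/

theorem sum_le_two {A : Finset I} {f f' : I → ℤ} {v z : I} {a b : ℤ} (hv : v ∈ A) (hz : z ∈ A)
    (h : ∀ x, f' x ≤ f x + (if x = v then a else 0) + (if x = z then b else 0)) :
    ∑ x ∈ A, f' x ≤ ∑ x ∈ A, f x + a + b := by
  refine (Finset.sum_le_sum fun x _ => h x).trans ?_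
  simp [Finset.sum_add_distrib, hv, hz]

theorem sum_eq_two {A : Finset I} {f f' : I → ℤ} {v z : I} {a b : ℤ} (hv : v ∈ A) (hz : z ∈ A)
    (h : ∀ x, f' x = f x + (if x = v then a else 0) + (if x = z then b else 0)) :
    ∑ x ∈ A, f' x = ∑ x ∈ A, f x + a + b := by
  rw [Finset.sum_congr rfl fun x _ => h x]
  simp [Finset.sum_add_distrib, hv, hz]

theorem sum_eq_one {A : Finset I} {f f' : I → ℤ} {v : I} {a : ℤ} (hv : v ∈ A)
    (h : ∀ x, f' x = f x + (if x = v then a else 0)) :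
    ∑ x ∈ A, f' x = ∑ x ∈ A, f x + a := by
  rw [Finset.sum_congr rfl fun x _ => h x]
  simp [Finset.sum_add_distrib, hv]

open Classical in
/-- The indicator of a proposition. -/
noncomputable def ind (P : Prop) : ℤ := if P then 1 else 0

/-- The number of elements of `A` with the property `P`. -/
noncomputable def cnt {I : Type*} (A : Finset I) (P : I → Prop) : ℤ := ∑ x ∈ A, ind (P x)

theorem ind_congr {P Q : Prop} (h : P ↔ Q) : ind P = ind Q := by rw [propext h]

theorem ind_pos {P : Prop} (h : P) : ind P = 1 := if_pos h

theorem ind_neg {P : Prop} (h : ¬ P) : ind P = 0 := if_neg h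

theorem ind_nonneg (P : Prop) : 0 ≤ ind P := by simp only [ind]; split <;> simp

theorem ind_le_one (P : Prop) : ind P ≤ 1 := by simp only [ind]; split <;> simp

theorem cnt_link {A : Finset I} {Rl : I → I → Prop} {ch : I → List I} {z v : I} (T : I → Prop)
    (hA : v ∈ A) (hv : Free ch v) :
    cnt A (fun x => T x ∧ Nonreal Rl (link ch z v) x) =
      cnt A (fun x => T x ∧ Nonreal Rl ch x) + ind (T v ∧ ¬ Rl v z) := by
  refine sum_eq_one hA fun x => ?_
  have key := nonreal_link (Rl := Rl) (z := z) hv x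
  by_cases h : x = v
  · subst h
    have : ¬ Nonreal Rl ch x := fun ⟨p, hp, _⟩ => hv p hp
    rw [if_pos rfl] at key
    rw [ind_neg (fun hh : T x ∧ _ => this hh.2), if_pos rfl, zero_add]
    exact ind_congr (and_congr_right fun _ => key)
  · rw [if_neg h] at key
    rw [if_neg h, add_zero]
    exact ind_congr (and_congr_right fun _ => key)

/-! ### Ghost variables -/

/-- The real temporary children, the masses, the numbers `b` and the labels. -/
structure Ghost (I : Type*) where
  rc : I → List I
  mass : I → ℕ
  bb : I → ℕ
  cc : I → ℕ

/-- The numbers `b` of the siblings on a list agree with their masses. -/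
def Lab (mass bb : I → ℕ) : List I → Prop
  | [] => True
  | w :: R => bb w = Nat.log 2 (Nat.log 2 (Run.total mass (w :: R)) - Nat.log 2 (mass w)) ∧
      Lab mass bb R

omit [DecidableEq I] in
theorem total_congr {mass mass' : I → ℕ} {l : List I} (h : ∀ x ∈ l, mass' x = mass x) :
    Run.total mass' l = Run.total mass l := by
  simp only [Run.total]
  rw [List.map_congr_left h]

omit [DecidableEq I] in
theorem Lab.congr {mass mass' bb bb' : I → ℕ} : ∀ {l : List I}, Lab mass bb l →
    (∀ x ∈ l, mass' x = mass x) → (∀ x ∈ l, bb' x = bb x) → Lab mass' bb' l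
  | [], _, _, _ => trivial
  | w :: R, h, h1, h2 => by
    refine ⟨?_, h.2.congr (fun x hx => h1 x (by simp [hx])) (fun x hx => h2 x (by simp [hx]))⟩
    rw [total_congr h1, h1 w (by simp), h2 w (by simp), h.1]

open Classical in
/-- The validity of the ghost variables, for the set `T` of temporary nodes, the set `Rl` of real
links and the lists of children `ch`; the labels of the roots in `X` need not be `0`. -/
structure Ghost.Ok (g : Ghost I) (T : I → Prop) (Rl : I → I → Prop) (ch : I → List I)
    (X : I → Prop) : Prop where
  rc_eq : ∀ v, g.rc v = (ch v).filter fun t => T t ∧ Rl t v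
  mass_eq : ∀ u, g.mass u = Run.total g.mass (g.rc u)
  lab : ∀ u, Lab g.mass g.bb (g.rc u)
  top : ∀ u, ¬ X u → (∀ p, u ∉ g.rc p) → g.bb u = 0 ∧ g.cc u = 0
  cc_le : ∀ u, g.cc u ≤ g.bb u

/-- The ghost variables after a real link of temporary nodes. -/
def Ghost.link (g : Ghost I) (z v : I) (c : ℕ) : Ghost I :=
  ⟨Function.update g.rc z (v :: g.rc z), Function.update g.mass z (g.mass z + g.mass v),
    Function.update g.bb v (Run.Data.b' (g.mass v) (g.mass z)), Function.update g.cc v c⟩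

/-- The ghost variables after any other link. -/
def Ghost.clear (g : Ghost I) (v : I) : Ghost I :=
  ⟨g.rc, g.mass, Function.update g.bb v 0, Function.update g.cc v 0⟩

variable {T : I → Prop} {Rl : I → I → Prop} {ch : I → List I} {X X' : I → Prop} {g : Ghost I}

omit [DecidableEq I] in
theorem Ghost.Ok.mem_rc (h : g.Ok T Rl ch X) {t v} : t ∈ g.rc v ↔ t ∈ ch v ∧ T t ∧ Rl t v := by
  classical
  rw [h.rc_eq]; simp

omit [DecidableEq I] in
theorem Ghost.Ok.not_mem_rc (h : g.Ok T Rl ch X) {t} (ht : Free ch t) (v) : t ∉ g.rc v :=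
  fun hh => ht v (h.mem_rc.1 hh).1

omit [DecidableEq I] in
theorem Ghost.Ok.mass_pos (h : g.Ok T Rl ch X) (u) : 1 ≤ g.mass u := by
  rw [h.mass_eq]; exact Run.total_pos _ _

theorem Ghost.Ok.link (h : g.Ok T Rl ch X) {z v : I} (hzv : v ≠ z) (hz : Free ch z)
    (hv : Free ch v) (hT : T v) (hR : Rl v z) {c : ℕ}
    (hc : c ≤ Run.Data.b' (g.mass v) (g.mass z)) (hX : ∀ u, X u → u ≠ v → X' u) :
    (g.link z v c).Ok T Rl (SlimHeap.link ch z v) X' := by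
  classical
  have z_rc := h.not_mem_rc hz
  have v_rc := h.not_mem_rc hv
  have hm : ∀ p, ∀ x ∈ g.rc p, (g.link z v c).mass x = g.mass x := fun p x hx => by
    have : x ≠ z := fun e => z_rc p (e ▸ hx)
    simp [Ghost.link, this]
  have hb : ∀ p, ∀ x ∈ g.rc p, (g.link z v c).bb x = g.bb x := fun p x hx => by
    have : x ≠ v := fun e => v_rc p (e ▸ hx)
    simp [Ghost.link, this]
  have hmv : (g.link z v c).mass v = g.mass v := by simp [Ghost.link, hzv]
  have hz' : Run.total (g.link z v c).mass (v :: g.rc z) = g.mass z + g.mass v := by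
    rw [Run.total_cons, total_congr (hm z), hmv, ← h.mass_eq, add_comm]
  refine ⟨fun p => ?_, fun p => ?_, fun p => ?_, fun u hu hp => ?_, fun u => ?_⟩
  · by_cases hp : p = z
    · subst hp
      simp [Ghost.link, SlimHeap.link, h.rc_eq, hT, hR]
    · simp [Ghost.link, SlimHeap.link, hp, h.rc_eq]
  · by_cases hp : p = z
    · subst hp
      have : (g.link p v c).rc p = v :: g.rc p := by simp [Ghost.link]
      rw [this, hz']
      simp [Ghost.link]
    · have : (g.link z v c).rc p = g.rc p := by simp [Ghost.link, hp]
      rw [this, total_congr (hm p), ← h.mass_eq]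
      simp [Ghost.link, hp]
  · by_cases hp : p = z
    · subst hp
      have : (g.link p v c).rc p = v :: g.rc p := by simp [Ghost.link]
      rw [this]
      refine ⟨?_, (h.lab p).congr (hm p) (hb p)⟩
      rw [hz', hmv]
      simp [Ghost.link, Run.Data.b']
    · have : (g.link z v c).rc p = g.rc p := by simp [Ghost.link, hp]
      rw [this]
      exact (h.lab p).congr (hm p) (hb p)
  · have huv : u ≠ v := by
      rintro rfl
      exact hp z (by simp [Ghost.link])
    have := h.top u (fun hx => hu (hX u hx huv)) fun p hup => hp p (by
      by_cases e : p = z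
      · subst e; simp [Ghost.link, hup]
      · simpa [Ghost.link, e] using hup)
    simpa [Ghost.link, huv] using this
  · by_cases e : u = v
    · subst e; simpa [Ghost.link] using hc
    · simpa [Ghost.link, e] using h.cc_le u

theorem Ghost.Ok.clear (h : g.Ok T Rl ch X) {v : I} (hv : Free ch v)
    (hX : ∀ u, X u → u ≠ v → X' u) : (g.clear v).Ok T Rl ch X' := by
  have v_rc := h.not_mem_rc hv
  refine ⟨h.rc_eq, h.mass_eq, fun p => (h.lab p).congr (fun _ _ => rfl) fun x hx => ?_,
    fun u hu hp => ?_, fun u => ?_⟩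
  · have : x ≠ v := fun e => v_rc p (e ▸ hx)
    simp [Ghost.clear, this]
  · by_cases e : u = v
    · subst e; simp [Ghost.clear]
    · simpa [Ghost.clear, e] using h.top u (fun hx => hu (hX u hx e)) hp
  · by_cases e : u = v
    · subst e; simp [Ghost.clear]
    · simpa [Ghost.clear, e] using h.cc_le u

theorem Ghost.Ok.link_nonreal (h : g.Ok T Rl ch X) {z v : I} (hR : ¬ (T v ∧ Rl v z)) :
    g.Ok T Rl (SlimHeap.link ch z v) X := by
  classical
  refine ⟨fun p => ?_, h.mass_eq, h.lab, h.top, h.cc_le⟩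
  by_cases hp : p = z
  · subst hp
    simp [SlimHeap.link, h.rc_eq, hR]
  · simp [SlimHeap.link, hp, h.rc_eq]

/-! ### Potentials -/

namespace Ghost

/-- The potential of a node. -/
def phi (g : Ghost I) (v : I) : ℤ :=
  67 * g.bb v - 5 * g.cc v + 9 * Run.tv (g.bb v :: (g.rc v).map g.cc)

def Phi (g : Ghost I) (A : Finset I) : ℤ := ∑ v ∈ A, g.phi v

/-- The sum of the logarithms of the masses. -/
def logMass (g : Ghost I) (A : Finset I) : ℤ := ∑ v ∈ A, (Nat.log 2 (g.mass v) : ℤ)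

open Classical in
/-- The total mass of the temporary nodes that are not real children. -/
noncomputable def topMass (g : Ghost I) (T : I → Prop) (B : Finset I) : ℤ :=
  ∑ v ∈ B, if T v ∧ ∀ p, v ∉ g.rc p then (g.mass v : ℤ) else 0

end Ghost

theorem tv_head (b b' : ℕ) (l : List ℕ) :
    (Run.tv (b' :: l) : ℤ) ≤ Run.tv (b :: l) + |(b' : ℤ) - b| := by
  have := abs_nonneg ((b' : ℤ) - b)
  cases l with
  | nil => simp [Run.tv]
  | cons x l =>
    rw [Run.tv_cons_cons, Run.tv_cons_cons]
    rcases abs_cases ((b' : ℤ) - b) with h | h <;> push_cast <;> omega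

theorem tv_insert (b c : ℕ) (l : List ℕ) (hc : c ≤ b) :
    (Run.tv (b :: c :: l) : ℤ) ≤ Run.tv (b :: l) + 2 * ((b : ℤ) - c) := by
  cases l with
  | nil => simp only [Run.tv]; push_cast; omega
  | cons x l =>
    simp only [Run.tv_cons_cons]
    push_cast
    omega

theorem map_update_of_not_mem {c : I → ℕ} {v : I} {k : ℕ} {l : List I} (h : v ∉ l) :
    l.map (Function.update c v k) = l.map c := by
  refine List.map_congr_left fun x hx => ?_
  have : x ≠ v := fun e => h (e ▸ hx)
  simp [this]

theorem Ghost.Ok.phi_clear (h : g.Ok T Rl ch X) {v : I} (hv : Free ch v) (x : I) :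
    (g.clear v).phi x ≤ g.phi x := by
  have v_rc := h.not_mem_rc hv
  simp only [Ghost.phi, Ghost.clear, map_update_of_not_mem (v_rc x)]
  by_cases e : x = v
  · subst e
    have h1 := tv_head (g.bb x) 0 ((g.rc x).map g.cc)
    have h2 := h.cc_le x
    simp only [Nat.cast_zero, zero_sub, abs_neg, Nat.abs_cast] at h1
    simp only [Function.update_self]
    push_cast
    omega
  · simp [e]

theorem Ghost.Ok.Phi_clear (h : g.Ok T Rl ch X) {v : I} (hv : Free ch v) (A : Finset I) :
    (g.clear v).Phi A ≤ g.Phi A :=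
  Finset.sum_le_sum fun x _ => h.phi_clear hv x

theorem Ghost.Ok.Phi_link (h : g.Ok T Rl ch X) {z v : I} (hzv : v ≠ z) (hv : Free ch v) {c : ℕ}
    (hc : c ≤ g.bb z) {A : Finset I} (hvA : v ∈ A) (hzA : z ∈ A) :
    (g.link z v c).Phi A ≤ g.Phi A +
      (67 * ((Run.Data.b' (g.mass v) (g.mass z) : ℤ) - g.bb v) - 5 * ((c : ℤ) - g.cc v) +
        9 * |(Run.Data.b' (g.mass v) (g.mass z) : ℤ) - g.bb v|) + 18 * ((g.bb z : ℤ) - c) := by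
  have v_rc := h.not_mem_rc hv
  refine sum_le_two hvA hzA fun x => ?_
  simp only [Ghost.phi, Ghost.link]
  by_cases e : x = v
  · subst e
    have h1 := tv_head (g.bb x) (Run.Data.b' (g.mass x) (g.mass z)) ((g.rc x).map g.cc)
    simp only [Function.update_self, Function.update_of_ne hzv, map_update_of_not_mem (v_rc x),
      if_true, if_neg hzv]
    linarith
  · by_cases e' : x = z
    · subst e'
      have h1 := tv_insert (g.bb x) c ((g.rc x).map g.cc) hc
      simp only [Function.update_self, Function.update_of_ne e, List.map_cons,
        map_update_of_not_mem (v_rc x), if_true, if_neg e]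
      linarith
    · simp [e, e', map_update_of_not_mem (v_rc x)]

theorem Ghost.logMass_link {g : Ghost I} {z v : I} {c : ℕ} {A : Finset I}
    (hzA : z ∈ A) :
    (g.link z v c).logMass A = g.logMass A + Run.Data.gam (g.mass v) (g.mass z) := by
  refine sum_eq_one hzA fun x => ?_
  by_cases e : x = z
  · subst e
    have := Run.log_add_ge (g.mass v) (g.mass x)
    simp only [Ghost.link, Function.update_self, if_true]
    omega
  · simp [Ghost.link, e]

theorem Ghost.Ok.topMass_link (h : g.Ok T Rl ch X) {z v : I} (hzv : v ≠ z) (hz : Free ch z)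
    (hv : Free ch v) (hT : T v) (hTz : T z) {c : ℕ} {B : Finset I} (hvB : v ∈ B) (hzB : z ∈ B) :
    (g.link z v c).topMass T B = g.topMass T B := by
  classical
  have z_rc := h.not_mem_rc hz
  have v_rc := h.not_mem_rc hv
  have key : ∀ x, x ≠ v → ((∀ p, x ∉ (g.link z v c).rc p) ↔ ∀ p, x ∉ g.rc p) := fun x hx => by
    refine forall_congr' fun p => not_congr ?_
    by_cases e : p = z
    · subst e; simp [Ghost.link, hx]
    · simp [Ghost.link, e]
  have hv' : ¬ ∀ p, v ∉ (g.link z v c).rc p := fun hh => hh z (by simp [Ghost.link])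
  have := sum_eq_two (A := B)
    (f := fun x => if T x ∧ ∀ p, x ∉ g.rc p then (g.mass x : ℤ) else 0)
    (f' := fun x => if T x ∧ ∀ p, x ∉ (g.link z v c).rc p then
      ((g.link z v c).mass x : ℤ) else 0) (a := -g.mass v) (b := g.mass v) hvB hzB fun x => ?_
  · simp only [Ghost.topMass]
    linarith
  by_cases e : x = v
  · subst e
    rw [if_neg (fun hh => hv' hh.2), if_pos ⟨hT, v_rc⟩]
    simp [hzv]
  · by_cases e' : x = z
    · subst e'
      rw [if_pos ⟨hTz, (key x e).2 z_rc⟩, if_pos ⟨hTz, z_rc⟩]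
      simp [Ghost.link, e]
    · rw [if_congr (and_congr_right fun _ => key x e) rfl rfl]
      simp [Ghost.link, e, e']

end

end SlimHeap

namespace SlimHeap

section

variable {H I : Type*} [DecidableEq I]

open Classical in
/-- The temporary nodes on a list. -/
noncomputable def temps (T : I → Prop) (l : List I) : List I := l.filter fun x => T x

omit [DecidableEq I] in
theorem temps_cons_pos {T : I → Prop} {x : I} (h : T x) (l : List I) :
    temps T (x :: l) = x :: temps T l := by simp [temps, h]

omit [DecidableEq I] in
theorem temps_cons_neg {T : I → Prop} {x : I} (h : ¬ T x) (l : List I) :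
    temps T (x :: l) = temps T l := by simp [temps, h]

omit [DecidableEq I] in
theorem mem_temps {T : I → Prop} {x : I} {l : List I} : x ∈ temps T l ↔ x ∈ l ∧ T x := by
  simp [temps]

/-- The temporary part of a state of the scan. -/
noncomputable def toSt (g : Ghost I) (T : I → Prop) (L R : List I)
    (cl : Option (I × ℕ × ℕ)) : Run.St I :=
  ⟨(temps T L).map fun x => (x, g.mass x), temps T R, cl⟩

variable {T : I → Prop} {Rl : I → I → Prop} {d : Run.Data I} {g : Ghost I}

omit [DecidableEq I] in
theorem toSt_advance {w : I} {L R : List I} (h : Run.Inv d (toSt g T L (w :: R) none))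
    (hw : g.mass w = d.sg w) :
    Run.Inv d (toSt g T (w :: L) R none) ∧
      d.pot (toSt g T (w :: L) R none) ≤ d.pot (toSt g T L (w :: R) none) := by
  by_cases hT : T w
  · simp only [toSt, temps_cons_pos hT, List.map_cons, hw] at *
    exact ⟨Run.inv_push d h, Run.pot_push d h⟩
  · simp only [toSt, temps_cons_neg hT] at *
    exact ⟨h, le_rfl⟩

omit [DecidableEq I] in
theorem toSt_drop {v : I} {L R : List I} {cl} (h : Run.Inv d (toSt g T (v :: L) R cl))
    (hcl : cl ≠ none → T v) :
    Run.Inv d (toSt g T L R none) ∧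
      d.pot (toSt g T L R none) ≤
        d.pot (toSt g T (v :: L) R cl) + 240 * (d.cap + 1) * ind (T v) := by
  by_cases hT : T v
  · simp only [toSt, temps_cons_pos hT, List.map_cons, ind_pos hT, mul_one] at *
    exact ⟨Run.inv_drop d h, Run.pot_drop d h⟩
  · have : cl = none := by by_contra hc; exact hT (hcl hc)
    subst this
    simp only [toSt, temps_cons_neg hT, ind_neg hT] at *
    exact ⟨h, by simp⟩

omit [DecidableEq I] in
theorem toSt_congr {g' : Ghost I} {L R : List I} {cl} (h : ∀ x ∈ L, g'.mass x = g.mass x) :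
    toSt g' T L R cl = toSt g T L R cl := by
  simp only [toSt]
  congr 1
  exact List.map_congr_left fun x hx => by rw [h x (mem_temps.1 hx).1]

/-- The state of the scan in a delete-min on the heap `hp`. -/
structure Proc (T : I → Prop) (Rl : I → I → Prop) (own : I → Option H) (hp : H) (d : Run.Data I)
    (ch : I → List I) (g : Ghost I) (L : List I) (v : I) (R : List I) (f : Bool)
    (cl : Option (I × ℕ × ℕ)) : Prop where
  forest : Forest own ch
  ok : g.Ok T Rl ch (· ∈ v :: (L ++ R))
  nodup : (v :: (L ++ R)).Nodup
  free : ∀ x ∈ v :: (L ++ R), Free ch x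
  own_eq : ∀ x ∈ v :: (L ++ R), own x = some hp
  closed : cl ≠ none → f = true ∧ T v
  inv : Run.Inv d (toSt g T (v :: L) R cl)
  mass : ∀ x ∈ R, g.mass x = d.sg x
  bb : ∀ x ∈ v :: (L ++ R), T x → g.bb x = d.b x ∧ g.cc x = d.c x

/-- Twice the temporary roots that have won twice, once those that have won at most once. -/
noncomputable def wins (T : I → Prop) (L : List I) (v : I) (f : Bool) : ℤ :=
  (L.map fun x => ind (T x)).sum + (if f then 2 else 1) * ind (T v)

omit [DecidableEq I] in
theorem Proc.perm {own : I → Option H} {hp ch L v R f cl X}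
    (h : Proc T Rl own hp d ch g L v R f cl) (hl : (v :: (L ++ R)).Perm X) :
    Forest own ch ∧ g.Ok T Rl ch (· ∈ X) ∧ X.Nodup ∧
      (∀ x ∈ X, Free ch x) ∧ (∀ x ∈ X, own x = some hp) ∧
      ∀ x ∈ X, T x → g.bb x = d.b x ∧ g.cc x = d.c x := by
  refine ⟨h.forest, ?_, hl.nodup_iff.1 h.nodup, fun x hx => h.free x (hl.mem_iff.2 hx),
    fun x hx => h.own_eq x (hl.mem_iff.2 hx), fun x hx => h.bb x (hl.mem_iff.2 hx)⟩
  have := h.ok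
  simpa only [hl.mem_iff] using this

/-- The common part of the facts on a link of `v` under `z` in a delete-min. -/
theorem link_common {own : I → Option H} {hp : H} {ch : I → List I} {z v : I} {l : List I}
    {A B : Finset I} (hRT : ∀ t u, Rl t u → T u) (hA : ∀ x, own x ≠ none → x ∈ A)
    (hB : ∀ x, own x = some hp → x ∈ B)
    (hf : Forest own ch) (hok : g.Ok T Rl ch (· ∈ v :: z :: l)) (hnd : (v :: z :: l).Nodup)
    (hfree : ∀ x ∈ v :: z :: l, Free ch x) (hown : ∀ x ∈ v :: z :: l, own x = some hp)
    (hbb : ∀ x ∈ v :: z :: l, T x → g.bb x = d.b x ∧ g.cc x = d.c x) :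
    ∃ g₁ : Ghost I, g₁.Ok T Rl (link ch z v) (· ∈ z :: l) ∧ Forest own (link ch z v) ∧
      (∀ x ∈ z :: l, Free (link ch z v) x) ∧
      (∀ x ∈ z :: l, T x → g₁.bb x = d.b x ∧ g₁.cc x = d.c x) ∧
      (∀ x, x ≠ z → g₁.mass x = g.mass x) ∧
      g₁.topMass T B = g.topMass T B ∧
      cnt B (fun x => T x ∧ Nonreal Rl (link ch z v) x) =
        cnt B (fun x => T x ∧ Nonreal Rl ch x) + ind (T v ∧ ¬ Rl v z) ∧
      cnt A (Nonreal Rl (link ch z v)) = cnt A (Nonreal Rl ch) + ind (¬ Rl v z) ∧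
      (T v ∧ Rl v z → T z ∧ g₁.mass z = g.mass z + g.mass v ∧
        3 * g₁.Phi A - 1800 * g₁.logMass A ≤ 3 * g.Phi A - 1800 * g.logMass A +
          3 * (d.cost (v, g.mass v) (z, g.mass z) - 1) -
            1800 * Run.Data.gam (g.mass v) (g.mass z)) ∧
      (¬ (T v ∧ Rl v z) → g₁.mass z = g.mass z ∧ g₁.Phi A ≤ g.Phi A ∧
        g₁.logMass A = g.logMass A) := by
  simp only [List.nodup_cons, List.mem_cons, not_or] at hnd
  obtain ⟨⟨hvz, hvl⟩, hzl, -⟩ := hnd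
  have hv := hfree v (by simp)
  have hz := hfree z (by simp)
  have ov := hown v (by simp)
  have oz := hown z (by simp)
  have vA := hA v (by simp [ov])
  have zA := hA z (by simp [oz])
  have e1 := cnt_link (Rl := Rl) (z := z) T (hB v ov) hv
  have e2 := cnt_link (Rl := Rl) (z := z) (fun _ => True) vA hv
  simp only [true_and] at e2
  have hff := hf.link hv (ov.trans oz.symm) (by simp [oz])
  have hfr : ∀ x ∈ z :: l, Free (link ch z v) x := fun x hx =>
    free_link.2 ⟨hfree x (List.mem_cons_of_mem _ hx), by
      rintro rfl
      rcases List.mem_cons.1 hx with h | h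
      · exact hvz h
      · exact hvl h⟩
  have hX : ∀ u, u ∈ v :: z :: l → u ≠ v → u ∈ z :: l := fun u hu hne => by
    simpa [hne] using hu
  have hne : ∀ x ∈ z :: l, x ≠ v := by
    rintro x hx rfl
    rcases List.mem_cons.1 hx with h | h
    · exact hvz h
    · exact hvl h
  by_cases hR : T v ∧ Rl v z
  · have hTz := hRT v z hR.2
    have bz := hbb z (by simp) hTz
    have bv := hbb v (by simp) hR.1
    have hP := hok.Phi_link hvz hv (c := min (g.bb z) (Run.Data.b' (g.mass v) (g.mass z)))
      (min_le_left _ _) vA zA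
    have hM := Ghost.logMass_link (g := g) (z := z) (v := v)
      (c := min (g.bb z) (Run.Data.b' (g.mass v) (g.mass z))) zA
    refine ⟨g.link z v (min (g.bb z) (Run.Data.b' (g.mass v) (g.mass z))),
      hok.link hvz hz hv hR.1 hR.2 (min_le_right _ _) hX, hff, hfr, fun x hx hT => ?_,
      fun x hx => by simp [Ghost.link, hx], hok.topMass_link hvz hz hv hR.1 hTz (hB v ov) (hB z oz), e1, e2,
      fun _ => ⟨hTz, by simp [Ghost.link], ?_⟩, fun h => absurd hR h⟩
    · simpa [Ghost.link, hne x hx] using hbb x (List.mem_cons_of_mem _ hx) hT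
    · simp only [Run.Data.cost]
      rw [bz.1, bv.1, bv.2] at hP
      rw [bz.1] at hM ⊢
      rw [hM]
      linarith
  · exact ⟨g.clear v, (hok.clear hv hX).link_nonreal hR, hff, hfr,
      fun x hx hT => by
        simpa [Ghost.clear, hne x hx] using hbb x (List.mem_cons_of_mem _ hx) hT,
      fun _ _ => rfl, rfl, e1, e2, fun h => absurd h hR,
      fun _ => ⟨rfl, hok.Phi_clear hv A, rfl⟩⟩

omit [DecidableEq I] in
theorem process_arith (hRT : ∀ t u, Rl t u → T u) {v z : I} (hR : ¬ (T v ∧ Rl v z)) {m cap : ℕ}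
    {p p₁ Φ₁ Φ M N N' C C' W W₁ F F' : ℤ}
    (hp : p₁ ≤ p + 240 * (cap + 1) * ind (T v))
    (hd : (m : ℤ) + F - F' - 723 * (cap + 1) * N' - C' ≤
      3 * Φ₁ - 1800 * M - 723 * (cap + 1) * (N + ind (T v ∧ ¬ Rl v z)) - (C + ind (¬ Rl v z)) +
        3 * p₁ - W₁ + 2 + 723 * (cap + 1))
    (hw : W ≤ 2 * ind (T v) + W₁ - ind (T z)) (hΦ : Φ₁ ≤ Φ) :
    ((m + 1 : ℕ) : ℤ) + F - F' - 723 * (cap + 1) * N' - C' ≤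
      3 * Φ - 1800 * M - 723 * (cap + 1) * N - C + 3 * p - W + 2 + 723 * (cap + 1) := by
  have h0 := ind_nonneg (T z)
  by_cases hv : T v
  · have hz : ¬ Rl v z := fun h => hR ⟨hv, h⟩
    rw [ind_pos hv] at *
    rw [ind_pos ⟨hv, hz⟩, ind_pos hz] at hd
    push_cast
    linarith
  · rw [ind_neg hv] at *
    rw [ind_neg (fun h => hv h.1)] at hd
    by_cases hz : Rl v z
    · rw [ind_neg (not_not_intro hz)] at hd
      rw [ind_pos (hRT v z hz)] at hw
      push_cast
      linarith
    · rw [ind_pos hz] at hd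
      push_cast
      linarith

theorem process {own : I → Option H} {hp : H} {A B : Finset I} (hRT : ∀ t u, Rl t u → T u)
    (hA : ∀ x, own x ≠ none → x ∈ A) (hB : ∀ x, own x = some hp → x ∈ B)
    {L : List I} {v : I} {R : List I} {f : Bool} {ch : I → List I} {m : ℕ} {r : I}
    {ch' : I → List I} (h : Scan L v R f ch m r ch') :
    ∀ g cl, Proc T Rl own hp d ch g L v R f cl → ∃ g' : Ghost I,
      g'.Ok T Rl ch' (fun _ => False) ∧ Forest own ch' ∧ Free ch' r ∧ own r = some hp ∧
      (∀ x, own x ≠ some hp → g'.mass x = g.mass x) ∧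
      g'.topMass T B = g.topMass T B ∧
      (m : ℤ) + 3 * g'.Phi A - 1800 * g'.logMass A -
          723 * (d.cap + 1) * cnt B (fun x => T x ∧ Nonreal Rl ch' x) - cnt A (Nonreal Rl ch') ≤
        3 * g.Phi A - 1800 * g.logMass A -
          723 * (d.cap + 1) * cnt B (fun x => T x ∧ Nonreal Rl ch x) - cnt A (Nonreal Rl ch) +
          3 * d.pot (toSt g T (v :: L) R cl) - wins T L v f + 2 + 723 * (d.cap + 1) := by
  induction h with
  | done v f ch =>
    intro g cl h
    have hv := h.free v (by simp)
    have h1 := toSt_drop h.inv fun hc => (h.closed hc).2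
    have h2 : d.pot (toSt g T [] [] none) = 0 := Run.pot_nil d
    have h3 := h.ok.Phi_clear hv A
    have h4 : (g.clear v).logMass A = g.logMass A := rfl
    have h5 : wins T [] v f ≤ 2 := by
      have := ind_le_one (T v)
      have := ind_nonneg (T v)
      simp only [wins]
      split <;> simp <;> omega
    have h6 : 240 * ((d.cap : ℤ) + 1) * ind (T v) ≤ 240 * (d.cap + 1) := by
      have := ind_le_one (T v)
      nlinarith
    refine ⟨g.clear v, h.ok.clear hv (by simp), h.forest, hv, h.own_eq v (by simp), fun _ _ => rfl, rfl, ?_⟩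
    push_cast
    rw [h4]
    linarith [h1.2]
  | @left L u v R f ch m r ch' hs ih =>
    intro g cl h
    obtain ⟨a1, a2, a3, a4, a5, a6⟩ := h.perm (X := v :: u :: (L ++ R)) (by simp)
    obtain ⟨g₁, b1, b2, b3, b4, b5, b6, b7, b8, b9, b10⟩ :=
      link_common hRT hA hB a1 a2 a3 a4 a5 a6
    have hnd := List.nodup_cons.1 (List.nodup_cons.1 a3).2
    have hw : wins T (u :: L) v f ≤ 2 * ind (T v) + wins T L u true - ind (T u) := by
      have := ind_nonneg (T v)
      simp only [wins, List.map_cons, List.sum_cons]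
      split <;> simp <;> omega
    have hm : ∀ x ∈ R, g₁.mass x = d.sg x := fun x hx => by
      rw [b5 x (fun e => hnd.1 (e ▸ by simp [hx])), h.mass x hx]
    have hms : ∀ x ∈ L, g₁.mass x = g.mass x := fun x hx =>
      b5 x fun e => hnd.1 (e ▸ by simp [hx])
    by_cases hR : T v ∧ Rl v u
    · obtain ⟨hTu, c1, c2⟩ := b9 hR
      have e1 : toSt g T (v :: u :: L) R cl = ⟨(v, g.mass v) :: (u, g.mass u) ::
          (temps T L).map fun x => (x, g.mass x), temps T R, cl⟩ := by
        simp [toSt, temps_cons_pos hR.1, temps_cons_pos hTu]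
      have e2 : toSt g₁ T (u :: L) R (some (v, g.mass v, g.mass u)) = ⟨(u, g.mass u + g.mass v) ::
          (temps T L).map fun x => (x, g.mass x), temps T R, some (v, g.mass v, g.mass u)⟩ := by
        have := toSt_congr (T := T) (R := R) (cl := some (v, g.mass v, g.mass u)) hms
        simp only [toSt, Run.St.mk.injEq, and_true] at this
        simp [toSt, temps_cons_pos hTu, c1, this]
      have hi := h.inv
      rw [e1] at hi
      obtain ⟨g', d1, d2, d3, d4, d7, d5, d6⟩ := ih g₁ (some (v, g.mass v, g.mass u))
        ⟨b2, b1, (List.nodup_cons.1 a3).2, b3, fun x hx => a5 x (by simp_all), fun _ => ⟨rfl, hTu⟩,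
          by rw [e2]; exact Run.inv_linkL d hi, hm, b4⟩
      refine ⟨g', d1, d2, d3, d4, fun x hx => (d7 x hx).trans (b5 x fun e => hx (e ▸ a5 _ (by simp))),
        d5.trans b6, ?_⟩
      have hc := Run.cost_linkL d hi
      rw [e1]
      rw [e2, b7, b8] at d6
      have i1 : ind (T v ∧ ¬ Rl v u) = 0 := ind_neg (by tauto)
      have i2 : ind (¬ Rl v u) = 0 := ind_neg (by tauto)
      rw [i1, i2] at d6
      rw [ind_pos hR.1, ind_pos hTu] at hw
      push_cast
      linarith
    · obtain ⟨c1, c2, c3⟩ := b10 hR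
      have hdr := toSt_drop h.inv fun hc => (h.closed hc).2
      have e2 : toSt g₁ T (u :: L) R none = toSt g T (u :: L) R none :=
        toSt_congr fun x hx => by
          rcases List.mem_cons.1 hx with rfl | hx
          · exact c1
          · exact hms x hx
      obtain ⟨g', d1, d2, d3, d4, d7, d5, d6⟩ := ih g₁ none
        ⟨b2, b1, (List.nodup_cons.1 a3).2, b3, fun x hx => a5 x (by simp_all), by simp,
          by rw [e2]; exact hdr.1, hm, b4⟩
      refine ⟨g', d1, d2, d3, d4, fun x hx => (d7 x hx).trans (b5 x fun e => hx (e ▸ a5 _ (by simp))),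
        d5.trans b6, ?_⟩
      rw [e2, b7, b8, c3] at d6
      exact process_arith hRT hR hdr.2 d6 hw c2
  | @right L v w R f ch m r ch' hs ih =>
    intro g cl h
    obtain ⟨a1, a2, a3, a4, a5, a6⟩ := h.perm (X := v :: w :: (L ++ R)) (by simp)
    obtain ⟨g₁, b1, b2, b3, b4, b5, b6, b7, b8, b9, b10⟩ :=
      link_common hRT hA hB a1 a2 a3 a4 a5 a6
    have hnd := List.nodup_cons.1 (List.nodup_cons.1 a3).2
    have hw : wins T L v f ≤ 2 * ind (T v) + wins T L w false - ind (T w) := by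
      have := ind_nonneg (T v)
      simp only [wins]
      split <;> simp <;> omega
    have hm : ∀ x ∈ R, g₁.mass x = d.sg x := fun x hx => by
      rw [b5 x (fun e => hnd.1 (e ▸ by simp [hx])), h.mass x (by simp [hx])]
    have hms : ∀ x ∈ L, g₁.mass x = g.mass x := fun x hx =>
      b5 x fun e => hnd.1 (e ▸ by simp [hx])
    have hmw := h.mass w (by simp)
    by_cases hR : T v ∧ Rl v w
    · obtain ⟨hTw, c1, c2⟩ := b9 hR
      have e1 : toSt g T (v :: L) (w :: R) cl = ⟨(v, g.mass v) ::
          (temps T L).map fun x => (x, g.mass x), w :: temps T R, cl⟩ := by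
        simp [toSt, temps_cons_pos hR.1, temps_cons_pos hTw]
      have e2 : toSt g₁ T (w :: L) R none = ⟨(w, d.sg w + g.mass v) ::
          (temps T L).map fun x => (x, g.mass x), temps T R, none⟩ := by
        have := toSt_congr (T := T) (R := R) (cl := none) hms
        simp only [toSt, Run.St.mk.injEq, and_true] at this
        simp [toSt, temps_cons_pos hTw, c1, this, hmw]
      have hi := h.inv
      rw [e1] at hi
      obtain ⟨g', d1, d2, d3, d4, d7, d5, d6⟩ := ih g₁ none
        ⟨b2, b1, (List.nodup_cons.1 a3).2, b3, fun x hx => a5 x (by simp_all), by simp,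
          by rw [e2]; exact Run.inv_linkR d hi, hm, b4⟩
      refine ⟨g', d1, d2, d3, d4, fun x hx => (d7 x hx).trans (b5 x fun e => hx (e ▸ a5 _ (by simp))),
        d5.trans b6, ?_⟩
      have hc := Run.cost_linkR d hi
      rw [e1]
      rw [e2, b7, b8] at d6
      have i1 : ind (T v ∧ ¬ Rl v w) = 0 := ind_neg (by tauto)
      have i2 : ind (¬ Rl v w) = 0 := ind_neg (by tauto)
      rw [i1, i2] at d6
      rw [ind_pos hR.1, ind_pos hTw] at hw
      rw [hmw] at c2
      push_cast
      linarith
    · obtain ⟨c1, c2, c3⟩ := b10 hR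
      have hdr := toSt_drop h.inv fun hc => (h.closed hc).2
      have had := toSt_advance hdr.1 hmw
      have e2 : toSt g₁ T (w :: L) R none = toSt g T (w :: L) R none :=
        toSt_congr fun x hx => by
          rcases List.mem_cons.1 hx with rfl | hx
          · exact c1
          · exact hms x hx
      obtain ⟨g', d1, d2, d3, d4, d7, d5, d6⟩ := ih g₁ none
        ⟨b2, b1, (List.nodup_cons.1 a3).2, b3, fun x hx => a5 x (by simp_all), by simp,
          by rw [e2]; exact had.1, hm, b4⟩
      refine ⟨g', d1, d2, d3, d4, fun x hx => (d7 x hx).trans (b5 x fun e => hx (e ▸ a5 _ (by simp))),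
        d5.trans b6, ?_⟩
      rw [e2, b7, b8, c3] at d6
      exact process_arith hRT hR (had.2.trans hdr.2) d6 hw c2
  | @move L v w R ch m r ch' hs ih =>
    intro g cl h
    have hcl : cl = none := by
      by_contra hc
      simpa using (h.closed hc).1
    subst hcl
    obtain ⟨a1, a2, a3, a4, a5, a6⟩ := h.perm (X := w :: (v :: L ++ R)) (by
      simpa using List.perm_middle (l₁ := v :: L))
    have had := toSt_advance h.inv (h.mass w (by simp))
    obtain ⟨g', d1, d2, d3, d4, d7, d5, d6⟩ := ih g none
      ⟨a1, a2, a3, a4, a5, by simp, had.1, fun x hx => h.mass x (by simp [hx]), a6⟩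
    refine ⟨g', d1, d2, d3, d4, d7, d5, ?_⟩
    have hw : wins T L v false ≤ wins T (v :: L) w false := by
      have := ind_nonneg (T w)
      simp only [wins, List.map_cons, List.sum_cons]
      simp
      omega
    linarith [had.2]

end

end SlimHeap

namespace SlimHeap

section

variable {H I : Type*} [DecidableEq I]
variable {T T' : I → Prop} {Rl Rl' : I → I → Prop} {g : Ghost I} {ch : I → List I} {X : I → Prop}

/-! ### The start of a delete-min -/

/-- The parameters of a list of siblings. -/
def Ghost.data (g : Ghost I) (l : List I) : Run.Data I :=
  ⟨g.mass, fun w => Run.total g.mass (l.dropWhile (· ≠ w)), g.cc, Run.total g.mass l⟩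

theorem Ghost.data_S {l l₁ l₂ : List I} {w : I} (h : l = l₁ ++ w :: l₂) (hl : l.Nodup) :
    (g.data l).S w = Run.total g.mass (w :: l₂) := by
  subst h
  have h1 : w ∉ l₁ := fun hw => (List.nodup_append.1 hl).2.2 w hw w (by simp) rfl
  have h2 : ∀ x ∈ l₁, decide (x ≠ w) = true := fun x hx => by
    simpa using fun e : x = w => h1 (e ▸ hx)
  simp only [Ghost.data]
  rw [List.dropWhile_append_of_pos h2, List.dropWhile_cons_of_neg (by simp)]

theorem Ghost.data_wf {l : List I} (hl : l.Nodup) (hm : ∀ x, 1 ≤ g.mass x)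
    (hc : ∀ x, g.cc x ≤ g.bb x) : ∀ l₁ l₂, l = l₁ ++ l₂ → Lab g.mass g.bb l₂ →
      (g.data l).Wf l₂ ∧ ∀ x ∈ l₂, g.bb x = (g.data l).b x
  | _, [], _, _ => ⟨trivial, by simp⟩
  | l₁, w :: l₂, h, hL => by
    have ih := data_wf hl hm hc (l₁ ++ [w]) l₂ (by simpa using h) hL.2
    have hS := g.data_S h hl
    have hb : g.bb w = (g.data l).b w := by
      rw [hL.1, Run.Data.b, Run.Data.x, hS]
      rfl
    exact ⟨⟨hS, hm w, hb ▸ hc w, ih.1⟩, by simpa using ⟨hb, ih.2⟩⟩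

omit [DecidableEq I] in
theorem temps_nodup {l : List I} (h : l.Nodup) : (temps T l).Nodup := h.filter _

/-- A whole delete-min after the deletion of the root. -/
theorem process_all {own : I → Option H} {hp : H} {A B : Finset I} (hRT : ∀ t u, Rl t u → T u)
    (hA : ∀ x, own x ≠ none → x ∈ A) (hB : ∀ x, own x = some hp → x ∈ B)
    {v : I} {R : List I} {m : ℕ} {r : I} {ch' : I → List I} (h : Scan [] v R false ch m r ch')
    (hf : Forest own ch) (hok : g.Ok T Rl ch (· ∈ v :: R)) (hnd : (v :: R).Nodup)
    (hfree : ∀ x ∈ v :: R, Free ch x) (hown : ∀ x ∈ v :: R, own x = some hp)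
    (hlab : Lab g.mass g.bb (temps T (v :: R))) {S cap : ℕ}
    (hS : S = Run.total g.mass (temps T (v :: R))) (hcap : cap = Nat.log 2 (Nat.log 2 S)) :
    ∃ g' : Ghost I,
      g'.Ok T Rl ch' (fun _ => False) ∧ Forest own ch' ∧ Free ch' r ∧ own r = some hp ∧
      (∀ x, own x ≠ some hp → g'.mass x = g.mass x) ∧
      g'.topMass T B = g.topMass T B ∧
      (m : ℤ) + 3 * g'.Phi A - 1800 * g'.logMass A -
          723 * (cap + 1) * cnt B (fun x => T x ∧ Nonreal Rl ch' x) - cnt A (Nonreal Rl ch') ≤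
        3 * g.Phi A - 1800 * g.logMass A -
          723 * (cap + 1) * cnt B (fun x => T x ∧ Nonreal Rl ch x) - cnt A (Nonreal Rl ch) +
          27 * Run.tv ((temps T (v :: R)).map g.cc) + 660 * (Nat.log 2 S + 1) + 2 +
            723 * (cap + 1) := by
  have hwf := g.data_wf (temps_nodup (T := T) hnd) hok.mass_pos hok.cc_le []
    (temps T (v :: R)) rfl hlab
  have hi : Run.Inv (g.data (temps T (v :: R))) (toSt g T [] (v :: R) none) :=
    Run.inv_init _ hwf.1 le_rfl
  have had := toSt_advance hi rfl
  obtain ⟨g', h1, h2, h3, h4, h7, h5, h6⟩ := process hRT hA hB h g none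
    ⟨hf, hok, hnd, hfree, hown, by simp, had.1, fun _ _ => rfl,
      fun x hx hT => ⟨hwf.2 x (mem_temps.2 ⟨hx, hT⟩), rfl⟩⟩
  refine ⟨g', h1, h2, h3, h4, h7, h5, ?_⟩
  have hpot := Run.pot_init _ hwf.1
  have e1 : (g.data (temps T (v :: R))).lsR (temps T (v :: R)) = Nat.log 2 S := by rw [hS]; rfl
  have e2 : (g.data (temps T (v :: R))).cap = cap := by rw [hcap, hS]; rfl
  have e3 : (g.data (temps T (v :: R))).c = g.cc := rfl
  have e4 : toSt g T [] (v :: R) none = ⟨[], temps T (v :: R), none⟩ := rfl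
  have hw : 0 ≤ wins T [] v false := by
    have := ind_nonneg (T v)
    simp [wins, this]
  rw [e1, e3] at hpot
  rw [e4] at had
  rw [e2] at h6
  linarith [had.2]

/-- The ghost variables after the deletion of the root `u`. -/
def Ghost.remove (g : Ghost I) (u : I) : Ghost I :=
  ⟨Function.update g.rc u [], Function.update g.mass u 1, g.bb, g.cc⟩

variable {u : I}

theorem Forest.remove {own : I → Option H} (h : Forest own ch) (hu : Free ch u) :
    Forest (Function.update own u none) (Function.update ch u []) := by
  have key : ∀ {x p}, x ∈ Function.update ch u [] p → p ≠ u ∧ x ∈ ch p ∧ x ≠ u := by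
    intro x p hx
    by_cases hp : p = u
    · subst hp; simp at hx
    · rw [Function.update_of_ne hp] at hx
      exact ⟨hp, hx, fun e => hu p (e ▸ hx)⟩
  refine ⟨fun p => ?_, fun h1 h2 => h.uniq (key h1).2.1 (key h2).2.1, fun h1 => ?_, fun h1 => ?_⟩
  · by_cases hp : p = u
    · subst hp; simp
    · rw [Function.update_of_ne hp]; exact h.nodup p
  · obtain ⟨h2, h3, h4⟩ := key h1
    rw [Function.update_of_ne h2, Function.update_of_ne h4]
    exact h.own_eq h3
  · obtain ⟨h2, h3, h4⟩ := key h1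
    rw [Function.update_of_ne h2]
    exact h.own_ne h3

theorem Ghost.Ok.remove {own : I → Option H} (hf : Forest own ch)
    (h : g.Ok T Rl ch fun _ => False) (hu : Free ch u)
    (hT : ∀ x, own x ≠ none → x ≠ u → (T x ↔ T' x))
    (hR : ∀ x p, x ∈ ch p → p ≠ u → (Rl x p ↔ Rl' x p)) :
    (g.remove u).Ok T' Rl' (Function.update ch u []) (· ∈ ch u) := by
  classical
  have u_rc := h.not_mem_rc hu
  have hm : ∀ p, ∀ x ∈ g.rc p, (g.remove u).mass x = g.mass x := fun p x hx => by
    have : x ≠ u := fun e => u_rc p (e ▸ hx)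
    simp [Ghost.remove, this]
  refine ⟨fun p => ?_, fun p => ?_, fun p => ?_, fun x hx hp => h.top x id fun p hxp => ?_,
    h.cc_le⟩
  · by_cases hp : p = u
    · subst hp; simp [Ghost.remove]
    · simp only [Ghost.remove, Function.update_of_ne hp, h.rc_eq]
      refine List.filter_congr fun x hx => decide_eq_decide.2 (and_congr (hT x ?_ ?_) (hR x p hx hp))
      · rw [hf.own_eq hx]; exact hf.own_ne hx
      · exact fun e => hu p (e ▸ hx)
  · by_cases hp : p = u
    · subst hp; simp [Ghost.remove, Run.total]
    · have : (g.remove u).rc p = g.rc p := by simp [Ghost.remove, hp]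
      rw [this, total_congr (hm p), ← h.mass_eq]
      simp [Ghost.remove, hp]
  · by_cases hp : p = u
    · subst hp; simp [Ghost.remove, Lab]
    · have : (g.remove u).rc p = g.rc p := by simp [Ghost.remove, hp]
      rw [this]
      exact (h.lab p).congr (hm p) fun _ _ => rfl
  · have hpu : p ≠ u := by
      rintro rfl
      exact hx (h.mem_rc.1 hxp).1
    exact hp p (by simpa [Ghost.remove, hpu] using hxp)

theorem Ghost.Phi_remove {A : Finset I} (hu : u ∈ A) :
    (g.remove u).Phi A ≤ g.Phi A - 9 * Run.tv ((g.rc u).map g.cc) := by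
  have := sum_le_two (A := A) (f := g.phi) (f' := (g.remove u).phi) (v := u) (z := u)
    (a := - 9 * Run.tv ((g.rc u).map g.cc)) (b := 0) hu hu fun x => ?_
  · simp only [Ghost.Phi]
    linarith
  by_cases e : x = u
  · subst e
    simp only [Ghost.phi, Ghost.remove, Function.update_self, if_true, List.map_nil]
    cases (g.rc x).map g.cc with
    | nil => simp [Run.tv]
    | cons y l => simp only [Run.tv]; push_cast; omega
  · simp [Ghost.phi, Ghost.remove, e]

theorem Ghost.logMass_remove {A : Finset I} (hu : u ∈ A) :
    (g.remove u).logMass A = g.logMass A - Nat.log 2 (g.mass u) := by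
  have := sum_eq_one (A := A) (f := fun x => (Nat.log 2 (g.mass x) : ℤ))
    (f' := fun x => (Nat.log 2 ((g.remove u).mass x) : ℤ)) (v := u)
    (a := - (Nat.log 2 (g.mass u) : ℤ)) hu fun x => ?_
  · simp only [Ghost.logMass]
    linarith
  by_cases e : x = u
  · subst e
    simp [Ghost.remove]
  · simp [Ghost.remove, e]

theorem nonreal_remove (hR : ∀ x p, x ∈ ch p → p ≠ u → (Rl x p ↔ Rl' x p))
    (hRu : ∀ x ∈ ch u, Rl x u) (x : I) :
    Nonreal Rl' (Function.update ch u []) x ↔ Nonreal Rl ch x := by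
  constructor
  · rintro ⟨p, h1, h2⟩
    by_cases hp : p = u
    · subst hp; simp at h1
    · rw [Function.update_of_ne hp] at h1
      exact ⟨p, h1, fun h => h2 ((hR x p h1 hp).1 h)⟩
  · rintro ⟨p, h1, h2⟩
    have hp : p ≠ u := by rintro rfl; exact h2 (hRu x h1)
    exact ⟨p, by rwa [Function.update_of_ne hp], fun h => h2 ((hR x p h1 hp).2 h)⟩

omit [DecidableEq I] in
theorem not_nonreal (hu : Free ch u) : ¬ Nonreal Rl ch u := fun ⟨p, hp, _⟩ => hu p hp

theorem Ghost.Ok.topMass_remove {own : I → Option H} (hf : Forest own ch)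
    (h : g.Ok T Rl ch fun _ => False) (hu : Free ch u) (hTu : T u)
    (hT : ∀ x, own x ≠ none → x ≠ u → (T x ↔ T' x))
    {B : Finset I} (huB : u ∈ B) (hB : ∀ x ∈ B, own x ≠ none) (hchB : ∀ x ∈ ch u, x ∈ B) :
    (g.remove u).topMass T' (B.erase u) = g.topMass T B - 1 := by
  classical
  have u_rc := h.not_mem_rc hu
  have h1 : g.topMass T B = g.mass u + g.topMass T (B.erase u) := by
    simp only [Ghost.topMass]
    rw [← Finset.add_sum_erase _ _ huB, if_pos ⟨hTu, u_rc⟩]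
  have h2 : ∑ x ∈ B.erase u, (if x ∈ g.rc u then (g.mass x : ℤ) else 0) = g.mass u - 1 := by
    have h3 : (g.rc u).Nodup := by rw [h.rc_eq]; exact (hf.nodup u).filter _
    rw [← Finset.sum_filter]
    have h4 : (B.erase u).filter (fun x => x ∈ g.rc u) = (g.rc u).toFinset := by
      ext x
      simp only [Finset.mem_filter, Finset.mem_erase, List.mem_toFinset, and_iff_right_iff_imp]
      intro hx
      exact ⟨fun e => u_rc u (e ▸ hx), hchB x (h.mem_rc.1 hx).1⟩
    have h5 : ((g.rc u).map g.mass).sum = ∑ x ∈ (g.rc u).toFinset, g.mass x :=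
      (List.sum_toFinset g.mass h3).symm
    rw [h4, h.mass_eq u, Run.total, h5]
    push_cast
    ring
  have h6 : (g.remove u).topMass T' (B.erase u) = g.topMass T (B.erase u) +
      ∑ x ∈ B.erase u, (if x ∈ g.rc u then (g.mass x : ℤ) else 0) := by
    simp only [Ghost.topMass]
    rw [← Finset.sum_add_distrib]
    refine Finset.sum_congr rfl fun x hx => ?_
    obtain ⟨hxu, hxB⟩ := Finset.mem_erase.1 hx
    have hm : (g.remove u).mass x = g.mass x := by simp [Ghost.remove, hxu]
    have ht : (∀ p, x ∉ (g.remove u).rc p) ↔ ∀ p, p ≠ u → x ∉ g.rc p := by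
      refine forall_congr' fun p => ?_
      by_cases hp : p = u
      · subst hp; simp [Ghost.remove]
      · simp [Ghost.remove, hp]
    rw [hm, ← hT x (hB x hxB) hxu]
    by_cases hr : x ∈ g.rc u
    · have hx1 := h.mem_rc.1 hr
      rw [if_pos ⟨hx1.2.1, ht.2 fun p hp hxp => hp (hf.uniq (h.mem_rc.1 hxp).1 hx1.1)⟩,
        if_neg (fun hh : T x ∧ ∀ p, x ∉ g.rc p => hh.2 u hr), if_pos hr, zero_add]
    · rw [if_neg hr, add_zero]
      refine if_congr (and_congr_right fun _ => ht.trans ⟨fun hh p => ?_, fun hh p _ => hh p⟩) rfl rfl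
      by_cases hp : p = u
      · rwa [hp]
      · exact hh p hp
  rw [h6, h2, h1]
  ring

/-! ### Links of roots outside of a delete-min -/

theorem rootLink_ghost {own : I → Option H} {hp : H} {A B : Finset I} {z v : I}
    (hRT : ∀ t u, Rl t u → T u) (hA : ∀ x, own x ≠ none → x ∈ A)
    (hB : ∀ x, own x = some hp → x ∈ B)
    (hok : g.Ok T Rl ch fun _ => False) (hvz : v ≠ z)
    (hv : Free ch v) (hz : Free ch z) (ov : own v = some hp) (oz : own z = some hp)
    {b : ℕ} (hb : T v → T z → Nat.log 2 (Nat.log 2 (g.mass v + g.mass z)) ≤ b) :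
    ∃ g₁ : Ghost I, g₁.Ok T Rl (link ch z v) (fun _ => False) ∧
      (∀ x, x ≠ z → g₁.mass x = g.mass x) ∧
      g₁.topMass T B = g.topMass T B ∧
      3 * g₁.Phi A - 1800 * g₁.logMass A ≤ 3 * g.Phi A - 1800 * g.logMass A +
        228 * b * ind (T v ∧ T z ∧ Rl v z) := by
  have vA := hA v (by simp [ov])
  have zA := hA z (by simp [oz])
  by_cases hR : T v ∧ Rl v z
  · have hTz := hRT v z hR.2
    have bv := hok.top v id (hok.not_mem_rc hv)
    have bz := hok.top z id (hok.not_mem_rc hz)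
    have hP := hok.Phi_link hvz hv (c := 0) (Nat.zero_le _) vA zA
    have hM := Ghost.logMass_link (g := g) (z := z) (v := v) (c := 0) zA
    refine ⟨g.link z v 0, hok.link hvz hz hv hR.1 hR.2 (Nat.zero_le _) (by simp),
      fun x hx => by simp [Ghost.link, hx], hok.topMass_link hvz hz hv hR.1 hTz (hB v ov) (hB z oz), ?_⟩
    have h1 : Run.Data.b' (g.mass v) (g.mass z) ≤ b :=
      (Run.log_le_log (by rw [add_comm]; omega)).trans (hb hR.1 hTz)
    rw [bv.1, bv.2, bz.1] at hP
    rw [ind_pos ⟨hR.1, hTz, hR.2⟩, hM]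
    simp only [Nat.cast_zero, sub_zero, Nat.abs_cast] at hP
    have h2 : (0 : ℤ) ≤ Run.Data.gam (g.mass v) (g.mass z) := Int.natCast_nonneg _
    zify at h1
    linarith
  · refine ⟨g, hok.link_nonreal hR, fun _ _ => rfl, rfl, ?_⟩
    rw [ind_neg (fun h => hR ⟨h.1, h.2.2⟩)]
    linarith

omit [DecidableEq I] in
theorem mass_le_topMass {B : Finset I} (h : g.Ok T Rl ch X) {v : I} (hv : Free ch v) (hT : T v)
    (hB : v ∈ B) : (g.mass v : ℤ) ≤ g.topMass T B := by
  classical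
  have h1 : (g.mass v : ℤ) = if T v ∧ ∀ p, v ∉ g.rc p then (g.mass v : ℤ) else 0 :=
    (if_pos ⟨hT, h.not_mem_rc hv⟩).symm
  rw [h1]
  exact Finset.single_le_sum (f := fun v => if T v ∧ ∀ p, v ∉ g.rc p then (g.mass v : ℤ) else 0)
    (fun x _ => by positivity) hB

theorem mass_add_le_topMass {B : Finset I} (h : g.Ok T Rl ch X) {v z : I} (hvz : v ≠ z)
    (hv : Free ch v) (hz : Free ch z) (hT : T v) (hTz : T z) (hB : v ∈ B) (hzB : z ∈ B) :
    ((g.mass v + g.mass z : ℕ) : ℤ) ≤ g.topMass T B := by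
  classical
  have h1 := mass_le_topMass h hz hTz (B := B.erase v) (Finset.mem_erase.2 ⟨hvz.symm, hzB⟩)
  have h2 : g.topMass T B = g.mass v + g.topMass T (B.erase v) := by
    simp only [Ghost.topMass]
    rw [← Finset.add_sum_erase _ _ hB, if_pos ⟨hT, h.not_mem_rc hv⟩]
  push_cast
  linarith

end

end SlimHeap

namespace SlimHeap

/-! ### The functions of the number of temporary nodes of a heap -/

/-- The logarithm of `n`, but at least `3`. -/
noncomputable def lgn (n : ℕ) : ℝ := Real.logb 2 (max 8 n : ℕ)

/-- The iterated logarithm of `n`. -/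
noncomputable def llgn (n : ℕ) : ℝ := Real.logb 2 (lgn n)

/-- The sum of the logarithms of the first `n` numbers. -/
def sumLog : ℕ → ℕ
  | 0 => 0
  | n + 1 => sumLog n + Nat.log 2 (n + 1)

theorem lgn_mono {m n : ℕ} (h : m ≤ n) : lgn m ≤ lgn n :=
  Real.logb_le_logb_of_le (by norm_num) (by positivity) (by
    exact_mod_cast max_le_max le_rfl h)

theorem three_le_lgn (n : ℕ) : 3 ≤ lgn n := by
  have h : lgn 0 = 3 := by
    rw [lgn]
    norm_num
    rw [show (8 : ℝ) = 2 ^ (3 : ℝ) by norm_num, Real.logb_rpow (by norm_num) (by norm_num)]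
  exact h ▸ lgn_mono (Nat.zero_le n)

theorem llgn_mono {m n : ℕ} (h : m ≤ n) : llgn m ≤ llgn n :=
  Real.logb_le_logb_of_le (by norm_num) (by linarith [three_le_lgn m]) (lgn_mono h)

theorem one_le_llgn (n : ℕ) : 1 ≤ llgn n := by
  have h : Real.logb 2 2 ≤ llgn n :=
    Real.logb_le_logb_of_le (by norm_num) (by norm_num) (by linarith [three_le_lgn n])
  rwa [Real.logb_self_eq_one (by norm_num)] at h

theorem natLog_le_logb (k : ℕ) (hk : k ≠ 0) : (Nat.log 2 k : ℝ) ≤ Real.logb 2 k := by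
  rw [Real.le_logb_iff_rpow_le (by norm_num) (by positivity), Real.rpow_natCast]
  exact_mod_cast Nat.pow_log_le_self 2 hk

theorem natLog_le_lgn {k n : ℕ} (h : k ≤ n) : (Nat.log 2 k : ℝ) ≤ lgn n := by
  have h1 : Nat.log 2 k ≤ Nat.log 2 (max 8 n) := Nat.log_mono_right (h.trans (le_max_right _ _))
  exact (Nat.cast_le.2 h1).trans (natLog_le_logb _ (by positivity))

theorem natLogLog_le_llgn {k n : ℕ} (h : k ≤ n) : (Nat.log 2 (Nat.log 2 k) : ℝ) ≤ llgn n := by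
  by_cases hk : Nat.log 2 k = 0
  · rw [hk]
    simpa using zero_le_one.trans (one_le_llgn n)
  · refine (natLog_le_logb _ hk).trans
      (Real.logb_le_logb_of_le (by norm_num) (by positivity) (natLog_le_lgn h))

theorem llgn_le_lgn (n : ℕ) : llgn n ≤ lgn n := by
  have h1 := three_le_lgn n
  rw [llgn, Real.logb_le_iff_le_rpow (by norm_num) (by linarith)]
  have h2 := one_add_mul_self_le_rpow_one_add (s := 1) (by norm_num) (p := lgn n) (by linarith)
  norm_num at h2
  linarith

theorem succ_mul_llgn_sub (n : ℕ) : ((n : ℝ) + 1) * (llgn (n + 1) - llgn n) ≤ 3 := by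
  rcases Nat.lt_or_ge n 8 with h | h
  · have h1 : lgn (n + 1) = lgn n := by
      rw [lgn, lgn, max_eq_left (by omega), max_eq_left (by omega)]
    simp [llgn, h1]
  · have hn : (8 : ℝ) ≤ n := by exact_mod_cast h
    have e1 : lgn n = Real.log n / Real.log 2 := by
      rw [lgn, max_eq_right h, Real.logb]
    have e2 : lgn (n + 1) = Real.log (n + 1) / Real.log 2 := by
      rw [lgn, max_eq_right (by omega), Real.logb]; push_cast; rfl
    have l2 : 1 / 2 ≤ Real.log 2 := by linarith [Real.log_two_gt_d9]
    have hl := three_le_lgn n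
    have hlog : 3 / 2 ≤ Real.log n := by
      rw [e1, le_div_iff₀ (by linarith)] at hl
      linarith
    have h1 : Real.log (n + 1) ≤ Real.log n + 1 / n := by
      have : Real.log ((n + 1) / n) ≤ (n + 1) / n - 1 :=
        Real.log_le_sub_one_of_pos (by positivity)
      rw [Real.log_div (by positivity) (by positivity)] at this
      have e : ((n : ℝ) + 1) / n - 1 = 1 / n := by field_simp; ring
      linarith
    have h2 : lgn (n + 1) / lgn n = Real.log (n + 1) / Real.log n := by
      rw [e1, e2]; field_simp
    have h3 : llgn (n + 1) - llgn n = Real.log (Real.log (n + 1) / Real.log n) / Real.log 2 := by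
      rw [llgn, llgn, ← Real.logb_div (by linarith [three_le_lgn (n + 1)]) (by linarith), h2]
      rfl
    have h4 : Real.log (Real.log (n + 1) / Real.log n) ≤ 2 / 3 * (1 / n) := by
      have hpos : 0 < Real.log (n + 1) := by
        apply Real.log_pos; linarith
      refine (Real.log_le_sub_one_of_pos (div_pos hpos (by linarith))).trans ?_
      rw [sub_le_iff_le_add, div_le_iff₀ (by linarith)]
      have : (0 : ℝ) < 1 / n := by positivity
      nlinarith
    have h5 : Real.log (Real.log (n + 1) / Real.log n) / Real.log 2 ≤ 4 / 3 * (1 / n) := by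
      rw [div_le_iff₀ (by linarith)]
      have : (0 : ℝ) < 1 / n := by positivity
      nlinarith
    rw [h3]
    calc ((n : ℝ) + 1) * _ ≤ (n + 1) * (4 / 3 * (1 / n)) :=
          mul_le_mul_of_nonneg_left h5 (by positivity)
      _ = 4 / 3 * (1 + 1 / n) := by field_simp
      _ ≤ 3 := by
        have : (1 : ℝ) / n ≤ 1 / 8 := one_div_le_one_div_of_le (by norm_num) hn
        linarith

theorem llgn_succ_le (n : ℕ) : llgn (n + 1) ≤ llgn n + 3 := by
  have h := succ_mul_llgn_sub n
  have h1 := llgn_mono (Nat.le_succ n)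
  have h2 : (0 : ℝ) ≤ n := Nat.cast_nonneg n
  simp only [Nat.succ_eq_add_one] at h1
  nlinarith

theorem sumLog_add_aux (a b : ℕ) : sumLog a + sumLog b ≤ sumLog (a + b) := by
  induction b with
  | zero => simp [sumLog]
  | succ b ih =>
    rw [← add_assoc, sumLog, sumLog]
    have := Run.log_le_log (show b + 1 ≤ a + b + 1 by omega)
    omega

theorem sumLog_add_aux' {a b : ℕ} (hb : 1 ≤ b) :
    sumLog a + sumLog b + Nat.log 2 (a + 1) ≤ sumLog (a + b) := by
  induction b, hb using Nat.le_induction with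
  | base => simp [sumLog]
  | succ b hb ih =>
    rw [← add_assoc, sumLog, sumLog]
    have := Run.log_le_log (show b + 1 ≤ a + b + 1 by omega)
    omega

theorem sumLog_add {a b : ℕ} (ha : 1 ≤ a) (hb : 1 ≤ b) :
    sumLog a + sumLog b + Nat.log 2 (Nat.log 2 (a + b)) ≤ sumLog (a + b) := by
  wlog h : b ≤ a generalizing a b with H
  · have := H hb ha (by omega)
    rw [add_comm b a] at this
    omega
  · have h1 := sumLog_add_aux' (a := a) hb
    have h2 : Nat.log 2 (a + b) ≤ Nat.log 2 a + 1 := by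
      rw [← Nat.log_mul_base (by norm_num) (by omega)]
      exact Run.log_le_log (by omega)
    have h3 : Nat.log 2 (Nat.log 2 (a + b)) ≤ Nat.log 2 a :=
      calc _ ≤ Nat.log 2 (Nat.log 2 a + 1) := Run.log_le_log h2
        _ ≤ Nat.log 2 a := Nat.lt_succ_iff.1 (Nat.log_lt_self 2 (by omega))
    have h4 := Run.log_le_log (show a ≤ a + 1 by omega)
    omega

/-- What a heap with `n` temporary nodes, `p` of which are cut by a later decrease-key,
contributes to the potential. -/
noncomputable def heapPot (n : ℕ) (p : ℤ) : ℝ := 3615 * (p * llgn n) + 228 * sumLog n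

theorem heapPot_mono_right {n : ℕ} {p q : ℤ} (h : p ≤ q) : heapPot n p ≤ heapPot n q := by
  have h1 := one_le_llgn n
  have h2 : (p : ℝ) ≤ q := by exact_mod_cast h
  have := mul_le_mul_of_nonneg_right h2 (zero_le_one.trans h1)
  simp only [heapPot]
  linarith

end SlimHeap

namespace SlimHeap

section

variable {H I : Type*} [DecidableEq H] [DecidableEq I]

/-- The nodes of the heap `h`. -/
def heapSet (A : Finset I) (own : I → Option H) (h : H) : Finset I :=
  A.filter fun x => own x = some h

open Classical in
/-- The number of temporary nodes of the heap `h`. -/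
noncomputable def num (A : Finset I) (T : I → Prop) (own : I → Option H) (h : H) : ℕ :=
  ((heapSet A own h).filter T).card

/-- The number of temporary nodes of the heap `h` that will be cut by a decrease-key. -/
noncomputable def pnum (A : Finset I) (T : I → Prop) (Rl : I → I → Prop) (ch : I → List I)
    (own : I → Option H) (h : H) : ℤ :=
  cnt (heapSet A own h) fun x => T x ∧ Nonreal Rl ch x

/-- Validity of the ghost variables of a forest. -/
structure Core (A : Finset I) (T : I → Prop) (Rl : I → I → Prop) (ch : I → List I)
    (own : I → Option H) (g : Ghost I) : Prop where
  forest : Forest own ch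
  mem_A : ∀ x, own x ≠ none → x ∈ A
  ok : g.Ok T Rl ch fun _ => False
  topMass : ∀ h, g.topMass T (heapSet A own h) ≤ num A T own h

/-- The potential of a forest. -/
noncomputable def chi (A : Finset I) (HS : Finset H) (T : I → Prop) (Rl : I → I → Prop)
    (ch : I → List I) (own : I → Option H) (g : Ghost I) : ℝ :=
  ((3 * g.Phi A - 1800 * g.logMass A - cnt A (Nonreal Rl ch) : ℤ) : ℝ) -
    ∑ h ∈ HS, heapPot (num A T own h) (pnum A T Rl ch own h)

variable {A : Finset I} {HS : Finset H} {T T' : I → Prop} {Rl Rl' : I → I → Prop}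
  {ch : I → List I} {own : I → Option H} {g : Ghost I}

omit [DecidableEq H] [DecidableEq I] in
theorem cnt_mono {B : Finset I} {P Q : I → Prop} (h : ∀ x ∈ B, P x → Q x) : cnt B P ≤ cnt B Q := by
  refine Finset.sum_le_sum fun x hx => ?_
  by_cases hP : P x
  · rw [ind_pos hP, ind_pos (h x hx hP)]
  · rw [ind_neg hP]; exact ind_nonneg _

omit [DecidableEq H] [DecidableEq I] in
theorem cnt_congr {B : Finset I} {P Q : I → Prop} (h : ∀ x ∈ B, (P x ↔ Q x)) : cnt B P = cnt B Q :=
  Finset.sum_congr rfl fun x hx => ind_congr (h x hx)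

omit [DecidableEq H] [DecidableEq I] in
theorem cnt_nonneg (B : Finset I) (P : I → Prop) : 0 ≤ cnt B P :=
  Finset.sum_nonneg fun _ _ => ind_nonneg _

omit [DecidableEq H] [DecidableEq I] in
theorem cnt_le_card (B : Finset I) (P : I → Prop) : cnt B P ≤ B.card := by
  refine (Finset.sum_le_sum fun x _ => ind_le_one (P x)).trans ?_
  simp

omit [DecidableEq I] in
theorem cnt_eq_num (A : Finset I) (T : I → Prop) (own : I → Option H) (h : H) :
    cnt (heapSet A own h) T = num A T own h := by
  classical
  simp [cnt, ind, num, Finset.sum_boole]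

omit [DecidableEq I] in
theorem pnum_le_num (h : H) : pnum A T Rl ch own h ≤ num A T own h := by
  rw [← cnt_eq_num]
  exact cnt_mono fun x _ hx => hx.1

omit [DecidableEq I] in
theorem mem_heapSet {h : H} {x : I} : x ∈ heapSet A own h ↔ x ∈ A ∧ own x = some h := by
  simp [heapSet]

omit [DecidableEq I] in
theorem Core.mem_heapSet (hc : Core A T Rl ch own g) {h : H} {x : I} (hx : own x = some h) :
    x ∈ heapSet A own h := SlimHeap.mem_heapSet.2 ⟨hc.mem_A x (by simp [hx]), hx⟩

omit [DecidableEq I] in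
theorem Core.mass_le (hc : Core A T Rl ch own g) {h : H} {x : I} (hx : own x = some h)
    (hf : Free ch x) (hT : T x) : g.mass x ≤ num A T own h := by
  have := (mass_le_topMass hc.ok hf hT (hc.mem_heapSet hx)).trans (hc.topMass h)
  exact_mod_cast this

theorem Core.mass_add_le (hc : Core A T Rl ch own g) {h : H} {x y : I} (hxy : x ≠ y)
    (hx : own x = some h) (hy : own y = some h) (hfx : Free ch x) (hfy : Free ch y) (hTx : T x)
    (hTy : T y) : g.mass x + g.mass y ≤ num A T own h := by
  have := (mass_add_le_topMass hc.ok hxy hfx hfy hTx hTy (hc.mem_heapSet hx)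
    (hc.mem_heapSet hy)).trans (hc.topMass h)
  exact_mod_cast this

omit [DecidableEq H] [DecidableEq I] in
theorem topMass_congr {g' : Ghost I} {B : Finset I} (hT : ∀ x ∈ B, (T' x ↔ T x))
    (hm : ∀ x ∈ B, g'.mass x = g.mass x)
    (ht : ∀ x ∈ B, ((∀ p, x ∉ g'.rc p) ↔ ∀ p, x ∉ g.rc p)) : g'.topMass T' B = g.topMass T B := by
  classical
  refine Finset.sum_congr rfl fun x hx => ?_
  rw [hm x hx]
  exact if_congr (and_congr (hT x hx) (ht x hx)) rfl rfl

omit [DecidableEq I] in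
/-- Real links may be redefined outside of the lists of children. -/
theorem Core.congr_real (hc : Core A T Rl ch own g)
    (hR : ∀ x p, x ∈ ch p → (Rl x p ↔ Rl' x p)) :
    Core A T Rl' ch own g ∧ chi A HS T Rl' ch own g = chi A HS T Rl ch own g := by
  classical
  have hn : ∀ x, Nonreal Rl' ch x ↔ Nonreal Rl ch x := fun x =>
    ⟨fun ⟨p, h1, h2⟩ => ⟨p, h1, by rwa [hR x p h1]⟩, fun ⟨p, h1, h2⟩ => ⟨p, h1, by rwa [← hR x p h1]⟩⟩
  refine ⟨⟨hc.forest, hc.mem_A, ⟨fun v => ?_, hc.ok.mass_eq, hc.ok.lab, hc.ok.top, hc.ok.cc_le⟩,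
    hc.topMass⟩, ?_⟩
  · rw [hc.ok.rc_eq]
    exact List.filter_congr fun x hx => decide_eq_decide.2 (and_congr_right fun _ => hR x v hx)
  · have h1 : Nonreal Rl' ch = Nonreal Rl ch := funext fun x => propext (hn x)
    simp only [chi, pnum, h1]

theorem Core.linkRoots (hc : Core A T Rl ch own g) (HS : Finset H) (hRT : ∀ t u, Rl t u → T u)
    {h : H} {z v : I} (hvz : v ≠ z) (hv : Free ch v) (hz : Free ch z) (ov : own v = some h)
    (oz : own z = some h) {b : ℕ} (hb : Nat.log 2 (Nat.log 2 (num A T own h)) ≤ b) :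
    ∃ g', Core A T Rl (link ch z v) own g' ∧
      chi A HS T Rl (link ch z v) own g' ≤ chi A HS T Rl ch own g + 228 * b * ind (T v ∧ T z) := by
  obtain ⟨g', h1, h2, h3, h4⟩ := rootLink_ghost (b := b) hRT hc.mem_A
    (fun x hx => hc.mem_heapSet hx) hc.ok hvz hv hz ov oz (fun hT hT' =>
      (Run.log_le_log (Run.log_le_log (hc.mass_add_le hvz ov oz hv hz hT hT'))).trans hb)
  have hf := hc.forest.link hv (ov.trans oz.symm) (by simp [oz])
  have hmem : ∀ x p, x ≠ v → (x ∈ link ch z v p ↔ x ∈ ch p) := fun x p hx => by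
    rw [mem_link]; simp [hx]
  have hn : ∀ x, Nonreal Rl ch x → Nonreal Rl (link ch z v) x := fun x ⟨p, h5, h6⟩ =>
    ⟨p, mem_link.2 (.inr h5), h6⟩
  refine ⟨g', ⟨hf, hc.mem_A, h1, fun h' => ?_⟩, ?_⟩
  · by_cases hh : h' = h
    · subst hh; rw [h3]; exact hc.topMass h'
    · refine (topMass_congr (fun _ _ => Iff.rfl) (fun x hx => ?_) fun x hx => ?_).trans_le
        (hc.topMass h')
      · refine h2 x ?_
        rintro rfl
        exact hh (by simpa [oz, eq_comm] using (SlimHeap.mem_heapSet.1 hx).2)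
      · have hxv : x ≠ v := by
          rintro rfl
          exact hh (by simpa [ov, eq_comm] using (SlimHeap.mem_heapSet.1 hx).2)
        exact forall_congr' fun p => not_congr (by rw [h1.mem_rc, hc.ok.mem_rc, hmem x p hxv])
  · have i1 : cnt A (Nonreal Rl ch) ≤ cnt A (Nonreal Rl (link ch z v)) :=
      cnt_mono fun x _ hx => hn x hx
    have i2 : ∑ h ∈ HS, heapPot (num A T own h) (pnum A T Rl ch own h) ≤
        ∑ h ∈ HS, heapPot (num A T own h) (pnum A T Rl (link ch z v) own h) :=
      Finset.sum_le_sum fun h' _ => heapPot_mono_right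
        (cnt_mono fun x _ hx => ⟨hx.1, hn x hx.2⟩)
    have i3 : ind (T v ∧ T z ∧ Rl v z) ≤ ind (T v ∧ T z) := by
      by_cases hh : T v ∧ T z
      · rw [ind_pos hh]; exact ind_le_one _
      · rw [ind_neg hh, ind_neg fun h => hh ⟨h.1, h.2.1⟩]
    have i4 : (228 * b : ℤ) * ind (T v ∧ T z ∧ Rl v z) ≤ 228 * b * ind (T v ∧ T z) :=
      mul_le_mul_of_nonneg_left i3 (by positivity)
    have i5 : 3 * g'.Phi A - 1800 * g'.logMass A - cnt A (Nonreal Rl (link ch z v)) ≤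
        3 * g.Phi A - 1800 * g.logMass A - cnt A (Nonreal Rl ch) + 228 * b * ind (T v ∧ T z) := by
      linarith
    have i6 : ((3 * g'.Phi A - 1800 * g'.logMass A - cnt A (Nonreal Rl (link ch z v)) : ℤ) : ℝ) ≤
      ((3 * g.Phi A - 1800 * g.logMass A - cnt A (Nonreal Rl ch) +
        228 * b * ind (T v ∧ T z) : ℤ) : ℝ) := by exact_mod_cast i5
    simp only [chi]
    push_cast at i6 ⊢
    linarith

omit [DecidableEq I] in
theorem sum_heap_le {f f' : H → ℝ} {h : H} {δ : ℝ} (hh : h ∈ HS)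
    (hf : ∀ h', f h' ≤ f' h' + if h' = h then δ else 0) :
    ∑ h' ∈ HS, f h' ≤ ∑ h' ∈ HS, f' h' + δ := by
  refine (Finset.sum_le_sum fun h' _ => hf h').trans ?_
  simp [Finset.sum_add_distrib, hh]

theorem heapPot_add_one {n : ℕ} {p : ℤ} (hp : 0 ≤ p) :
    heapPot n p + 228 * Nat.log 2 (n + 1) ≤ heapPot (n + 1) p := by
  have h1 := llgn_mono (Nat.le_succ n)
  have h2 : (0 : ℝ) ≤ p := by exact_mod_cast hp
  have := mul_le_mul_of_nonneg_left h1 h2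
  simp only [heapPot, sumLog, Nat.succ_eq_add_one] at *
  push_cast
  linarith

/-- A new one-node tree. -/
theorem Core.insert (hc : Core A T Rl ch own g) {h : H} (hh : h ∈ HS) {e : I} (he : own e = none)
    (heA : e ∈ A) :
    Core A T Rl ch (Function.update own e (some h)) g ∧ Free ch e ∧
      chi A HS T Rl ch (Function.update own e (some h)) g ≤ chi A HS T Rl ch own g -
        228 * Nat.log 2 (num A T (Function.update own e (some h)) h) * ind (T e) := by
  classical
  have hf : Free ch e := fun p hp => by
    have h1 := hc.forest.own_eq hp
    have h2 := hc.forest.own_ne hp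
    rw [he] at h1
    exact h2 h1.symm
  have hce : ch e = [] := by
    rw [List.eq_nil_iff_forall_not_mem]
    exact fun x hx => hc.forest.own_ne hx he
  have hne : ∀ x p, x ∈ ch p → x ≠ e ∧ p ≠ e := fun x p hx =>
    ⟨fun h => hf p (h ▸ hx), by rintro rfl; simp [hce] at hx⟩
  have hS : heapSet A (Function.update own e (some h)) h = Insert.insert e (heapSet A own h) := by
    ext x
    by_cases hx : x = e
    · subst hx; simp [SlimHeap.mem_heapSet, heA]
    · simp [SlimHeap.mem_heapSet, hx]
  have hS' : ∀ h', h' ≠ h → heapSet A (Function.update own e (some h)) h' = heapSet A own h' := by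
    intro h' hh'
    ext x
    by_cases hx : x = e
    · subst hx; simp [SlimHeap.mem_heapSet, he, hh'.symm]
    · simp [SlimHeap.mem_heapSet, hx]
  have heS : e ∉ heapSet A own h := by simp [SlimHeap.mem_heapSet, he]
  have hm : g.mass e = 1 := by
    have : g.rc e = [] := by rw [hc.ok.rc_eq, hce]; rfl
    rw [hc.ok.mass_eq, this]; rfl
  have hnum : (num A T (Function.update own e (some h)) h : ℤ) = num A T own h + ind (T e) := by
    rw [← cnt_eq_num, ← cnt_eq_num, hS, cnt, Finset.sum_insert heS, add_comm]
    rfl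
  refine ⟨⟨⟨hc.forest.nodup, hc.forest.uniq, fun {x p} hx => ?_, fun {x p} hx => ?_⟩, fun x hx => ?_,
    hc.ok, fun h' => ?_⟩, hf, ?_⟩
  · obtain ⟨h1, h2⟩ := hne x p hx
    rw [Function.update_of_ne h1, Function.update_of_ne h2]
    exact hc.forest.own_eq hx
  · obtain ⟨h1, h2⟩ := hne x p hx
    rw [Function.update_of_ne h2]
    exact hc.forest.own_ne hx
  · by_cases hxe : x = e
    · subst hxe; exact heA
    · rw [Function.update_of_ne hxe] at hx
      exact hc.mem_A x hx
  · by_cases hh' : h' = h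
    · subst hh'
      rw [hnum, hS, Ghost.topMass, Finset.sum_insert heS, hm]
      have h1 := hc.topMass h'
      simp only [Ghost.topMass] at h1
      have h2 : (if T e ∧ ∀ p, e ∉ g.rc p then ((1 : ℕ) : ℤ) else 0) ≤ ind (T e) := by
        by_cases hT : T e
        · rw [ind_pos hT]; split <;> simp
        · rw [if_neg fun h => hT h.1, ind_neg hT]
      linarith
    · have h1 := hc.topMass h'
      rw [hS' h' hh']
      simpa only [num, hS' h' hh'] using h1
  · have hp : pnum A T Rl ch (Function.update own e (some h)) h = pnum A T Rl ch own h := by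
      rw [pnum, hS, cnt, Finset.sum_insert heS, ind_neg fun h => not_nonreal hf h.2, zero_add]
      rfl
    have key := sum_heap_le (HS := HS) (h := h)
      (f := fun h => heapPot (num A T own h) (pnum A T Rl ch own h))
      (f' := fun h' => heapPot (num A T (Function.update own e (some h)) h')
        (pnum A T Rl ch (Function.update own e (some h)) h'))
      (δ := - (228 * Nat.log 2 (num A T (Function.update own e (some h)) h) * ind (T e))) hh
      fun h' => ?_
    · simp only [chi]
      linarith
    · by_cases hh' : h' = h
      · subst hh'
        simp only [if_true, hp]
        by_cases hT : T e
        · rw [ind_pos hT] at hnum ⊢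
          have e1 : num A T (Function.update own e (some h')) h' = num A T own h' + 1 := by
            exact_mod_cast hnum
          rw [e1]
          have hp0 : 0 ≤ pnum A T Rl ch own h' := cnt_nonneg _ _
          have := heapPot_add_one (n := num A T own h') hp0
          push_cast
          linarith
        · rw [ind_neg hT] at hnum ⊢
          have e1 : num A T (Function.update own e (some h')) h' = num A T own h' := by
            have : (num A T (Function.update own e (some h')) h' : ℤ) = num A T own h' := by
              rw [hnum, add_zero]
            exact_mod_cast this
          rw [e1]
          simp
      · simp only [if_neg hh', add_zero]
        rw [pnum, pnum, num, num, hS' h' hh']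

/-- The map from the nodes to the heaps after a meld. -/
def meldOwn (own : I → Option H) (h₁ h₂ : H) (x : I) : Option H :=
  if own x = some h₂ then some h₁ else own x

theorem Core.meld (hc : Core A T Rl ch own g) {h₁ h₂ : H} (hne : h₁ ≠ h₂) (hh₁ : h₁ ∈ HS)
    (hh₂ : h₂ ∈ HS) :
    Core A T Rl ch (meldOwn own h₁ h₂) g ∧
      num A T (meldOwn own h₁ h₂) h₁ = num A T own h₁ + num A T own h₂ ∧
      chi A HS T Rl ch (meldOwn own h₁ h₂) g ≤ chi A HS T Rl ch own g +
        228 * (sumLog (num A T own h₁) + sumLog (num A T own h₂)) -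
        228 * sumLog (num A T own h₁ + num A T own h₂) := by
  classical
  have hS1 : heapSet A (meldOwn own h₁ h₂) h₁ = heapSet A own h₁ ∪ heapSet A own h₂ := by
    ext x
    simp only [SlimHeap.mem_heapSet, Finset.mem_union, meldOwn]
    split_ifs with h
    · simp [h, hne.symm]
    · simp [h]
  have hd : Disjoint (heapSet A own h₁) (heapSet A own h₂) := by
    rw [Finset.disjoint_left]
    intro x hx hx'
    have := (SlimHeap.mem_heapSet.1 hx).2.symm.trans (SlimHeap.mem_heapSet.1 hx').2
    exact hne (Option.some.inj this)
  have hS2 : heapSet A (meldOwn own h₁ h₂) h₂ = ∅ := by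
    ext x
    simp only [SlimHeap.mem_heapSet, meldOwn, Finset.notMem_empty, iff_false, not_and]
    intro _
    split_ifs with h
    · simpa using hne
    · exact h
  have hS : ∀ h, h ≠ h₁ → h ≠ h₂ → heapSet A (meldOwn own h₁ h₂) h = heapSet A own h := by
    intro h h1 h2
    ext x
    simp only [SlimHeap.mem_heapSet, meldOwn]
    split_ifs with h3
    · simp [h3, h1.symm, h2.symm]
    · rfl
  have hcnt : ∀ P : I → Prop, cnt (heapSet A (meldOwn own h₁ h₂) h₁) P =
      cnt (heapSet A own h₁) P + cnt (heapSet A own h₂) P := fun P => by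
    rw [hS1, cnt, Finset.sum_union hd]; rfl
  have hnum : num A T (meldOwn own h₁ h₂) h₁ = num A T own h₁ + num A T own h₂ := by
    have := hcnt T
    simp only [cnt_eq_num] at this
    exact_mod_cast this
  have hnum2 : num A T (meldOwn own h₁ h₂) h₂ = 0 := by simp [num, hS2]
  have hp2 : pnum A T Rl ch (meldOwn own h₁ h₂) h₂ = 0 := by simp [pnum, hS2, cnt]
  have hp1 : pnum A T Rl ch (meldOwn own h₁ h₂) h₁ =
    pnum A T Rl ch own h₁ + pnum A T Rl ch own h₂ := hcnt _
  refine ⟨⟨⟨hc.forest.nodup, hc.forest.uniq, fun {x p} hx => ?_, fun {x p} hx => ?_⟩, fun x hx => ?_,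
    hc.ok, fun h => ?_⟩, hnum, ?_⟩
  · simp only [meldOwn, hc.forest.own_eq hx]
  · have := hc.forest.own_ne hx
    simp only [meldOwn]
    split_ifs <;> simp [this]
  · refine hc.mem_A x fun h => hx ?_
    simp [meldOwn, h]
  · by_cases h1 : h = h₁
    · subst h1
      rw [hnum, Ghost.topMass, hS1, Finset.sum_union hd]
      have a1 := hc.topMass h
      have a2 := hc.topMass h₂
      simp only [Ghost.topMass] at a1 a2
      push_cast
      linarith
    · by_cases h2 : h = h₂
      · subst h2
        simp [hS2, Ghost.topMass]
      · have a1 := hc.topMass h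
        rw [hS h h1 h2]
        simpa only [num, hS h h1 h2] using a1
  · have hsub : ∀ f : H → ℝ, ∑ h ∈ HS, f h =
        f h₁ + (f h₂ + ∑ h ∈ (HS.erase h₁).erase h₂, f h) := fun f => by
      rw [Finset.add_sum_erase _ _ (Finset.mem_erase.2 ⟨hne.symm, hh₂⟩),
        Finset.add_sum_erase _ _ hh₁]
    have hrest : ∑ h ∈ (HS.erase h₁).erase h₂, heapPot (num A T (meldOwn own h₁ h₂) h)
        (pnum A T Rl ch (meldOwn own h₁ h₂) h) =
        ∑ h ∈ (HS.erase h₁).erase h₂, heapPot (num A T own h) (pnum A T Rl ch own h) := by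
      refine Finset.sum_congr rfl fun h hh => ?_
      simp only [Finset.mem_erase] at hh
      rw [pnum, pnum, num, num, hS h hh.2.1 hh.1]
    simp only [chi]
    rw [hsub, hsub, hrest, hnum, hnum2, hp1, hp2]
    have q1 : (0 : ℝ) ≤ pnum A T Rl ch own h₁ := by exact_mod_cast cnt_nonneg _ _
    have q2 : (0 : ℝ) ≤ pnum A T Rl ch own h₂ := by exact_mod_cast cnt_nonneg _ _
    have m1 := llgn_mono (show num A T own h₁ ≤ num A T own h₁ + num A T own h₂ by omega)
    have m2 := llgn_mono (show num A T own h₂ ≤ num A T own h₁ + num A T own h₂ by omega)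
    have m3 := mul_le_mul_of_nonneg_left m1 q1
    have m4 := mul_le_mul_of_nonneg_left m2 q2
    simp only [heapPot, sumLog]
    push_cast
    linarith

/-- A decrease-key cuts `e`. -/
theorem Core.cut (hc : Core A T Rl ch own g) {h : H} (hh : h ∈ HS) {e : I} (he : own e = some h)
    (hR : ∀ x p, x ∈ ch p → x ≠ e → (Rl x p ↔ Rl' x p)) (hRe : ∀ p, e ∈ ch p → ¬ Rl e p) :
    Core A T Rl' (cut ch e) own g ∧ Free (SlimHeap.cut ch e) e ∧
      chi A HS T Rl' (SlimHeap.cut ch e) own g ≤ chi A HS T Rl ch own g + 1 +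
        3615 * llgn (num A T own h) := by
  classical
  have hmem : ∀ {x p}, x ∈ SlimHeap.cut ch e p ↔ x ≠ e ∧ x ∈ ch p := fun {x p} =>
    (hc.forest.nodup p).mem_erase_iff
  have hn : ∀ x, x ≠ e → (Nonreal Rl' (SlimHeap.cut ch e) x ↔ Nonreal Rl ch x) := fun x hx => by
    refine exists_congr fun p => ?_
    rw [hmem]
    constructor
    · rintro ⟨⟨-, h1⟩, h2⟩
      exact ⟨h1, by rwa [hR x p h1 hx]⟩
    · rintro ⟨h1, h2⟩
      exact ⟨⟨hx, h1⟩, by rwa [← hR x p h1 hx]⟩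
  refine ⟨⟨⟨fun p => (hc.forest.nodup p).erase _, fun h1 h2 => hc.forest.uniq (hmem.1 h1).2
    (hmem.1 h2).2, fun h1 => hc.forest.own_eq (hmem.1 h1).2, fun h1 =>
    hc.forest.own_ne (hmem.1 h1).2⟩, hc.mem_A, ⟨fun p => ?_, hc.ok.mass_eq, hc.ok.lab, hc.ok.top,
    hc.ok.cc_le⟩, hc.topMass⟩, fun p hp => (hmem.1 hp).1 rfl, ?_⟩
  · rw [hc.ok.rc_eq, SlimHeap.cut, (hc.forest.nodup p).erase_eq_filter, List.filter_filter]
    refine List.filter_congr fun x hx => ?_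
    by_cases hxe : x = e
    · subst hxe
      simp [hRe p hx]
    · simp [hxe, hR x p hx hxe]
  · have i1 : cnt A (Nonreal Rl ch) ≤ cnt A (Nonreal Rl' (SlimHeap.cut ch e)) + 1 := by
      have := sum_le_two (A := A) (f := fun x => ind (Nonreal Rl' (SlimHeap.cut ch e) x))
        (f' := fun x => ind (Nonreal Rl ch x)) (v := e) (z := e) (a := 1) (b := 0)
        (hc.mem_A e (by simp [he])) (hc.mem_A e (by simp [he])) fun x => ?_
      · simp only [cnt]; linarith
      · by_cases hx : x = e
        · subst hx
          have h1 := ind_le_one (Nonreal Rl ch x)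
          have h2 := ind_nonneg (Nonreal Rl' (SlimHeap.cut ch x) x)
          simp only [if_true]
          linarith
        · rw [ind_congr (hn x hx)]; simp [hx]
    have i2 := sum_heap_le (HS := HS) (h := h)
      (f := fun h => heapPot (num A T own h) (pnum A T Rl ch own h))
      (f' := fun h => heapPot (num A T own h) (pnum A T Rl' (SlimHeap.cut ch e) own h))
      (δ := 3615 * llgn (num A T own h)) hh fun h' => ?_
    · have i3 : (cnt A (Nonreal Rl ch) : ℝ) ≤ cnt A (Nonreal Rl' (SlimHeap.cut ch e)) + 1 := by
        exact_mod_cast i1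
      simp only [chi]
      push_cast
      linarith
    · by_cases hh' : h' = h
      · subst hh'
        have j1 : pnum A T Rl ch own h' ≤ pnum A T Rl' (SlimHeap.cut ch e) own h' + 1 := by
          have := sum_le_two (A := heapSet A own h')
            (f := fun x => ind (T x ∧ Nonreal Rl' (SlimHeap.cut ch e) x))
            (f' := fun x => ind (T x ∧ Nonreal Rl ch x)) (v := e) (z := e) (a := 1) (b := 0)
            (hc.mem_heapSet he) (hc.mem_heapSet he) fun x => ?_
          · simp only [pnum, cnt]; linarith
          · by_cases hx : x = e
            · subst hx
              have h1 := ind_le_one (T x ∧ Nonreal Rl ch x)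
              have h2 := ind_nonneg (T x ∧ Nonreal Rl' (SlimHeap.cut ch x) x)
              simp only [if_true]
              linarith
            · rw [ind_congr (and_congr_right fun _ => hn x hx)]; simp [hx]
        have j2 := heapPot_mono_right (n := num A T own h') j1
        simp only [if_true]
        refine j2.trans (le_of_eq ?_)
        simp only [heapPot]
        push_cast
        ring
      · simp only [if_neg hh', add_zero]
        refine heapPot_mono_right (cnt_mono fun x hx hx' => ⟨hx'.1, (hn x ?_).2 hx'.2⟩)
        rintro rfl
        exact hh' (by simpa [he, eq_comm] using (SlimHeap.mem_heapSet.1 hx).2)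

end

end SlimHeap

namespace SlimHeap

section

variable {H I : Type*} [DecidableEq H] [DecidableEq I]

omit [DecidableEq H] in
theorem scan_mem_iff {L : List I} {v : I} {R : List I} {f : Bool} {ch : I → List I} {m : ℕ} {r : I}
    {ch' : I → List I} (hs : Scan L v R f ch m r ch') {x : I} (hx : x ∉ v :: (L ++ R)) (p : I) :
    x ∈ ch' p ↔ x ∈ ch p := by
  induction hs with
  | done => rfl
  | left _ ih =>
    simp only [List.cons_append, List.mem_cons, List.mem_append, not_or] at *
    rw [ih ⟨hx.2.1, hx.2.2⟩, mem_link]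
    simp [hx.1]
  | right _ ih =>
    simp only [List.mem_cons, List.mem_append, not_or] at *
    rw [ih ⟨hx.2.2.1, hx.2.1, hx.2.2.2⟩, mem_link]
    simp [hx.1]
  | move _ ih =>
    simp only [List.cons_append, List.mem_cons, List.mem_append, not_or] at *
    exact ih ⟨hx.2.2.1, hx.1, hx.2.1, hx.2.2.2⟩

omit [DecidableEq H] in
theorem scan_mem {L : List I} {v : I} {R : List I} {f : Bool} {ch : I → List I} {m : ℕ} {r : I}
    {ch' : I → List I} (hs : Scan L v R f ch m r ch') {x p : I} (hx : x ∈ ch p) : x ∈ ch' p := by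
  induction hs with
  | done => exact hx
  | left _ ih => exact ih (mem_link.2 (.inr hx))
  | right _ ih => exact ih (mem_link.2 (.inr hx))
  | move _ ih => exact ih hx

omit [DecidableEq H] in
theorem scan_reach {L : List I} {v : I} {R : List I} {f : Bool} {ch : I → List I} {m : ℕ} {r : I}
    {ch' : I → List I} (hs : Scan L v R f ch m r ch') :
    ∀ x ∈ v :: (L ++ R), Relation.ReflTransGen (fun a b => b ∈ ch' a) r x := by
  induction hs with
  | done => simp [Relation.ReflTransGen.refl]
  | @left L u v R f c m r c' hs ih =>
    simp only [List.cons_append, List.mem_cons, List.mem_append] at *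
    rintro x (rfl | rfl | h)
    · exact (ih u (.inl rfl)).tail (scan_mem hs (mem_link.2 (.inl ⟨rfl, rfl⟩)))
    · exact ih x (.inl rfl)
    · exact ih x (.inr h)
  | @right L v w R f c m r c' hs ih =>
    simp only [List.mem_cons, List.mem_append] at *
    rintro x (rfl | h | rfl | h)
    · exact (ih w (.inl rfl)).tail (scan_mem hs (mem_link.2 (.inl ⟨rfl, rfl⟩)))
    · exact ih x (.inr (.inl h))
    · exact ih x (.inl rfl)
    · exact ih x (.inr (.inr h))
  | move _ ih =>
    simp only [List.cons_append, List.mem_cons, List.mem_append] at *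
    rintro x (rfl | h | rfl | h)
    · exact ih x (.inr (.inl rfl))
    · exact ih x (.inr (.inr (.inl h)))
    · exact ih x (.inl rfl)
    · exact ih x (.inr (.inr (.inr h)))

theorem heapPot_succ_le {n : ℕ} {p : ℤ} (hp : p ≤ n + 1) :
    heapPot (n + 1) p ≤ heapPot n p + 10845 + 228 * lgn (n + 1) := by
  have h1 := succ_mul_llgn_sub n
  have h2 := llgn_mono (Nat.le_succ n)
  have h3 : (p : ℝ) ≤ n + 1 := by exact_mod_cast hp
  have h4 := mul_le_mul_of_nonneg_right h3 (sub_nonneg.2 h2)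
  have h5 := natLog_le_lgn (le_refl (n + 1))
  simp only [heapPot, sumLog, Nat.succ_eq_add_one] at *
  push_cast at *
  linarith

variable {A : Finset I} {HS : Finset H} {T T' : I → Prop} {Rl Rl' : I → I → Prop}
  {ch : I → List I} {own : I → Option H} {g : Ghost I} {u : I} {h : H}

theorem heapSet_remove (h' : H) :
    heapSet A (Function.update own u none) h' = (heapSet A own h').erase u := by
  ext x
  by_cases hx : x = u
  · subst hx; simp [mem_heapSet]
  · simp [mem_heapSet, hx]

theorem heapSet_remove_of_ne (ou : own u = some h) {h' : H} (hh : h' ≠ h) :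
    heapSet A (Function.update own u none) h' = heapSet A own h' := by
  rw [heapSet_remove, Finset.erase_eq_of_notMem]
  simp [mem_heapSet, ou, hh.symm]

theorem num_congr (hT : ∀ x, own x ≠ none → x ≠ u → (T x ↔ T' x)) (h' : H) :
    cnt (heapSet A (Function.update own u none) h') T =
      num A T' (Function.update own u none) h' := by
  rw [← cnt_eq_num]
  refine cnt_congr fun x hx => ?_
  rw [heapSet_remove, Finset.mem_erase, mem_heapSet] at hx
  exact hT x (by simp [hx.2.2]) hx.1

theorem Core.num_remove (hc : Core A T Rl ch own g) (ou : own u = some h) (hTu : T u)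
    (hT : ∀ x, own x ≠ none → x ≠ u → (T x ↔ T' x)) :
    num A T own h = num A T' (Function.update own u none) h + 1 := by
  have h1 := num_congr (A := A) hT h
  have h2 := cnt_eq_num A T own h
  rw [cnt, ← Finset.add_sum_erase _ _ (hc.mem_heapSet ou), ind_pos hTu, ← heapSet_remove] at h2
  rw [cnt] at h1
  omega

theorem Core.num_remove_of_ne (ou : own u = some h)
    (hT : ∀ x, own x ≠ none → x ≠ u → (T x ↔ T' x)) {h' : H} (hh : h' ≠ h) :
    num A T own h' = num A T' (Function.update own u none) h' := by
  have h1 := num_congr (A := A) hT h'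
  rw [heapSet_remove_of_ne ou hh, cnt_eq_num] at h1
  exact_mod_cast h1

theorem pnum_remove (hu : Free ch u)
    (hT : ∀ x, own x ≠ none → x ≠ u → (T x ↔ T' x))
    (hR : ∀ x p, x ∈ ch p → p ≠ u → (Rl x p ↔ Rl' x p)) (hRu : ∀ x ∈ ch u, Rl x u) (h' : H) :
    pnum A T' Rl' (Function.update ch u []) (Function.update own u none) h' =
      pnum A T Rl ch own h' := by
  have hn := nonreal_remove hR hRu
  rw [pnum, pnum, heapSet_remove, cnt, cnt]
  refine (Finset.sum_congr rfl fun x hx => ind_congr ?_).trans (Finset.sum_erase _ ?_)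
  · rw [Finset.mem_erase, mem_heapSet] at hx
    rw [hn, hT x (by simp [hx.2.2]) hx.1]
  · exact ind_neg fun h => not_nonreal hu h.2

theorem Core.topMass_remove (hc : Core A T Rl ch own g) (hu : Free ch u) (ou : own u = some h)
    (hTu : T u) (hT : ∀ x, own x ≠ none → x ≠ u → (T x ↔ T' x))
    (hR : ∀ x p, x ∈ ch p → p ≠ u → (Rl x p ↔ Rl' x p)) (h' : H) :
    (g.remove u).topMass T' (heapSet A (Function.update own u none) h') ≤
      num A T' (Function.update own u none) h' := by
  have hok := hc.ok.remove hc.forest hu hT hR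
  by_cases hh : h' = h
  · subst hh
    have h1 := hc.ok.topMass_remove hc.forest hu hTu hT (hc.mem_heapSet ou)
      (fun x hx => by simp [(SlimHeap.mem_heapSet.1 hx).2])
      fun x hx => hc.mem_heapSet ((hc.forest.own_eq hx).trans ou)
    have h2 := hc.topMass h'
    have h3 := hc.num_remove ou hTu hT
    rw [heapSet_remove, h1]
    omega
  · rw [heapSet_remove_of_ne ou hh, ← Core.num_remove_of_ne ou hT hh]
    refine (topMass_congr (fun x hx => ?_) (fun x hx => ?_) fun x hx => ?_).trans_le
      (hc.topMass h')
    all_goals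
      rw [SlimHeap.mem_heapSet] at hx
      have hxu : x ≠ u := by
        rintro rfl
        rw [ou] at hx
        exact hh (Option.some.inj hx.2).symm
    · exact (hT x (by simp [hx.2]) hxu).symm
    · simp [Ghost.remove, hxu]
    · refine forall_congr' fun p => not_congr ?_
      by_cases hp : p = u
      · subst hp
        have : x ∉ g.rc p := fun hxp => by
          have := (hc.forest.own_eq (hc.ok.mem_rc.1 hxp).1).symm.trans hx.2
          rw [ou] at this
          exact hh (Option.some.inj this).symm
        simp [Ghost.remove, this]
      · simp [Ghost.remove, hp]

theorem Core.mem_remove (hc : Core A T Rl ch own g) (x : I)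
    (hx : Function.update own u none x ≠ none) : x ∈ A := by
  by_cases hxu : x = u
  · subst hxu; simp at hx
  · rw [Function.update_of_ne hxu] at hx
    exact hc.mem_A x hx

/-- The effect of a delete-min on the heap potentials, where at least `D` new nodes will be cut by
a decrease-key. -/
theorem heapPot_remove (hc : Core A T Rl ch own g) (hh : h ∈ HS) (hu : Free ch u)
    (ou : own u = some h) (hTu : T u) (hT : ∀ x, own x ≠ none → x ≠ u → (T x ↔ T' x))
    (hR : ∀ x p, x ∈ ch p → p ≠ u → (Rl x p ↔ Rl' x p)) (hRu : ∀ x ∈ ch u, Rl x u)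
    {ch' : I → List I} (hch : ∀ x p, x ∈ Function.update ch u [] p → x ∈ ch' p) :
    ∑ h ∈ HS, heapPot (num A T own h) (pnum A T Rl ch own h) ≤
      ∑ h ∈ HS, heapPot (num A T' (Function.update own u none) h)
        (pnum A T' Rl' ch' (Function.update own u none) h) +
      (10845 + 228 * lgn (num A T own h) -
        3615 * llgn (num A T' (Function.update own u none) h) *
          (pnum A T' Rl' ch' (Function.update own u none) h -
            pnum A T' Rl' (Function.update ch u []) (Function.update own u none) h)) := by
  have hnr : ∀ x, Nonreal Rl' (Function.update ch u []) x → Nonreal Rl' ch' x :=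
    fun x ⟨p, h1, h2⟩ => ⟨p, hch x p h1, h2⟩
  refine sum_heap_le hh fun h' => ?_
  rw [← pnum_remove hu hT hR hRu h']
  by_cases h1 : h' = h
  · subst h1
    rw [if_pos rfl, hc.num_remove ou hTu hT]
    have h2 : pnum A T' Rl' (Function.update ch u []) (Function.update own u none) h' ≤
      num A T' (Function.update own u none) h' := pnum_le_num h'
    have h3 := heapPot_succ_le (h2.trans (le_add_of_nonneg_right zero_le_one))
    simp only [heapPot] at h3 ⊢
    linarith
  · rw [if_neg h1, add_zero, Core.num_remove_of_ne ou hT h1]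
    exact heapPot_mono_right (cnt_mono fun x _ hx => ⟨hx.1, hnr x hx.2⟩)

/-- Deletion of the last node of a heap. -/
theorem Core.deleteLast (hc : Core A T Rl ch own g) (hh : h ∈ HS) (hu : Free ch u)
    (ou : own u = some h) (hTu : T u) (hT : ∀ x, own x ≠ none → x ≠ u → (T x ↔ T' x))
    (hR : ∀ x p, x ∈ ch p → p ≠ u → (Rl x p ↔ Rl' x p)) (hcu : ch u = []) :
    Core A T' Rl' ch (Function.update own u none) (g.remove u) ∧
      chi A HS T' Rl' ch (Function.update own u none) (g.remove u) ≤ chi A HS T Rl ch own g +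
        8000 * lgn (num A T own h) := by
  have e : Function.update ch u [] = ch := by rw [← hcu, Function.update_eq_self]
  have hRu : ∀ x ∈ ch u, Rl x u := by simp [hcu]
  have hf := hc.forest.remove hu
  have hok := hc.ok.remove hc.forest hu hT hR
  have hn := nonreal_remove hR hRu
  have hpot := heapPot_remove hc hh hu ou hTu hT hR hRu (fun x p h => h)
  rw [e] at hf hok hpot
  have hP := Ghost.Phi_remove (g := g) (hc.mem_A u (by simp [ou]))
  have hM := Ghost.logMass_remove (g := g) (hc.mem_A u (by simp [ou]))
  have hN : cnt A (Nonreal Rl' ch) = cnt A (Nonreal Rl ch) := cnt_congr fun x _ => by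
    have := hn x; rwa [e] at this
  refine ⟨⟨hf, hc.mem_remove, ⟨hok.rc_eq, hok.mass_eq, hok.lab, fun x _ => hok.top x (by simp [hcu]),
    hok.cc_le⟩, hc.topMass_remove hu ou hTu hT hR⟩, ?_⟩
  have i1 : 3 * (g.remove u).Phi A - 1800 * (g.remove u).logMass A - cnt A (Nonreal Rl' ch) ≤
      3 * g.Phi A - 1800 * g.logMass A - cnt A (Nonreal Rl ch) + 1800 * Nat.log 2 (g.mass u) := by
    have : (0 : ℤ) ≤ Run.tv ((g.rc u).map g.cc) := by positivity
    rw [hM, hN]; linarith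
  have i2 : ((3 * (g.remove u).Phi A - 1800 * (g.remove u).logMass A - cnt A (Nonreal Rl' ch) : ℤ) : ℝ)
    ≤ ((3 * g.Phi A - 1800 * g.logMass A - cnt A (Nonreal Rl ch) +
      1800 * Nat.log 2 (g.mass u) : ℤ) : ℝ) := by exact_mod_cast i1
  have i3 := natLog_le_lgn (hc.mass_le ou hu hTu)
  have i4 := three_le_lgn (num A T own h)
  simp only [chi]
  push_cast at i2 ⊢
  simp only [sub_self, mul_zero, sub_zero] at hpot
  linarith

/-- Deletion of a root with children. -/
theorem Core.deleteLink (hc : Core A T Rl ch own g) (hh : h ∈ HS) (hu : Free ch u)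
    (ou : own u = some h) (hTu : T u) (hT : ∀ x, own x ≠ none → x ≠ u → (T x ↔ T' x))
    (hR : ∀ x p, x ∈ ch p → p ≠ u → (Rl x p ↔ Rl' x p)) (hRu : ∀ x ∈ ch u, Rl x u)
    (hRT : ∀ t u, Rl' t u → T' u) {v : I} {R : List I} (hcu : ch u = v :: R) {m : ℕ} {r : I}
    {ch' : I → List I} (hs : Scan [] v R false (Function.update ch u []) m r ch') :
    ∃ g', Core A T' Rl' ch' (Function.update own u none) g' ∧ Free ch' r ∧
      Function.update own u none r = some h ∧
      m + chi A HS T' Rl' ch' (Function.update own u none) g' ≤ chi A HS T Rl ch own g +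
        8000 * lgn (num A T own h) := by
  classical
  have hf := hc.forest.remove hu
  have hok := hc.ok.remove hc.forest hu hT hR
  have hn := nonreal_remove hR hRu
  have hP := Ghost.Phi_remove (g := g) (hc.mem_A u (by simp [ou]))
  have hM := Ghost.logMass_remove (g := g) (hc.mem_A u (by simp [ou]))
  have hN : cnt A (Nonreal Rl' (Function.update ch u [])) = cnt A (Nonreal Rl ch) :=
    cnt_congr fun x _ => hn x
  have hcne : ∀ x ∈ ch u, x ≠ u := fun x hx e => hu u (e ▸ hx)
  have hrc : temps T' (ch u) = g.rc u := by
    rw [hc.ok.rc_eq]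
    refine List.filter_congr fun x hx => decide_eq_decide.2 ?_
    rw [← hT x (by rw [hc.forest.own_eq hx]; simp [ou]) (hcne x hx)]
    exact ⟨fun h => ⟨h, hRu x hx⟩, And.left⟩
  have hm : ∀ x ∈ g.rc u, (g.remove u).mass x = g.mass x := fun x hx => by
    simp [Ghost.remove, hcne x (hc.ok.mem_rc.1 hx).1]
  have hS : g.mass u = Run.total (g.remove u).mass (temps T' (v :: R)) := by
    rw [← hcu, hrc, total_congr hm, ← hc.ok.mass_eq]
  have hch : ∀ x p, x ∈ Function.update ch u [] p → x ∈ ch' p := fun x p hx => scan_mem hs hx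
  have hpot := heapPot_remove hc hh hu ou hTu hT hR hRu hch
  obtain ⟨g', k1, k2, k3, k4, k5, k6, k7⟩ := process_all (cap := Nat.log 2 (Nat.log 2 (g.mass u)))
    (A := A) (B := heapSet A (Function.update own u none) h) hRT
    hc.mem_remove (fun x hx => SlimHeap.mem_heapSet.2 ⟨hc.mem_remove x (hx ▸ Option.some_ne_none h), hx⟩) hs hf
    (by rw [← hcu]; exact hok) (by rw [← hcu]; exact hc.forest.nodup u)
    (by
      rw [← hcu]
      intro x hx p hp
      by_cases e : p = u
      · subst e; simp at hp
      · rw [Function.update_of_ne e] at hp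
        exact e (hc.forest.uniq hp hx))
    (by
      rw [← hcu]
      intro x hx
      rw [Function.update_of_ne (hcne x hx), hc.forest.own_eq hx, ou])
    (by
      rw [← hcu, hrc]
      exact (hc.ok.lab u).congr hm fun _ _ => rfl) hS rfl
  refine ⟨g', ⟨k2, hc.mem_remove, k1, fun h' => ?_⟩, k3, k4, ?_⟩
  · have h2 := hc.topMass_remove hu ou hTu hT hR h'
    by_cases h1 : h' = h
    · subst h1
      rwa [k6]
    · refine (topMass_congr (fun _ _ => Iff.rfl) (fun x hx => ?_) fun x hx => ?_).trans_le h2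
      all_goals rw [SlimHeap.mem_heapSet] at hx
      · exact k5 x (by rw [hx.2]; simpa using h1)
      · refine forall_congr' fun p => not_congr ?_
        rw [k1.mem_rc, hok.mem_rc, scan_mem_iff hs]
        rw [List.nil_append, ← hcu]
        intro hxu
        have h3 := hx.2
        rw [Function.update_of_ne (hcne x hxu), hc.forest.own_eq hxu, ou] at h3
        exact h1 (Option.some.inj h3).symm
  · rw [← hcu, hrc] at k7
    have e1 : cnt (heapSet A (Function.update own u none) h) (fun x => T' x ∧ Nonreal Rl' ch' x) =
      pnum A T' Rl' ch' (Function.update own u none) h := rfl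
    have e2 : cnt (heapSet A (Function.update own u none) h)
      (fun x => T' x ∧ Nonreal Rl' (Function.update ch u []) x) =
      pnum A T' Rl' (Function.update ch u []) (Function.update own u none) h := rfl
    rw [e1, e2, hN, hM] at k7
    have hD : pnum A T' Rl' (Function.update ch u []) (Function.update own u none) h ≤
        pnum A T' Rl' ch' (Function.update own u none) h :=
      cnt_mono fun x _ ⟨h1, p, h2, h3⟩ => ⟨h1, p, hch x p h2, h3⟩
    generalize pnum A T' Rl' (Function.update ch u []) (Function.update own u none) h = p₀ at *
    generalize hp₁ : pnum A T' Rl' ch' (Function.update own u none) h = p₁ at *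
    have hnum := hc.num_remove ou hTu hT
    have j1 := natLog_le_lgn (hc.mass_le ou hu hTu)
    have j2 := natLogLog_le_llgn (hc.mass_le ou hu hTu)
    have j3 := llgn_succ_le (num A T' (Function.update own u none) h)
    have j4 := one_le_llgn (num A T' (Function.update own u none) h)
    have j5 := three_le_lgn (num A T own h)
    have j6 := llgn_le_lgn (num A T own h)
    rw [← hnum] at j3
    generalize Nat.log 2 (Nat.log 2 (g.mass u)) = cap at *
    generalize Nat.log 2 (g.mass u) = lS at *
    have k8 : (m : ℤ) + (3 * g'.Phi A - 1800 * g'.logMass A - cnt A (Nonreal Rl' ch')) ≤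
        3 * g.Phi A - 1800 * g.logMass A - cnt A (Nonreal Rl ch) + 2460 * lS + 662 +
          723 * (cap + 1) + 723 * (cap + 1) * (p₁ - p₀) := by
      have e3 : (g.remove u).cc = g.cc := rfl
      rw [e3] at k7
      linarith
    have k9 : ((m + (3 * g'.Phi A - 1800 * g'.logMass A - cnt A (Nonreal Rl' ch')) : ℤ) : ℝ) ≤
        ((3 * g.Phi A - 1800 * g.logMass A - cnt A (Nonreal Rl ch) + 2460 * lS + 662 +
          723 * (cap + 1) + 723 * (cap + 1) * (p₁ - p₀) : ℤ) : ℝ) := by exact_mod_cast k8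
    have hD' : (0 : ℝ) ≤ (p₁ : ℝ) - p₀ := by
      have : (p₀ : ℝ) ≤ p₁ := by exact_mod_cast hD
      linarith
    have j7 : 723 * ((cap : ℝ) + 1) * (p₁ - p₀) ≤
        3615 * llgn (num A T' (Function.update own u none) h) * (p₁ - p₀) :=
      mul_le_mul_of_nonneg_right (by linarith) hD'
    simp only [chi]
    push_cast at k9 ⊢
    linarith

end

end SlimHeap

namespace SlimHeap

section

variable {H I K : Type*} [DecidableEq H] [DecidableEq I]

/-- The node `x` is `r` or a descendant of `r`. -/
abbrev Reach (ch : I → List I) (r x : I) : Prop :=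
  Relation.ReflTransGen (fun v w => w ∈ ch v) r x

omit [DecidableEq I] in
theorem Reach.transfer {ch ch' : I → List I} {r w : I} {P : I → Prop}
    (hr : P r ∨ Reach ch' w r)
    (hs : ∀ y x, x ∈ ch y → P x ∨ Reach ch' w x ∨ (¬ P y ∧ x ∈ ch' y)) {x : I}
    (hx : Reach ch r x) : P x ∨ Reach ch' w x := by
  induction hx with
  | refl => exact hr
  | @tail y x _ hyx ih =>
    rcases hs y x hyx with h | h | ⟨h1, h2⟩
    · exact .inl h
    · exact .inr h
    · exact .inr ((ih.resolve_left h1).tail h2)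

omit [DecidableEq H] [DecidableEq I] in
theorem Forest.own_reach {own : I → Option H} {ch : I → List I} (hf : Forest own ch) {r x : I}
    (hx : Reach ch r x) : own x = own r := by
  induction hx with
  | refl => rfl
  | tail _ h ih => exact (hf.own_eq h).trans ih

variable {A : Finset I} {HS : Finset H} {T T' : I → Prop} {Rl Rl' : I → I → Prop}
  {ch : I → List I} {own : I → Option H} {g : Ghost I} {s : State H I K}

/-- The ghost variables of a state are valid, and `own` sends each node to its heap. -/
structure Valid (A : Finset I) (T : I → Prop) (Rl : I → I → Prop) (s : State H I K)
    (own : I → Option H) (g : Ghost I) : Prop where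
  core : Core A T Rl s.children own g
  root : ∀ {h r}, s.root h = some (some r) → own r = some h ∧ Free s.children r
  mem : ∀ {h x}, own x = some h → s.Mem h x

omit [DecidableEq I] in
theorem Valid.mem_iff (hv : Valid A T Rl s own g) {h : H} {x : I} : s.Mem h x ↔ own x = some h := by
  refine ⟨fun ⟨r, h1, h2⟩ => ?_, hv.mem⟩
  rw [hv.core.forest.own_reach h2, (hv.root h1).1]

/-- The number of nonempty trees, for one heap. -/
def full : Option (Option I) → ℤ
  | some (some _) => 1
  | _ => 0

/-- The number of nonempty heaps. -/
def heapCount (HS : Finset H) (root : H → Option (Option I)) : ℤ := ∑ h ∈ HS, full (root h)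

omit [DecidableEq I] in
theorem heapCount_update {h : H} (hh : h ∈ HS) (root : H → Option (Option I))
    (a : Option (Option I)) :
    heapCount HS (Function.update root h a) = heapCount HS root + (full a - full (root h)) := by
  refine sum_eq_one hh fun x => ?_
  by_cases hx : x = h
  · subst hx; simp
  · simp [hx]

omit [DecidableEq H] [DecidableEq I] in
theorem full_nonneg (a : Option (Option I)) : 0 ≤ full a := by
  rcases a with _ | _ | _ <;> simp [full]

theorem RootLink.cases' [LinearOrder K] {key : I → K} {x y r : I} {ch' : I → List I}
    (hl : RootLink key ch x y r ch') :
    ch' = link ch x y ∧ r = x ∨ ch' = link ch y x ∧ r = y := by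
  cases hl with
  | first => exact .inl ⟨rfl, rfl⟩
  | second => exact .inr ⟨rfl, rfl⟩

theorem Core.link_valid (hc : Core A T Rl ch own g) (HS : Finset H) (hRT : ∀ t u, Rl t u → T u)
    {root : H → Option (Option I)} (key : I → K) {x y : I} {h : H}
    (hxy : x ≠ y) (fx : Free ch x) (fy : Free ch y) (ox : own x = some h)
    (oy : own y = some h)
    (hroot : ∀ h' r, h' ≠ h → root h' = some (some r) → own r = some h' ∧ Free ch r)
    (hmem : ∀ h' z, h' ≠ h → own z = some h' → ∃ r, root h' = some (some r) ∧ Reach ch r z)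
    (hmem' : ∀ z, own z = some h → Reach ch x z ∨ Reach ch y z) :
    ∃ g', Valid A T Rl ⟨Function.update root h (some (some x)), link ch x y, key⟩ own g' ∧
      chi A HS T Rl (link ch x y) own g' ≤ chi A HS T Rl ch own g +
        228 * Nat.log 2 (Nat.log 2 (num A T own h)) * ind (T x ∧ T y) := by
  obtain ⟨g', h1, h2⟩ := hc.linkRoots HS hRT hxy.symm fy fx oy ox le_rfl
  have hsub : ∀ {r z}, Reach ch r z → Reach (link ch x y) r z := fun hz =>
    hz.lift id fun _ _ hab => mem_link.2 (.inr hab)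
  refine ⟨g', ⟨h1, fun {h' r} hr => ?_, fun {h' z} hz => ?_⟩, by rwa [and_comm (a := T x)]⟩
  · by_cases hh : h' = h
    · subst hh
      simp only [Function.update_self, Option.some.injEq] at hr
      subst hr
      exact ⟨ox, free_link.2 ⟨fx, hxy⟩⟩
    · simp only [Function.update_of_ne hh] at hr
      obtain ⟨h3, h4⟩ := hroot h' r hh hr
      refine ⟨h3, free_link.2 ⟨h4, ?_⟩⟩
      rintro rfl
      exact hh (Option.some.inj (h3.symm.trans oy))
  · by_cases hh : h' = h
    · subst hh
      refine ⟨x, by simp, ?_⟩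
      rcases hmem' z hz with h3 | h3
      · exact hsub h3
      · exact .head (mem_link.2 (.inl ⟨rfl, rfl⟩)) (hsub h3)
    · obtain ⟨r, h3, h4⟩ := hmem h' z hh hz
      exact ⟨r, by simpa [hh] using h3, hsub h4⟩

/-- The link of two roots in an insertion, meld or decrease-key. -/
theorem Core.rootLink_valid [LinearOrder K] (hc : Core A T Rl ch own g) (HS : Finset H)
    (hRT : ∀ t u, Rl t u → T u) {root : H → Option (Option I)} {key : I → K} {x y r : I}
    {ch' : I → List I} (hl : RootLink key ch x y r ch') {h : H}
    (hxy : x ≠ y) (fx : Free ch x) (fy : Free ch y) (ox : own x = some h)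
    (oy : own y = some h)
    (hroot : ∀ h' r, h' ≠ h → root h' = some (some r) → own r = some h' ∧ Free ch r)
    (hmem : ∀ h' z, h' ≠ h → own z = some h' → ∃ r, root h' = some (some r) ∧ Reach ch r z)
    (hmem' : ∀ z, own z = some h → Reach ch x z ∨ Reach ch y z) :
    ∃ g', Valid A T Rl ⟨Function.update root h (some (some r)), ch', key⟩ own g' ∧
      chi A HS T Rl ch' own g' ≤ chi A HS T Rl ch own g +
        228 * Nat.log 2 (Nat.log 2 (num A T own h)) * ind (T x ∧ T y) := by
  rcases hl.cases' with ⟨rfl, rfl⟩ | ⟨rfl, rfl⟩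
  · exact hc.link_valid HS hRT key hxy fx fy ox oy hroot hmem hmem'
  · rw [and_comm (a := T x)]
    exact hc.link_valid HS hRT key hxy.symm fy fx oy ox hroot hmem fun z hz => (hmem' z hz).symm

omit [DecidableEq I] in
theorem Valid.congr_real (hv : Valid A T Rl s own g) (HS : Finset H)
    (hR : ∀ x p, x ∈ s.children p → (Rl x p ↔ Rl' x p)) :
    Valid A T Rl' s own g ∧ chi A HS T Rl' s.children own g = chi A HS T Rl s.children own g :=
  ⟨⟨(hv.core.congr_real (HS := HS) hR).1, hv.root, hv.mem⟩, (hv.core.congr_real hR).2⟩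

omit [DecidableEq I] in
/-- Without changes of the forest and of the nonempty trees, validity is preserved. -/
theorem Valid.congr_root (hv : Valid A T Rl s own g) {s' : State H I K}
    (hch : s'.children = s.children)
    (hroot : ∀ h r, s'.root h = some (some r) ↔ s.root h = some (some r)) :
    Valid A T Rl s' own g := by
  refine ⟨hch ▸ hv.core, fun hr => ?_, fun hx => ?_⟩
  · rw [hch]; exact hv.root ((hroot _ _).1 hr)
  · obtain ⟨r, h1, h2⟩ := hv.mem hx
    exact ⟨r, (hroot _ _).2 h1, by rwa [hch]⟩

theorem Valid.insertEmpty (hv : Valid A T Rl s own g) {h : H} (hh : h ∈ HS) {e : I} (heA : e ∈ A)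
    (he : ∀ h', ¬ s.Mem h' e) (hs : s.root h = some none) (key : I → K) :
    ∃ own' g', Valid A T Rl ⟨Function.update s.root h (some (some e)),
        Function.update s.children e [], key⟩ own' g' ∧
      chi A HS T Rl (Function.update s.children e []) own' g' ≤ chi A HS T Rl s.children own g := by
  have oe : own e = none := by
    rw [Option.eq_none_iff_forall_ne_some]
    exact fun h' h1 => he h' (hv.mem h1)
  obtain ⟨h1, h2, h3⟩ := hv.core.insert hh oe heA
  have hce : Function.update s.children e [] = s.children := by
    rw [Function.update_eq_self_iff, eq_comm, List.eq_nil_iff_forall_not_mem]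
    exact fun x hx => hv.core.forest.own_ne hx oe
  rw [hce]
  refine ⟨_, g, ⟨h1, fun {h' r} hr => ?_, fun {h' x} hx => ?_⟩, h3.trans ?_⟩
  · by_cases hh' : h' = h
    · subst hh'
      simp only [Function.update_self, Option.some.injEq] at hr
      subst hr
      exact ⟨by simp, h2⟩
    · simp only [Function.update_of_ne hh'] at hr
      have := hv.root hr
      refine ⟨?_, this.2⟩
      rw [Function.update_of_ne, this.1]
      rintro rfl
      simp [oe] at this
  · by_cases hxe : x = e
    · subst hxe
      simp only [Function.update_self, Option.some.injEq] at hx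
      subst hx
      exact ⟨x, by simp, .refl⟩
    · rw [Function.update_of_ne hxe] at hx
      obtain ⟨r, h4, h5⟩ := hv.mem hx
      refine ⟨r, ?_, h5⟩
      have hh' : h' ≠ h := by rintro rfl; simp [hs] at h4
      simpa [hh'] using h4
  · have h4 : (0 : ℝ) ≤ ind (T e) := by exact_mod_cast ind_nonneg _
    have h5 : (0 : ℝ) ≤ 228 * Nat.log 2 (num A T (Function.update own e (some h)) h) * ind (T e) := by
      positivity
    linarith

theorem Valid.insertLink [LinearOrder K] (hv : Valid A T Rl s own g) {h : H} (hh : h ∈ HS)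
    (hRT : ∀ t u, Rl t u → T u) {e : I} (heA : e ∈ A) (he : ∀ h', ¬ s.Mem h' e) {r r' : I}
    (hs : s.root h = some (some r)) {key : I → K} {ch' : I → List I}
    (hl : RootLink key (Function.update s.children e []) r e r' ch') :
    ∃ own' g', Valid A T Rl ⟨Function.update s.root h (some (some r')), ch', key⟩ own' g' ∧
      chi A HS T Rl ch' own' g' ≤ chi A HS T Rl s.children own g := by
  have oe : own e = none := by
    rw [Option.eq_none_iff_forall_ne_some]
    exact fun h' h1 => he h' (hv.mem h1)
  obtain ⟨h1, h2, h3⟩ := hv.core.insert hh oe heA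
  have hce : Function.update s.children e [] = s.children := by
    rw [Function.update_eq_self_iff, eq_comm, List.eq_nil_iff_forall_not_mem]
    exact fun x hx => hv.core.forest.own_ne hx oe
  rw [hce] at hl
  have hr := hv.root hs
  have hre : r ≠ e := by rintro rfl; simp [oe] at hr
  obtain ⟨g', h4, h5⟩ := h1.rootLink_valid (root := s.root) HS hRT hl hre hr.2 h2
    (by rw [Function.update_of_ne hre, hr.1]) (by simp)
    (fun h' r₁ hh' hr₁ => by
      have := hv.root hr₁
      have hne : r₁ ≠ e := by rintro rfl; simp [oe] at this
      rwa [Function.update_of_ne hne])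
    (fun h' z hh' hz => by
      have hne : z ≠ e := by
        rintro rfl
        simp only [Function.update_self, Option.some.injEq] at hz
        exact hh' hz.symm
      rw [Function.update_of_ne hne] at hz
      exact hv.mem hz)
    (fun z hz => by
      by_cases hne : z = e
      · exact .inr (hne ▸ .refl)
      · rw [Function.update_of_ne hne] at hz
        obtain ⟨r₁, h6, h7⟩ := hv.mem hz
        rw [hs] at h6
        simp only [Option.some.injEq] at h6
        exact .inl (h6 ▸ h7))
  refine ⟨_, g', h4, ?_⟩
  generalize num A T (Function.update own e (some h)) h = N at *
  have h6 : (Nat.log 2 (Nat.log 2 N) : ℝ) ≤ Nat.log 2 N := by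
    exact_mod_cast Nat.log_le_self 2 _
  have h7 : (ind (T r ∧ T e) : ℝ) ≤ ind (T e) := by
    have : ind (T r ∧ T e) ≤ ind (T e) := by
      by_cases hT : T e
      · rw [ind_pos hT]; exact ind_le_one _
      · rw [ind_neg hT, ind_neg fun h => hT h.2]
    exact_mod_cast this
  have h8 : (0 : ℝ) ≤ ind (T r ∧ T e) := by exact_mod_cast ind_nonneg _
  have h9 : (Nat.log 2 (Nat.log 2 N) : ℝ) * ind (T r ∧ T e) ≤ Nat.log 2 N * ind (T e) :=
    mul_le_mul h6 h7 h8 (Nat.cast_nonneg _)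
  linarith

theorem Valid.meldLink [LinearOrder K] (hv : Valid A T Rl s own g) {h₁ h₂ : H} (hh₁ : h₁ ∈ HS)
    (hh₂ : h₂ ∈ HS) (hne : h₁ ≠ h₂) (hRT : ∀ t u, Rl t u → T u) {r₁ r₂ r' : I}
    (hs₁ : s.root h₁ = some (some r₁)) (hs₂ : s.root h₂ = some (some r₂)) {ch' : I → List I}
    (hl : RootLink s.key s.children r₁ r₂ r' ch') :
    ∃ own' g', Valid A T Rl
        ⟨Function.update (Function.update s.root h₂ none) h₁ (some (some r')), ch', s.key⟩ own' g' ∧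
      chi A HS T Rl ch' own' g' ≤ chi A HS T Rl s.children own g := by
  obtain ⟨h1, h2, h3⟩ := hv.core.meld hne hh₁ hh₂
  have hr₁ := hv.root hs₁
  have hr₂ := hv.root hs₂
  have hr : r₁ ≠ r₂ := by
    rintro rfl
    exact hne (Option.some.inj (hr₁.1.symm.trans hr₂.1))
  obtain ⟨g', h4, h5⟩ := h1.rootLink_valid (root := Function.update s.root h₂ none) (h := h₁) HS
    hRT hl hr
    hr₁.2 hr₂.2 (by simp [meldOwn, hr₁.1]) (by simp [meldOwn, hr₂.1])
    (fun h' r hh' hr => by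
      by_cases hh : h' = h₂
      · subst hh; simp at hr
      · rw [Function.update_of_ne hh] at hr
        have := hv.root hr
        exact ⟨by simp [meldOwn, this.1, hh], this.2⟩)
    (fun h' z hh' hz => by
      simp only [meldOwn] at hz
      split_ifs at hz with h6
      · exact absurd (Option.some.inj hz).symm hh'
      · have hh : h' ≠ h₂ := by rintro rfl; exact h6 hz
        rw [Function.update_of_ne hh]
        exact hv.mem hz)
    (fun z hz => by
      simp only [meldOwn] at hz
      split_ifs at hz with h6
      · obtain ⟨r, h7, h8⟩ := hv.mem h6
        rw [hs₂] at h7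
        simp only [Option.some.injEq] at h7
        exact .inr (h7 ▸ h8)
      · obtain ⟨r, h7, h8⟩ := hv.mem hz
        rw [hs₁] at h7
        simp only [Option.some.injEq] at h7
        exact .inl (h7 ▸ h8))
  refine ⟨_, g', h4, ?_⟩
  rw [h2] at h5
  by_cases hT : T r₁ ∧ T r₂
  · have h6 := (hv.core.ok.mass_pos r₁).trans (hv.core.mass_le hr₁.1 hr₁.2 hT.1)
    have h7 := (hv.core.ok.mass_pos r₂).trans (hv.core.mass_le hr₂.1 hr₂.2 hT.2)
    have h8 := sumLog_add h6 h7
    have h9 : (sumLog (num A T own h₁) : ℝ) + sumLog (num A T own h₂) +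
      Nat.log 2 (Nat.log 2 (num A T own h₁ + num A T own h₂)) ≤
        sumLog (num A T own h₁ + num A T own h₂) := by exact_mod_cast h8
    rw [ind_pos hT] at h5
    push_cast at h5
    linarith
  · have h8 := sumLog_add_aux (num A T own h₁) (num A T own h₂)
    have h9 : (sumLog (num A T own h₁) : ℝ) + sumLog (num A T own h₂) ≤
        sumLog (num A T own h₁ + num A T own h₂) := by exact_mod_cast h8
    rw [ind_neg hT] at h5
    push_cast at h5
    linarith

theorem Valid.meldLeftEmpty (hv : Valid A T Rl s own g) {h₁ h₂ : H} (hh₁ : h₁ ∈ HS)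
    (hh₂ : h₂ ∈ HS) (hne : h₁ ≠ h₂) {x : Option I} (hs₁ : s.root h₁ = some none)
    (hs₂ : s.root h₂ = some x) :
    ∃ own' g', Valid A T Rl
        { s with root := Function.update (Function.update s.root h₂ none) h₁ (some x) } own' g' ∧
      chi A HS T Rl s.children own' g' ≤ chi A HS T Rl s.children own g := by
  obtain ⟨h1, h2, h3⟩ := hv.core.meld hne hh₁ hh₂
  refine ⟨_, g, ⟨h1, fun {h' r} hr => ?_, fun {h' z} hz => ?_⟩, ?_⟩
  · by_cases hh : h' = h₁
    · subst hh
      simp only [Function.update_self, Option.some.injEq] at hr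
      subst hr
      have := hv.root hs₂
      exact ⟨by simp [meldOwn, this.1], this.2⟩
    · by_cases hh' : h' = h₂
      · subst hh'; simp [hh] at hr
      · simp only [Function.update_of_ne hh, Function.update_of_ne hh'] at hr
        have := hv.root hr
        exact ⟨by simp [meldOwn, this.1, hh'], this.2⟩
  · simp only [meldOwn] at hz
    split_ifs at hz with h6
    · obtain ⟨r, h7, h8⟩ := hv.mem h6
      rw [hs₂] at h7
      obtain rfl := Option.some.inj hz
      exact ⟨r, by simpa using h7, h8⟩
    · obtain ⟨r, h7, h8⟩ := hv.mem hz
      have hh : h' ≠ h₁ := by rintro rfl; simp [hs₁] at h7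
      have hh' : h' ≠ h₂ := by rintro rfl; exact h6 hz
      exact ⟨r, by simpa [hh, hh'] using h7, h8⟩
  · have h8 := sumLog_add_aux (num A T own h₁) (num A T own h₂)
    have h9 : (sumLog (num A T own h₁) : ℝ) + sumLog (num A T own h₂) ≤
        sumLog (num A T own h₁ + num A T own h₂) := by exact_mod_cast h8
    linarith

theorem Valid.decreaseKeyLink [LinearOrder K] (hv : Valid A T Rl s own g) {h : H} (hh : h ∈ HS)
    (hRT : ∀ t u, Rl' t u → T u) {e : I} (he : s.Mem h e) {r r' : I}
    (hR : ∀ x p, x ∈ s.children p → x ≠ e → (Rl x p ↔ Rl' x p))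
    (hRe : ∀ p, e ∈ s.children p → ¬ Rl e p)
    (hs : s.root h = some (some r)) (hne : e ≠ r) {key : I → K} {ch' : I → List I}
    (hl : RootLink key (SlimHeap.cut s.children e) r e r' ch') :
    ∃ own' g', Valid A T Rl' ⟨Function.update s.root h (some (some r')), ch', key⟩ own' g' ∧
      chi A HS T Rl' ch' own' g' ≤ chi A HS T Rl s.children own g + 1 +
        3843 * llgn (num A T own h) := by
  have oe := hv.mem_iff.1 he
  obtain ⟨h1, h2, h3⟩ := hv.core.cut hh oe hR hRe
  have hmem : ∀ {x p}, x ∈ SlimHeap.cut s.children e p ↔ x ≠ e ∧ x ∈ s.children p := fun {x p} =>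
    (hv.core.forest.nodup p).mem_erase_iff
  have hcut : ∀ {r z}, Reach s.children r z →
      Reach (SlimHeap.cut s.children e) e z ∨ Reach (SlimHeap.cut s.children e) r z := by
    intro r z hz
    induction hz with
    | refl => exact .inr .refl
    | @tail y x _ hyx ih =>
      by_cases hxe : x = e
      · exact .inl (hxe ▸ .refl)
      · exact ih.imp (fun h => h.tail (hmem.2 ⟨hxe, hyx⟩)) fun h => h.tail (hmem.2 ⟨hxe, hyx⟩)
  have hfree : ∀ {x}, Free s.children x → Free (SlimHeap.cut s.children e) x := fun hx p hp =>
    hx p (hmem.1 hp).2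
  have hr := hv.root hs
  obtain ⟨g', h4, h5⟩ := h1.rootLink_valid (root := s.root) HS hRT hl hne.symm (hfree hr.2) h2
    hr.1 oe (fun h' r₁ _ hr₁ => ⟨(hv.root hr₁).1, hfree (hv.root hr₁).2⟩)
    (fun h' z hh' hz => by
      obtain ⟨r₁, h6, h7⟩ := hv.mem hz
      refine ⟨r₁, h6, (hcut h7).resolve_left fun h8 => hh' ?_⟩
      exact Option.some.inj (hz.symm.trans ((h1.forest.own_reach h8).trans oe)))
    (fun z hz => by
      obtain ⟨r₁, h6, h7⟩ := hv.mem hz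
      rw [hs] at h6
      simp only [Option.some.injEq] at h6
      subst h6
      exact (hcut h7).symm)
  refine ⟨_, g', h4, ?_⟩
  have h6 := natLogLog_le_llgn (le_refl (num A T own h))
  have h7 : (ind (T r ∧ T e) : ℝ) ≤ 1 := by exact_mod_cast ind_le_one _
  have h8 := mul_le_mul_of_nonneg_left h7
    (by positivity : (0 : ℝ) ≤ 228 * Nat.log 2 (Nat.log 2 (num A T own h)))
  linarith

theorem Valid.deleteMinLast (hv : Valid A T Rl s own g) {h : H} (hh : h ∈ HS) {u : I}
    (hs : s.root h = some (some u)) (hTu : T u) (hT : ∀ x, x ≠ u → (T x ↔ T' x))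
    (hR : ∀ x p, x ∈ s.children p → p ≠ u → (Rl x p ↔ Rl' x p)) (hcu : s.children u = []) :
    ∃ own' g', Valid A T' Rl' { s with root := Function.update s.root h (some none) } own' g' ∧
      chi A HS T' Rl' s.children own' g' ≤ chi A HS T Rl s.children own g +
        8000 * lgn (num A T own h) := by
  have hu := hv.root hs
  obtain ⟨h1, h2⟩ := hv.core.deleteLast hh hu.2 hu.1 hTu (fun x _ => hT x) hR hcu
  refine ⟨_, _, ⟨h1, fun {h' r} hr => ?_, fun {h' z} hz => ?_⟩, h2⟩
  · have hh' : h' ≠ h := by rintro rfl; simp at hr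
    simp only [Function.update_of_ne hh'] at hr
    have := hv.root hr
    refine ⟨?_, this.2⟩
    rw [Function.update_of_ne, this.1]
    rintro rfl
    exact hh' (Option.some.inj (this.1.symm.trans hu.1))
  · have hzu : z ≠ u := by rintro rfl; simp at hz
    rw [Function.update_of_ne hzu] at hz
    obtain ⟨r, h3, h4⟩ := hv.mem hz
    have hh' : h' ≠ h := by
      rintro rfl
      rw [hs] at h3
      simp only [Option.some.injEq] at h3
      subst h3
      rcases h4.cases_head with rfl | ⟨y, h5, -⟩
      · exact hzu rfl
      · simp [hcu] at h5
    exact ⟨r, by simpa [hh'] using h3, h4⟩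

theorem Valid.deleteMinLink (hv : Valid A T Rl s own g) {h : H} (hh : h ∈ HS) {u : I}
    (hs : s.root h = some (some u)) (hTu : T u) (hT : ∀ x, x ≠ u → (T x ↔ T' x))
    (hR : ∀ x p, x ∈ s.children p → p ≠ u → (Rl x p ↔ Rl' x p))
    (hRu : ∀ x ∈ s.children u, Rl x u) (hRT : ∀ t u, Rl' t u → T' u) {v : I} {R : List I}
    (hcu : s.children u = v :: R) {m : ℕ} {r : I} {ch' : I → List I}
    (hsc : Scan [] v R false (Function.update s.children u []) m r ch') :
    ∃ own' g', Valid A T' Rl' ⟨Function.update s.root h (some (some r)), ch', s.key⟩ own' g' ∧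
      m + chi A HS T' Rl' ch' own' g' ≤ chi A HS T Rl s.children own g +
        8000 * lgn (num A T own h) := by
  have hu := hv.root hs
  obtain ⟨g', h1, h2, h3, h4⟩ := hv.core.deleteLink hh hu.2 hu.1 hTu (fun x _ => hT x) hR hRu hRT
    hcu hsc
  have hsub : ∀ {x p}, x ∈ s.children p → p ≠ u → x ∈ ch' p := fun {x p} hx hp =>
    scan_mem hsc (by rwa [Function.update_of_ne hp])
  refine ⟨_, g', ⟨h1, fun {h' r'} hr => ?_, fun {h' z} hz => ?_⟩, h4⟩
  · by_cases hh' : h' = h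
    · subst hh'
      simp only [Function.update_self, Option.some.injEq] at hr
      subst hr
      exact ⟨h3, h2⟩
    · simp only [Function.update_of_ne hh'] at hr
      have h5 := hv.root hr
      refine ⟨?_, fun p hp => ?_⟩
      · rw [Function.update_of_ne, h5.1]
        rintro rfl
        exact hh' (Option.some.inj (h5.1.symm.trans hu.1))
      · rw [scan_mem_iff hsc (by rw [List.nil_append, ← hcu]; exact h5.2 u)] at hp
        by_cases hpu : p = u
        · subst hpu; simp at hp
        · rw [Function.update_of_ne hpu] at hp
          exact h5.2 p hp
  · have hzu : z ≠ u := by rintro rfl; simp at hz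
    rw [Function.update_of_ne hzu] at hz
    obtain ⟨r₀, h5, h6⟩ := hv.mem hz
    by_cases hh' : h' = h
    · subst hh'
      rw [hs] at h5
      simp only [Option.some.injEq] at h5
      subst h5
      refine ⟨r, by simp, ?_⟩
      refine (Reach.transfer (P := fun x => x = u) (.inl rfl) (fun y x hx => ?_) h6).resolve_left hzu
      by_cases hy : y = u
      · subst hy
        rw [hcu] at hx
        exact .inr (.inl (scan_reach hsc x hx))
      · exact .inr (.inr ⟨hy, hsub hx hy⟩)
    · refine ⟨r₀, by simpa [hh'] using h5, ?_⟩
      refine (Reach.transfer (P := fun x => own x = some h) (.inr .refl) (fun y x hx => ?_)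
        h6).resolve_left fun h7 => hh' (Option.some.inj (hz.symm.trans h7))
      by_cases hy : own y = some h
      · exact .inl ((hv.core.forest.own_eq hx).trans hy)
      · exact .inr (.inr ⟨hy, hsub hx fun e => hy (e ▸ hu.1)⟩)

end

end SlimHeap

namespace SlimHeap

section

variable {H I K : Type*} [DecidableEq H] [DecidableEq I] [LinearOrder K]

/-- A bound on the increase of the potential in an operation. -/
noncomputable def Op.cost (A : Finset I) (T : I → Prop) (own : I → Option H) : Op H I K → ℝ
  | .insert _ _ _ => 1
  | .decreaseKey h _ _ => 3845 * llgn (num A T own h)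
  | .deleteMin h => 8000 * lgn (num A T own h)
  | .makeHeap _ => 0
  | .findMin _ => 0
  | .meld _ _ => 0

/-- The items inserted by an operation. -/
def Op.items : Op H I K → Finset I
  | .insert _ e _ => {e}
  | _ => ∅

/-- The heaps changed by an operation. -/
def Op.handles : Op H I K → Finset H
  | .makeHeap h => {h}
  | .insert h _ _ => {h}
  | .decreaseKey h _ _ => {h}
  | .deleteMin h => {h}
  | .meld h₁ h₂ => {h₁, h₂}
  | .findMin _ => ∅

/-- The operation `o`, done in the state `s`, deletes `x`. -/
def State.Deletes (s : State H I K) (o : Op H I K) (x : I) : Prop :=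
  ∃ h, o = .deleteMin h ∧ s.root h = some (some x)

/-- The compatibility of the sets `T`, `T'` of temporary nodes and `Rl`, `Rl'` of real links before
and after an operation. -/
structure Compat (s : State H I K) (o : Op H I K) (T T' : I → Prop) (Rl Rl' : I → I → Prop) :
    Prop where
  temp_iff : ∀ x, ¬ s.Deletes o x → (T x ↔ T' x)
  temp : ∀ x, s.Deletes o x → T x
  real_iff : ∀ x p, x ∈ s.children p → ¬ s.Deletes o p → (∀ h k, o ≠ .decreaseKey h x k) →
    (Rl x p ↔ Rl' x p)
  real : ∀ x p, x ∈ s.children p → s.Deletes o p → Rl x p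
  not_real : ∀ h x k p, o = .decreaseKey h x k → ¬ Rl x p
  temp_of_real : ∀ x p, Rl' x p → T' p

variable {A : Finset I} {HS : Finset H} {T T' : I → Prop} {Rl Rl' : I → I → Prop}
  {own : I → Option H} {g : Ghost I} {s s' : State H I K}

/-- The potential of a state. -/
noncomputable def State.potential (s : State H I K) (A : Finset I) (HS : Finset H) (T : I → Prop)
    (Rl : I → I → Prop) (own : I → Option H) (g : Ghost I) : ℝ :=
  chi A HS T Rl s.children own g + heapCount HS s.root

theorem Valid.step (hv : Valid A T Rl s own g) {o : Op H I K} {m τ : ℕ} (hs : Step s o m τ s')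
    (hA : o.items ⊆ A) (hH : o.handles ⊆ HS) (hc : Compat s o T T' Rl Rl') :
    ∃ own' g', Valid A T' Rl' s' own' g' ∧
      m + s'.potential A HS T' Rl' own' g' ≤
        s.potential A HS T Rl own g + o.cost A T own := by
  have same : (∀ x, ¬ s.Deletes o x) → (∀ h x k, o = .decreaseKey h x k → Free s.children x) →
      T' = T ∧ Valid A T Rl' s own g ∧
        chi A HS T Rl' s.children own g = chi A HS T Rl s.children own g := fun h1 h2 =>
    ⟨funext fun x => propext (hc.temp_iff x (h1 x)).symm, hv.congr_real HS fun x p hx =>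
      hc.real_iff x p hx (h1 p) fun h k e => h2 h x k e p hx⟩
  cases hs with
  | makeHeap h hh =>
    obtain ⟨rfl, h1, h2⟩ := same (by simp [State.Deletes]) (by simp)
    refine ⟨own, g, h1.congr_root rfl fun h' r => ?_, ?_⟩
    · by_cases e : h' = h
      · subst e; simp [hh]
      · simp [e]
    · simp only [State.potential, h2, heapCount_update (hH (by simp [Op.handles] : h ∈ _)), hh, full,
        Op.cost]
      simp
  | findMin h x hh =>
    obtain ⟨rfl, h1, h2⟩ := same (by simp [State.Deletes]) (by simp)
    refine ⟨own, g, h1, ?_⟩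
    simp [State.potential, h2, Op.cost]
  | insertEmpty h e k he hh =>
    obtain ⟨rfl, h1, h2⟩ := same (by simp [State.Deletes]) (by simp)
    have hHS : h ∈ HS := hH (by simp [Op.handles])
    obtain ⟨own', g', h3, h4⟩ := h1.insertEmpty hHS (hA (by simp [Op.items] : e ∈ _))
      he hh (Function.update s.key e k)
    refine ⟨own', g', h3, ?_⟩
    simp only [State.potential, heapCount_update hHS, hh, full, Op.cost]
    push_cast
    linarith
  | insertLink h e k r r' c' he hh hl =>
    obtain ⟨rfl, h1, h2⟩ := same (by simp [State.Deletes]) (by simp)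
    have hHS : h ∈ HS := hH (by simp [Op.handles])
    obtain ⟨own', g', h3, h4⟩ := h1.insertLink hHS hc.temp_of_real
      (hA (by simp [Op.items] : e ∈ _)) he hh hl
    refine ⟨own', g', h3, ?_⟩
    simp only [State.potential, heapCount_update hHS, hh, full, Op.cost]
    push_cast
    linarith
  | meldRightEmpty h₁ h₂ x hne hh₁ hh₂ =>
    obtain ⟨rfl, h1, h2⟩ := same (by simp [State.Deletes]) (by simp)
    refine ⟨own, g, h1.congr_root rfl fun h' r => ?_, ?_⟩
    · by_cases e : h' = h₂
      · subst e; simp [hh₂]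
      · simp [e]
    · simp only [State.potential, h2, heapCount_update (hH (by simp [Op.handles] : h₂ ∈ _)), hh₂, full,
        Op.cost]
      simp
  | meldLeftEmpty h₁ h₂ x hne hh₁ hh₂ =>
    obtain ⟨rfl, h1, h2⟩ := same (by simp [State.Deletes]) (by simp)
    have hHS₁ : h₁ ∈ HS := hH (by simp [Op.handles])
    have hHS₂ : h₂ ∈ HS := hH (by simp [Op.handles])
    obtain ⟨own', g', h3, h4⟩ := h1.meldLeftEmpty hHS₁ hHS₂ hne hh₁ hh₂
    refine ⟨own', g', h3, ?_⟩
    simp only [State.potential, heapCount_update hHS₁, heapCount_update hHS₂,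
      Function.update_of_ne hne, hh₁, hh₂, Op.cost]
    simp only [full]
    push_cast
    linarith
  | meldLink h₁ h₂ r₁ r₂ r' c' hne hh₁ hh₂ hl =>
    obtain ⟨rfl, h1, h2⟩ := same (by simp [State.Deletes]) (by simp)
    have hHS₁ : h₁ ∈ HS := hH (by simp [Op.handles])
    have hHS₂ : h₂ ∈ HS := hH (by simp [Op.handles])
    obtain ⟨own', g', h3, h4⟩ := h1.meldLink hHS₁ hHS₂ hne hc.temp_of_real hh₁ hh₂ hl
    refine ⟨own', g', h3, ?_⟩
    simp only [State.potential, heapCount_update hHS₁, heapCount_update hHS₂,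
      Function.update_of_ne hne, hh₁, hh₂, Op.cost]
    simp only [full]
    push_cast
    linarith
  | decreaseKeyRoot h e k hh hk =>
    obtain ⟨rfl, h1, h2⟩ := same (by simp [State.Deletes]) (by
      rintro h' x k' h3
      obtain ⟨-, rfl, -⟩ := Op.decreaseKey.inj h3
      exact (hv.root hh).2)
    refine ⟨own, g, h1.congr_root rfl fun h' r => Iff.rfl, ?_⟩
    have := one_le_llgn (num A T' own h)
    simp only [State.potential, h2, Op.cost]
    push_cast
    linarith
  | decreaseKeyLink h e k r r' c' he hh hne hk hl =>
    have hd : ∀ x, ¬ s.Deletes (.decreaseKey h e k) x := by simp [State.Deletes]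
    obtain rfl : T' = T := funext fun x => propext (hc.temp_iff x (hd x)).symm
    have hHS : h ∈ HS := hH (by simp [Op.handles])
    obtain ⟨own', g', h3, h4⟩ := hv.decreaseKeyLink hHS hc.temp_of_real he
      (fun x p hx hxe => hc.real_iff x p hx (hd p) fun h' k' h5 =>
        hxe (Op.decreaseKey.inj h5).2.1.symm)
      (fun p _ => hc.not_real h e k p rfl) hh hne hl
    refine ⟨own', g', h3, ?_⟩
    have := one_le_llgn (num A T' own h)
    simp only [State.potential, heapCount_update hHS, hh, full, Op.cost]
    push_cast
    linarith
  | deleteMinLast h u hh hcu =>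
    have hd : ∀ x, s.Deletes (.deleteMin h) x ↔ x = u := fun x => by
      simp only [State.Deletes, Op.deleteMin.injEq, exists_eq_left', hh, Option.some.injEq, eq_comm]
    have hHS : h ∈ HS := hH (by simp [Op.handles])
    obtain ⟨own', g', h3, h4⟩ := hv.deleteMinLast hHS hh (hc.temp u ((hd u).2 rfl))
      (fun x hx => hc.temp_iff x (by rwa [hd]))
      (fun x p hx hp => hc.real_iff x p hx (by rwa [hd]) (by simp)) hcu
    refine ⟨own', g', h3, ?_⟩
    simp only [State.potential, heapCount_update hHS, hh, full, Op.cost]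
    push_cast
    linarith
  | deleteMinLink h u v R m r' c' hh hcu hl =>
    have hd : ∀ x, s.Deletes (.deleteMin h) x ↔ x = u := fun x => by
      simp only [State.Deletes, Op.deleteMin.injEq, exists_eq_left', hh, Option.some.injEq, eq_comm]
    have hHS : h ∈ HS := hH (by simp [Op.handles])
    obtain ⟨own', g', h3, h4⟩ := hv.deleteMinLink hHS hh (hc.temp u ((hd u).2 rfl))
      (fun x hx => hc.temp_iff x (by rwa [hd]))
      (fun x p hx hp => hc.real_iff x p hx (by rwa [hd]) (by simp))
      (fun x hx => hc.real x u hx ((hd u).2 rfl)) hc.temp_of_real hcu (linkAll_shape hl)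
    refine ⟨own', g', h3, ?_⟩
    simp only [State.potential, heapCount_update hHS, hh, full, Op.cost]
    push_cast
    linarith

theorem Step.time_le {o : Op H I K} {m τ : ℕ} (hs : Step s o m τ s') : τ ≤ 3 + 2 * m := by
  cases hs with
  | deleteMinLink h u v R m r' c' hh hcu hl =>
    have := linkAll_steps hl
    omega
  | _ => omega

end

namespace Execution

variable {H I K : Type*} [DecidableEq H] [DecidableEq I] [LinearOrder K]

/-- The node `x` is a child of `u` and remains so until `u` is deleted, with no decrease-key of `x`
in between. -/
inductive IsReal (E : Execution H I K) : ℕ → I → I → Prop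
  | del {t x u} (ht : t < E.T) (hu : (E.state t).Deletes (E.op t) u)
      (hx : x ∈ (E.state t).children u) : IsReal E t x u
  | step {t x u} (hop : ∀ h k, E.op t ≠ .decreaseKey h x k) (h : IsReal E (t + 1) x u) :
      IsReal E t x u

variable {E : Execution H I K}

theorem Temporary.of_succ {t : ℕ} {x : I} (h : E.Temporary (t + 1) x) : E.Temporary t x := by
  obtain ⟨t', h1, h2, h3⟩ := h
  exact ⟨t', h1, by omega, h3⟩

theorem IsReal.temporary {t : ℕ} {x u : I} (h : E.IsReal t x u) : E.Temporary t u := by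
  induction h with
  | @del t x u ht hu hx => exact ⟨t, ht, le_rfl, hu⟩
  | step _ _ ih => exact ih.of_succ

theorem compat {t : ℕ} (ht : t < E.T) :
    Compat (E.state t) (E.op t) (E.Temporary t) (E.Temporary (t + 1)) (E.IsReal t)
      (E.IsReal (t + 1)) := by
  refine ⟨fun x hx => ⟨fun h => ?_, Temporary.of_succ⟩, fun x hx => ⟨t, ht, le_rfl, hx⟩,
    fun x p hx hp hk => ⟨fun h => ?_, IsReal.step hk⟩, fun x p hx hp => .del ht hp hx,
    fun h x k p ho hr => ?_, fun _ _ => IsReal.temporary⟩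
  · obtain ⟨t', h1, h2, h3⟩ := h
    have : t' ≠ t := by rintro rfl; exact hx h3
    exact ⟨t', h1, by omega, h3⟩
  · cases h with
    | del _ hu _ => exact absurd hu hp
    | step _ h => exact h
  · cases hr with
    | del _ hu _ =>
      obtain ⟨h', h1, -⟩ := hu
      rw [ho] at h1
      cases h1
    | step hk _ => exact hk h k ho

/-- All inserted items. -/
def items (E : Execution H I K) : Finset I := (Finset.range E.T).biUnion fun t => (E.op t).items

/-- All handles of changed heaps. -/
def handles (E : Execution H I K) : Finset H :=
  (Finset.range E.T).biUnion fun t => (E.op t).handles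

/-- The ghost variables at the start. -/
def startGhost : Ghost I := ⟨fun _ => [], fun _ => 1, fun _ => 0, fun _ => 0⟩

theorem valid_start {A : Finset I} (E : Execution H I K) :
    Valid A (E.Temporary 0) (E.IsReal 0) (E.state 0) (fun _ => none) startGhost := by
  have h1 := E.start.1
  have h2 := E.start.2
  refine ⟨⟨⟨by simp [h2], by simp [h2], by simp [h2], by simp [h2]⟩, by simp,
    ⟨by simp [h2, startGhost], by simp [startGhost, Run.total], by simp [startGhost, Lab],
      by simp [startGhost], by simp [startGhost]⟩, fun h => ?_⟩, by simp [h1], by simp⟩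
  simp [heapSet, num, Ghost.topMass]

theorem potential_start {A : Finset I} {HS : Finset H} (E : Execution H I K) :
    (E.state 0).potential A HS (E.Temporary 0) (E.IsReal 0) (fun _ => none) startGhost = 0 := by
  have h1 := E.start.1
  have h2 := E.start.2
  have h3 : cnt A (Nonreal (E.IsReal 0) (E.state 0).children) = 0 :=
    Finset.sum_eq_zero fun x _ => ind_neg fun ⟨p, hp, _⟩ => by simp [h2] at hp
  have h4 : ∀ h : H,
      pnum A (E.Temporary 0) (E.IsReal 0) (E.state 0).children (fun _ => none) h = 0 :=
    fun h => by simp [pnum, heapSet, cnt]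
  simp [State.potential, chi, h3, h4, heapCount, h1, full, Ghost.Phi, Ghost.phi, Ghost.logMass,
    startGhost, Run.tv, heapSet, num, heapPot, sumLog]

theorem not_temporary_end (x : I) : ¬ E.Temporary E.T x := fun ⟨t, h1, h2, _⟩ => by omega

theorem potential_end {A : Finset I} {HS : Finset H} {own : I → Option H} {g : Ghost I}
    (hv : Valid A (E.Temporary E.T) (E.IsReal E.T) (E.state E.T) own g) :
    -(A.card : ℝ) ≤
      (E.state E.T).potential A HS (E.Temporary E.T) (E.IsReal E.T) own g := by
  have hok := hv.core.ok
  have h1 : ∀ p, g.rc p = [] := fun p => List.eq_nil_iff_forall_not_mem.2 fun x hx =>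
    not_temporary_end x (hok.mem_rc.1 hx).2.1
  have h2 : ∀ x, g.mass x = 1 := fun x => by rw [hok.mass_eq, h1]; rfl
  have h3 : ∀ x, g.bb x = 0 ∧ g.cc x = 0 := fun x => hok.top x id fun p => by simp [h1]
  have h4 : ∀ h, num A (E.Temporary E.T) own h = 0 := fun h => by
    simp [num, not_temporary_end]
  have h5 : ∀ h, pnum A (E.Temporary E.T) (E.IsReal E.T) (E.state E.T).children own h = 0 :=
    fun h => Finset.sum_eq_zero fun x _ => ind_neg fun hx => not_temporary_end x hx.1
  have h6 : (cnt A (Nonreal (E.IsReal E.T) (E.state E.T).children) : ℝ) ≤ A.card := by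
    exact_mod_cast cnt_le_card _ _
  have h7 : (0 : ℝ) ≤ heapCount HS (E.state E.T).root := by
    exact_mod_cast Finset.sum_nonneg fun h _ => full_nonneg _
  have h8 : g.Phi A = 0 := Finset.sum_eq_zero fun x _ => by
    simp [Ghost.phi, h1, h3, Run.tv]
  have h9 : g.logMass A = 0 := Finset.sum_eq_zero fun x _ => by simp [h2]
  have h10 : ∀ h, heapPot (num A (E.Temporary E.T) own h)
      (pnum A (E.Temporary E.T) (E.IsReal E.T) (E.state E.T).children own h) = 0 := fun h => by
    rw [h4, h5]; simp [heapPot, sumLog]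
  simp only [State.potential, chi, h8, h9, h10, Finset.sum_const_zero]
  push_cast
  linarith

theorem lg_n {A : Finset I} {own : I → Option H} {g : Ghost I} {t : ℕ}
    (hv : Valid A (E.Temporary t) (E.IsReal t) (E.state t) own g) (h : H) :
    lg (E.n t h) = lgn (num A (E.Temporary t) own h) := by
  have h1 : E.n t h = max 8 (num A (E.Temporary t) own h) := by
    classical
    rw [Execution.n, num, ← Set.ncard_coe_finset]
    congr 2
    ext x
    simp only [Set.mem_ofPred_eq, Finset.coe_filter, mem_heapSet, hv.mem_iff]
    exact ⟨fun h2 => ⟨⟨hv.core.mem_A x (by simp [h2.1]), h2.1⟩, h2.2⟩, fun h2 => ⟨h2.1.2, h2.2⟩⟩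
  have h2 := three_le_lgn (num A (E.Temporary t) own h)
  rw [lg, h1]
  exact max_eq_left (by rw [← lgn]; linarith)

theorem cost_le_charge {A : Finset I} {own : I → Option H} {g : Ghost I} {t : ℕ}
    (hv : Valid A (E.Temporary t) (E.IsReal t) (E.state t) own g) :
    (E.op t).cost A (E.Temporary t) own ≤ 8000 * E.charge 0 t := by
  rw [Execution.charge]
  cases E.op t with
  | insert => simp [Op.cost]
  | makeHeap => simp [Op.cost]
  | findMin => simp [Op.cost]
  | meld => simp [Op.cost]
  | deleteMin h => simp [Op.cost, lg_n hv]
  | decreaseKey h e k =>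
    have h1 := one_le_llgn (num A (E.Temporary t) own h)
    have h2 : lg (lg (E.n t h)) = llgn (num A (E.Temporary t) own h) := by
      rw [lg_n hv, lg, ← llgn]
      exact max_eq_left (by linarith)
    simp only [Op.cost, h2]
    linarith

theorem card_items_le (E : Execution H I K) :
    ((E.items).card : ℝ) ≤ ∑ t ∈ Finset.range E.T, E.charge 0 t := by
  have h1 : (E.items).card ≤ ∑ t ∈ Finset.range E.T, (E.op t).items.card := Finset.card_biUnion_le
  have h2 : ∀ t, ((E.op t).items.card : ℝ) ≤ E.charge 0 t := fun t => by
    rw [Execution.charge]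
    cases E.op t <;> simp [Op.items, lg]
  calc ((E.items).card : ℝ) ≤ ((∑ t ∈ Finset.range E.T, (E.op t).items.card : ℕ) : ℝ) := by
        exact_mod_cast h1
    _ ≤ _ := by
        push_cast
        exact Finset.sum_le_sum fun t _ => h2 t

theorem links_le (E : Execution H I K) :
    (∑ t ∈ Finset.range E.T, (E.links t : ℝ)) ≤
      8001 * ∑ t ∈ Finset.range E.T, E.charge 0 t := by
  have key : ∀ t ≤ E.T, ∃ own g,
      Valid E.items (E.Temporary t) (E.IsReal t) (E.state t) own g ∧
      (∑ i ∈ Finset.range t, (E.links i : ℝ)) + (E.state t).potential E.items E.handles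
        (E.Temporary t) (E.IsReal t) own g ≤ 8000 * ∑ i ∈ Finset.range t, E.charge 0 i := by
    intro t
    induction t with
    | zero => exact fun _ => ⟨_, _, E.valid_start, by simp [potential_start]⟩
    | succ t ih =>
      intro ht
      obtain ⟨own, g, h1, h2⟩ := ih (by omega)
      have htr : t ∈ Finset.range E.T := Finset.mem_range.2 ht
      have hA : (E.op t).items ⊆ E.items :=
        Finset.subset_biUnion_of_mem (fun t => (E.op t).items) htr
      have hH : (E.op t).handles ⊆ E.handles :=
        Finset.subset_biUnion_of_mem (fun t => (E.op t).handles) htr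
      obtain ⟨own', g', h3, h4⟩ := h1.step (E.step t ht) hA hH (compat ht)
      have h5 := cost_le_charge h1
      refine ⟨own', g', h3, ?_⟩
      rw [Finset.sum_range_succ, Finset.sum_range_succ]
      linarith
  obtain ⟨own, g, h1, h2⟩ := key E.T le_rfl
  have h3 := potential_end (HS := E.handles) h1
  have h4 := E.card_items_le
  linarith

theorem one_le_charge (E : Execution H I K) (t : ℕ) : 1 ≤ E.charge 1 t := by
  have h1 : ∀ h, 3 ≤ lg (E.n t h) := fun h =>
    (three_le_lgn (Set.ncard {x | (E.state t).Mem h x ∧ E.Temporary t x})).trans (le_max_left _ _)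
  have h2 : ∀ h, 1 ≤ lg (lg (E.n t h)) := fun h => by
    refine le_trans ?_ (le_max_left _ _)
    rw [Real.le_logb_iff_rpow_le (by norm_num) (by linarith [h1 h])]
    norm_num
    linarith [h1 h]
  rw [Execution.charge]
  cases E.op t with
  | deleteMin h => exact (by norm_num : (1 : ℝ) ≤ 3).trans (h1 h)
  | decreaseKey h e k => exact h2 h
  | _ => exact le_rfl

theorem charge_le (E : Execution H I K) (t : ℕ) : E.charge 0 t ≤ E.charge 1 t := by
  rw [Execution.charge, Execution.charge]
  cases E.op t <;> simp

theorem time_le (E : Execution H I K) :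
    (∑ t ∈ Finset.range E.T, (E.time t : ℝ)) ≤
      16005 * ∑ t ∈ Finset.range E.T, E.charge 1 t := by
  have h1 : (∑ t ∈ Finset.range E.T, (E.time t : ℝ)) ≤
      ∑ t ∈ Finset.range E.T, (3 * E.charge 1 t + 2 * (E.links t : ℝ)) :=
    Finset.sum_le_sum fun t ht => by
      have h2 : (E.time t : ℝ) ≤ 3 + 2 * E.links t := by
        exact_mod_cast (E.step t (Finset.mem_range.1 ht)).time_le
      linarith [E.one_le_charge t]
  rw [Finset.sum_add_distrib, ← Finset.mul_sum, ← Finset.mul_sum] at h1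
  have h3 := E.links_le
  have h4 : ∑ t ∈ Finset.range E.T, E.charge 0 t ≤ ∑ t ∈ Finset.range E.T, E.charge 1 t :=
    Finset.sum_le_sum fun t _ => E.charge_le t
  linarith

end Execution

end SlimHeap

theorem theoremT :
    ∃ C : ℝ, 0 < C ∧
      ∀ (H I K : Type*) [DecidableEq H] [DecidableEq I] [LinearOrder K]
        (E : SlimHeap.Execution H I K),
        (∑ t ∈ Finset.range E.T, (E.links t : ℝ)) ≤
            C * ∑ t ∈ Finset.range E.T, E.charge 0 t ∧
        (∑ t ∈ Finset.range E.T, (E.time t : ℝ)) ≤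
            C * ∑ t ∈ Finset.range E.T, E.charge 1 t := by
  refine ⟨16005, by norm_num, fun H I K _ _ _ E => ⟨?_, E.time_le⟩⟩
  have h1 := E.links_le
  have h2 : 0 ≤ ∑ t ∈ Finset.range E.T, E.charge 0 t := (Nat.cast_nonneg _).trans E.card_items_le
  linarith
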